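/- Let $n\ge 2$, let $b\in S^n$ be a base point and let $R$ be a commutative ring (for instance $R=\mathbb Z$). Let $C^*=C^*(S^n;R)$ be the singular cochain algebra of $S^n$ with its cup product, augmented by evaluation of $0$-cochains at $b$, and let $\bar C^*\subset C^*$ be the augmentation ideal. The bar construction $BC^*(S^n)$ is $\bigoplus_{k\ge 0}(\bar C^*)^{\otimes k}$. Its generators $|x_1|\cdots|x_k|$ (with homogeneous $x_i\in\bar C^*$) have weight $k$ and degree $\sum_i(\deg x_i-1)$, and its differential is $$d\,|x_1|\cdots|x_k|=\sum_{i=1}^{k}(-1)^{\varepsilon_{i-1}}|x_1|\cdots|dx_i|\cdots|x_k|+\sum_{i=1}^{k-1}(-1)^{\varepsilon_i}|x_1|\cdots|x_i\smallsmile x_{i+1}|\cdots|x_k|,\qquad \varepsilon_i=\sum_{j\le i}(\deg x_j-1).$$ Let $H^*_B(S^n)$ be its cohomology. Then $H^{n-1}_B(S^n)$ is a free $R$-module of rank one. It is generated by an element of weight one corresponding to a generator of $H^n(S^n;R)$: the $R$-module $H^n(S^n;R)$ is generated by the class of a single cocycle, and for every $n$-cocycle $\omega$ on $S^n$ whose class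 generates $H^n(S^n;R)$, the weight one cocycle $|\omega|$ generates $H^{n-1}_B(S^n)$. -/

import Mathlib

universe u v

noncomputable section

open CategoryTheory Simplicial Opposite
open scoped DirectSum TensorProduct

/-- The `k`-cochains of a simplicial set `K` with coefficients in `R`: all functions from the
`k`-simplices to `R`. -/
def SSetCochain (K : SSet.{v}) (R : Type u) (k : ℕ) : Type (max u v) := K _⦋k⦌ → R

namespace SSetCochain

section Simplices

variable {K : SSet.{v}}

/-- The face of `σ` spanned by the consecutive vertices `j, j + 1, …, j + l`. -/
def segment (j l : ℕ) {m : ℕ} (h : j + l ≤ m) (σ : K _⦋m⦌) : K _⦋l⦌ :=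
  K.map (SimplexCategory.subinterval j l h).op σ

theorem segment_apply (j l : ℕ) {m : ℕ} (h : j + l ≤ m) (x : Fin (l + 1)) :
    (((SimplexCategory.subinterval j l h).toOrderHom x : Fin (m + 1)) : ℕ) = x + j := rfl

theorem δ_apply {m : ℕ} (i : Fin (m + 2)) (x : Fin (m + 1)) :
    (((SimplexCategory.δ i).toOrderHom x : Fin (m + 2)) : ℕ) = if (x : ℕ) < i then (x : ℕ) else x + 1 := by
  change ((i.succAbove x : Fin (m + 2)) : ℕ) = _
  simp only [Fin.succAbove, Fin.lt_def, Fin.val_castSucc]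
  split <;> simp

theorem map_eq_map {a m : ℕ} (φ φ' : ⦋a⦌ ⟶ ⦋m⦌)
    (h : ∀ x : Fin (a + 1), ((φ.toOrderHom x : Fin (m + 1)) : ℕ) = φ'.toOrderHom x)
    (σ : K _⦋m⦌) : K.map φ.op σ = K.map φ'.op σ := by
  have : φ = φ' := by
    apply SimplexCategory.Hom.ext
    ext x
    exact h x
  rw [this]

theorem map_map {a b m : ℕ} (φ : ⦋a⦌ ⟶ ⦋b⦌) (ψ : ⦋b⦌ ⟶ ⦋m⦌) (σ : K _⦋m⦌) :
    K.map φ.op (K.map ψ.op σ) = K.map (φ ≫ ψ).op σ := by simp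

theorem segment_segment (j l j' m m' : ℕ) (h : j + l ≤ m) (h' : j' + m ≤ m') (σ : K _⦋m'⦌) :
    segment j l h (segment j' m h' σ) = segment (j' + j) l (by omega) σ := by
  unfold segment
  rw [map_map]
  refine map_eq_map _ _ (fun x => ?_) σ
  change (x : ℕ) + j + j' = x + (j' + j)
  omega

theorem segment_zero_self (m : ℕ) (h : 0 + m ≤ m) (σ : K _⦋m⦌) : segment 0 m h σ = σ := by
  have := map_eq_map (SimplexCategory.subinterval 0 m h) (𝟙 ⦋m⦌) (fun x => rfl) σ
  rw [op_id, K.map_id] at this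
  exact this

theorem mk_eq {R : Type u} {m m' : ℕ} (e : m = m') (f : SSetCochain K R m) (g : SSetCochain K R m')
    (h : ∀ σ : K _⦋m'⦌, f (segment 0 m (by omega) σ) = g σ) :
    GradedMonoid.mk m f = GradedMonoid.mk m' g := by
  subst e
  congr 1
  funext σ
  simpa [segment_zero_self] using h σ

/-- Front and back faces of a face. -/
theorem segment_δ_of_le {p q m : ℕ} (hm : m = p + q) (i : Fin (m + 2)) (hi : (i : ℕ) ≤ p)
    (σ : K _⦋m + 1⦌) :
    segment 0 p (by omega) (K.δ i σ) =
        K.δ ⟨i, by omega⟩ (segment 0 (p + 1) (by omega) σ) ∧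
      segment p q (by omega) (K.δ i σ) = segment (p + 1) q (by omega) σ := by
  unfold segment SimplicialObject.δ
  simp only [map_map]
  constructor
  · refine map_eq_map _ _ (fun x => ?_) σ
    change ((SimplexCategory.δ i).toOrderHom _ : ℕ) = ((SimplexCategory.δ _).toOrderHom x : ℕ) + 0
    rw [δ_apply, δ_apply]
    rfl
  · refine map_eq_map _ _ (fun x => ?_) σ
    change ((SimplexCategory.δ i).toOrderHom _ : ℕ) = (x : ℕ) + (p + 1)
    rw [δ_apply, segment_apply, if_neg (by omega)]
    omega

theorem segment_δ_of_lt {p q m : ℕ} (hm : m = p + q) (i : Fin (m + 2)) (j : Fin (q + 2))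
    (hj : 0 < (j : ℕ)) (hi : (i : ℕ) = p + j) (σ : K _⦋m + 1⦌) :
    segment 0 p (by omega) (K.δ i σ) = segment 0 p (by omega) σ ∧
      segment p q (by omega) (K.δ i σ) = K.δ j (segment p (q + 1) (by omega) σ) := by
  unfold segment SimplicialObject.δ
  simp only [map_map]
  constructor
  · refine map_eq_map _ _ (fun x => ?_) σ
    change ((SimplexCategory.δ i).toOrderHom _ : ℕ) = (x : ℕ) + 0
    rw [δ_apply, segment_apply, if_pos (by omega)]
  · refine map_eq_map _ _ (fun x => ?_) σ
    change ((SimplexCategory.δ i).toOrderHom _ : ℕ) = ((SimplexCategory.δ _).toOrderHom x : ℕ) + p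
    rw [δ_apply, δ_apply, segment_apply]
    split_ifs <;> omega

theorem δ_last_segment (p m : ℕ) (h : p + 1 ≤ m) (σ : K _⦋m⦌) :
    K.δ (Fin.last (p + 1)) (segment 0 (p + 1) (by omega) σ) = segment 0 p (by omega) σ := by
  unfold segment SimplicialObject.δ
  simp only [map_map]
  refine map_eq_map _ _ (fun x => ?_) σ
  change ((SimplexCategory.δ _).toOrderHom x : ℕ) + 0 = (x : ℕ) + 0
  rw [δ_apply, if_pos (by simp; omega)]

theorem δ_zero_segment (p q m : ℕ) (h : p + (q + 1) ≤ m) (σ : K _⦋m⦌) :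
    K.δ (0 : Fin (q + 2)) (segment p (q + 1) h σ) = segment (p + 1) q (by omega) σ := by
  unfold segment SimplicialObject.δ
  simp only [map_map]
  refine map_eq_map _ _ (fun x => ?_) σ
  change ((SimplexCategory.δ _).toOrderHom x : ℕ) + p = (x : ℕ) + (p + 1)
  rw [δ_apply, if_neg (by simp)]
  omega

end Simplices

section Cup

variable {K : SSet.{v}} {R : Type u} [CommRing R]

instance (k : ℕ) : AddCommGroup (SSetCochain K R k) := inferInstanceAs (AddCommGroup (K _⦋k⦌ → R))
instance (k : ℕ) : Module R (SSetCochain K R k) := inferInstanceAs (Module R (K _⦋k⦌ → R))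

/-- The cup product: the value on `σ` is the value of `f` on the front face of `σ` times the value
of `g` on its back face. -/
def cup {p q : ℕ} (f : SSetCochain K R p) (g : SSetCochain K R q) : SSetCochain K R (p + q) :=
  fun σ => f (segment 0 p (by omega) σ) * g (segment p q le_rfl σ)

/-- The constant `0`-cochain with value `r`. -/
def const (r : R) : SSetCochain K R 0 := fun _ => r

/-- The coboundary of a `k`-cochain: the alternating sum of its values on the faces. -/
def coboundary (k : ℕ) : SSetCochain K R k →ₗ[R] SSetCochain K R (k + 1) where
  toFun f := fun σ => ∑ i : Fin (k + 2), (-1) ^ (i : ℕ) * f (K.δ i σ)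
  map_add' f g := by
    funext σ
    change ∑ i : Fin (k + 2), (-1) ^ (i : ℕ) * (f (K.δ i σ) + g (K.δ i σ)) =
      (∑ i : Fin (k + 2), (-1) ^ (i : ℕ) * f (K.δ i σ)) +
        ∑ i : Fin (k + 2), (-1) ^ (i : ℕ) * g (K.δ i σ)
    simp only [mul_add, Finset.sum_add_distrib]
  map_smul' r f := by
    funext σ
    change ∑ i : Fin (k + 2), (-1) ^ (i : ℕ) * (r * f (K.δ i σ)) =
      r * ∑ i : Fin (k + 2), (-1) ^ (i : ℕ) * f (K.δ i σ)
    simp only [Finset.mul_sum, mul_left_comm]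

instance : GradedMonoid.GOne (SSetCochain K R) := ⟨const 1⟩

instance : GradedMonoid.GMul (SSetCochain K R) := ⟨cup⟩

instance : GradedMonoid.GMonoid (SSetCochain K R) where
  one_mul := by
    rintro ⟨p, f⟩
    refine mk_eq (Nat.zero_add p) (cup (const 1) f) f fun σ => ?_
    simp [cup, const, segment_segment, segment_zero_self]
  mul_one := by
    rintro ⟨p, f⟩
    refine mk_eq (Nat.add_zero p) (cup f (const 1)) f fun σ => ?_
    simp [cup, const, segment_zero_self]
  mul_assoc := by
    rintro ⟨p, f⟩ ⟨q, g⟩ ⟨r, h⟩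
    refine mk_eq (Nat.add_assoc p q r) (cup (cup f g) h) (cup f (cup g h)) fun σ => ?_
    simp [cup, segment_segment, mul_assoc]

instance : DirectSum.GRing (SSetCochain K R) where
  mul_zero f := by funext σ; exact mul_zero _
  zero_mul f := by funext σ; exact zero_mul _
  mul_add f g h := by funext σ; exact mul_add _ _ _
  add_mul f g h := by funext σ; exact add_mul _ _ _
  natCast n := const n
  natCast_zero := by funext σ; exact Nat.cast_zero
  natCast_succ n := by funext σ; exact Nat.cast_succ n
  intCast n := const n
  intCast_ofNat n := by funext σ; exact Int.cast_natCast n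
  intCast_negSucc_ofNat n := by funext σ; exact Int.cast_negSucc n

instance : DirectSum.GAlgebra R (SSetCochain K R) where
  toFun := { toFun := const, map_zero' := rfl, map_add' := fun _ _ => rfl }
  map_one := rfl
  map_mul r s := by
    refine mk_eq rfl (const (r * s)) (cup (const r) (const s)) fun σ => ?_
    simp [cup, const]
  commutes := by
    rintro r ⟨p, f⟩
    refine mk_eq (Nat.add_comm 0 p) (cup (const r) f) (cup f (const r)) fun σ => ?_
    simp [cup, const, segment_segment, segment_zero_self, mul_comm]
  smul_def := by
    rintro r ⟨p, f⟩
    refine mk_eq (Nat.zero_add p).symm (r • f) (cup (const r) f) fun σ => ?_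
    simp [cup, const]
    rfl


theorem coboundary_apply (k : ℕ) (f : SSetCochain K R k) (σ : K _⦋k + 1⦌) :
    coboundary k f σ = ∑ i : Fin (k + 2), (-1) ^ (i : ℕ) * f (K.δ i σ) := rfl

theorem coboundary_cup_apply {p q : ℕ} (f : SSetCochain K R p) (g : SSetCochain K R q)
    (σ : K _⦋p + q + 1⦌) :
    coboundary (p + q) (cup f g) σ =
      coboundary p f (segment 0 (p + 1) (by omega) σ) * g (segment (p + 1) q (by omega) σ) +
        (-1) ^ p * (f (segment 0 p (by omega) σ) *
          coboundary q g (segment p (q + 1) (by omega) σ)) := by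
  rw [coboundary_apply, coboundary_apply, coboundary_apply,
    ← Fin.sum_congr' _ (show (p + 1) + (q + 1) = p + q + 2 by omega), Fin.sum_univ_add,
    Fin.sum_univ_castSucc (n := p + 1), Fin.sum_univ_succ (n := q + 1), δ_last_segment _ _ (by omega),
    δ_zero_segment]
  have h1 : ∀ i : Fin (p + 1),
      cup f g (K.δ ((Fin.castAdd (q + 1) i).cast (by omega)) σ) =
        f (K.δ i.castSucc (segment 0 (p + 1) (by omega) σ)) *
          g (segment (p + 1) q (by omega) σ) := fun i => by
    have := segment_δ_of_le (q := q) rfl ((Fin.castAdd (q + 1) i).cast (by omega))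
      (by simp; omega) σ
    unfold cup
    rw [this.1, this.2]
    rfl
  have h2 : ∀ j : Fin (q + 1),
      cup f g (K.δ ((Fin.natAdd (p + 1) j).cast (by omega)) σ) =
        f (segment 0 p (by omega) σ) *
          g (K.δ j.succ (segment p (q + 1) (by omega) σ)) := fun j => by
    have := segment_δ_of_lt rfl ((Fin.natAdd (p + 1) j).cast (by omega)) j.succ
      (by simp) (by simp; omega) σ
    unfold cup
    rw [this.1, this.2]
  simp only [h1, h2, Fin.val_cast, Fin.val_castAdd, Fin.val_natAdd, Fin.val_castSucc, Fin.val_last,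
    Fin.val_succ, Fin.val_zero, pow_zero, one_mul, add_mul, mul_add, Finset.sum_mul,
    Finset.mul_sum, pow_succ, pow_add]
  have e1 : ∀ i : Fin (p + 1), (-1 : R) ^ (i : ℕ) *
      (f (K.δ i.castSucc (segment 0 (p + 1) (by omega) σ)) * g (segment (p + 1) q (by omega) σ)) =
      (-1 : R) ^ (i : ℕ) * f (K.δ i.castSucc (segment 0 (p + 1) (by omega) σ)) *
        g (segment (p + 1) q (by omega) σ) := fun i => by ring
  have e2 : ∀ j : Fin (q + 1), (-1 : R) ^ p * (f (segment 0 p (by omega) σ) *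
      ((-1 : R) ^ (j : ℕ) * -1 * g (K.δ j.succ (segment p (q + 1) (by omega) σ)))) =
      (-1 : R) ^ p * -1 * (-1 : R) ^ (j : ℕ) * (f (segment 0 p (by omega) σ) *
        g (K.δ j.succ (segment p (q + 1) (by omega) σ))) := fun j => by ring
  simp only [e1, e2]
  ring

theorem coboundary_coboundary (k : ℕ) (f : SSetCochain K R k) :
    coboundary (k + 1) (coboundary k f) = 0 := by
  funext σ
  change ∑ i : Fin (k + 3), (-1) ^ (i : ℕ) *
    ∑ j : Fin (k + 2), (-1) ^ (j : ℕ) * f (K.δ j (K.δ i σ)) = 0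
  simp only [Finset.mul_sum]
  rw [← Finset.sum_product', Finset.univ_product_univ]
  refine Finset.sum_involution
    (fun ij _ => if h : (ij.1 : ℕ) ≤ ij.2 then (ij.2.succ, ⟨ij.1, by omega⟩)
      else (ij.2.castSucc, ⟨(ij.1 : ℕ) - 1, by omega⟩)) ?_ ?_ ?_ ?_
  · rintro ⟨i, j⟩ -
    dsimp only
    have key : ∀ (i : Fin (k + 3)) (j : Fin (k + 2)) (h : (i : ℕ) ≤ j),
        K.δ j (K.δ i σ) = K.δ (⟨i, by omega⟩ : Fin (k + 2)) (K.δ j.succ σ) := by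
      intro i j h
      unfold SimplicialObject.δ
      simp only [map_map]
      refine map_eq_map _ _ (fun x => ?_) σ
      change ((SimplexCategory.δ i).toOrderHom ((SimplexCategory.δ j).toOrderHom x) : ℕ) =
        ((SimplexCategory.δ j.succ).toOrderHom ((SimplexCategory.δ _).toOrderHom x) : ℕ)
      rw [δ_apply, δ_apply, δ_apply, δ_apply, Fin.val_succ]
      dsimp only
      split_ifs <;> omega
    split_ifs with h
    · dsimp only
      rw [key i j h, Fin.val_succ, pow_succ]
      ring
    · dsimp only
      have hi : i = (⟨(i : ℕ) - 1, by omega⟩ : Fin (k + 2)).succ := by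
        ext; simp; omega
      have hk := key j.castSucc ⟨(i : ℕ) - 1, by omega⟩ (by simp; omega)
      rw [← hi] at hk
      rw [hk]
      obtain ⟨m, hm⟩ : ∃ m, (i : ℕ) = m + 1 := ⟨i - 1, by omega⟩
      simp only [hm, Fin.val_castSucc, Nat.add_sub_cancel, pow_succ]
      ring
  · rintro ⟨i, j⟩ - _ h
    dsimp only at h
    split_ifs at h with h'
    · have := congrArg (fun x => (x.1 : ℕ)) h
      simp at this; omega
    · have := congrArg (fun x => (x.1 : ℕ)) h
      simp at this; omega
  · intros; exact Finset.mem_univ _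
  · rintro ⟨i, j⟩ -
    dsimp only
    by_cases h : (i : ℕ) ≤ j
    · have h2 : ¬ ((j.succ : Fin (k + 3)) : ℕ) ≤ (i : ℕ) := by simp; omega
      simp [h]
    · have h2 : ((j.castSucc : Fin (k + 3)) : ℕ) ≤ (i : ℕ) - 1 := by simp; omega
      have h3 : (i : ℕ) - 1 + 1 = i := by omega
      simp only [Fin.val_castSucc] at h2
      simp [h, Prod.ext_iff, Fin.ext_iff, h3]
      omega

end Cup

end SSetCochain

/-- An augmented differential graded algebra over `R`, graded by `ℕ` (cohomologically). -/
structure AugDGAlgebra (R : Type u) [CommRing R] where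
  carrier : Type v
  [ring : Ring carrier]
  [algebra : Algebra R carrier]
  grading : ℕ → Submodule R carrier
  [graded : GradedAlgebra grading]
  d : carrier →ₗ[R] carrier
  d_mem : ∀ {p : ℕ} {a : carrier}, a ∈ grading p → d a ∈ grading (p + 1)
  d_d : ∀ a : carrier, d (d a) = 0
  leibniz : ∀ {p : ℕ} {a : carrier} (b : carrier), a ∈ grading p →
    d (a * b) = d a * b + (-1) ^ p * (a * d b)
  aug : carrier →ₐ[R] R
  aug_of_mem : ∀ {p : ℕ} {a : carrier}, a ∈ grading p → p ≠ 0 → aug a = 0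

namespace AugDGAlgebra

attribute [instance] ring algebra graded

variable {R : Type u} [CommRing R] (A : AugDGAlgebra.{u, v} R)

theorem aug_d (a : A.carrier) : A.aug (A.d a) = 0 := by
  induction a using DirectSum.Decomposition.inductionOn A.grading with
  | zero => simp
  | homogeneous m => exact A.aug_of_mem (A.d_mem m.2) (Nat.succ_ne_zero _)
  | add a b ha hb => simp [ha, hb]

end AugDGAlgebra

namespace SSetCochain

variable {K : SSet.{v}} {R : Type u} [CommRing R]

/-- The coboundary on the direct sum of the cochain groups. -/
def totalD (K : SSet.{v}) (R : Type u) [CommRing R] : (⨁ k, SSetCochain K R k) →ₗ[R] (⨁ k, SSetCochain K R k) :=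
  DirectSum.toModule R ℕ _ fun k => DirectSum.lof R ℕ (SSetCochain K R) (k + 1) ∘ₗ coboundary k

/-- The cochains of degree `k`, inside the direct sum of all cochain groups. -/
def totalGrading (K : SSet.{v}) (R : Type u) [CommRing R] (k : ℕ) : Submodule R (⨁ k, SSetCochain K R k) :=
  LinearMap.range (DirectSum.lof R ℕ (SSetCochain K R) k)

/-- Evaluation at the vertex `v` on `0`-cochains, and zero in positive degrees. -/
def augComponent (v : K _⦋0⦌) (k : ℕ) : SSetCochain K R k →ₗ[R] R :=
  match k with
  | 0 => LinearMap.proj (R := R) (φ := fun _ : K _⦋0⦌ => R) v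
  | _ + 1 => 0

/-- The augmentation of the cochain algebra which is given by the vertex `v`. -/
def totalAug (v : K _⦋0⦌) : (⨁ k, SSetCochain K R k) →ₐ[R] R :=
  DirectSum.toAlgebra R (SSetCochain K R) (augComponent v) rfl (by
    intro i j f g
    match i, j, f, g with
    | 0, 0, f, g =>
      change f (segment 0 0 _ v) * g (segment 0 0 _ v) = f v * g v
      rw [segment_zero_self]
    | 0, j + 1, f, g => exact (mul_zero (f v)).symm
    | i + 1, 0, f, g => exact (zero_mul (g v)).symm
    | i + 1, j + 1, f, g => exact (zero_mul (0 : R)).symm)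

theorem totalD_lof (k : ℕ) (f : SSetCochain K R k) :
    totalD K R (DirectSum.lof R ℕ (SSetCochain K R) k f) =
      DirectSum.lof R ℕ (SSetCochain K R) (k + 1) (coboundary k f) := by
  simp [totalD]

theorem lof_mul_lof {p q : ℕ} (f : SSetCochain K R p) (g : SSetCochain K R q) :
    DirectSum.lof R ℕ (SSetCochain K R) p f * DirectSum.lof R ℕ (SSetCochain K R) q g =
      DirectSum.lof R ℕ (SSetCochain K R) (p + q) (cup f g) :=
  DirectSum.of_mul_of f g

theorem totalD_lof_mul {p q : ℕ} (f : SSetCochain K R p) (g : SSetCochain K R q) :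
    totalD K R (DirectSum.lof R ℕ (SSetCochain K R) p f * DirectSum.lof R ℕ (SSetCochain K R) q g) =
      totalD K R (DirectSum.lof R ℕ (SSetCochain K R) p f) * DirectSum.lof R ℕ (SSetCochain K R) q g
      + (-1) ^ p * (DirectSum.lof R ℕ (SSetCochain K R) p f *
          totalD K R (DirectSum.lof R ℕ (SSetCochain K R) q g)) := by
  simp only [lof_mul_lof, totalD_lof]
  have h1 : DirectSum.lof R ℕ (SSetCochain K R) (p + 1 + q) (cup (coboundary p f) g) =
      DirectSum.lof R ℕ (SSetCochain K R) (p + q + 1) (show SSetCochain K R (p + q + 1) from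
        fun σ => coboundary p f (segment 0 (p + 1) (by omega) σ) *
          g (segment (p + 1) q (by omega) σ)) := by
    refine DirectSum.of_eq_of_gradedMonoid_eq (mk_eq (by omega) _ _ fun σ => ?_)
    simp [cup, segment_segment]
  have h2 : ∀ x : ⨁ k, SSetCochain K R k, (-1) ^ p * x = ((-1 : R) ^ p) • x := fun x => by
    rw [Algebra.smul_def]; simp
  rw [h1, h2, ← map_smul]
  refine Eq.trans ?_ (map_add (DirectSum.lof R ℕ (SSetCochain K R) (p + q + 1)) _ _)
  congr 1
  funext σ
  exact coboundary_cup_apply f g σ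

instance : GradedAlgebra (totalGrading K R) where
  one_mem := ⟨const 1, rfl⟩
  mul_mem := by
    rintro p q _ _ ⟨f, rfl⟩ ⟨g, rfl⟩
    exact ⟨cup f g, (lof_mul_lof f g).symm⟩
  decompose' := DirectSum.toModule R ℕ _ fun k =>
    DirectSum.lof R ℕ (fun k => totalGrading K R k) k ∘ₗ
      (DirectSum.lof R ℕ (SSetCochain K R) k).rangeRestrict
  left_inv x := by
    induction x using DirectSum.induction_on with
    | zero => simp
    | of k f =>
      rw [← DirectSum.lof_eq_of R, DirectSum.toModule_lof]
      exact DirectSum.coeAddMonoidHom_of _ _ _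
    | add x y hx hy => rw [map_add, map_add, hx, hy]
  right_inv x := by
    induction x using DirectSum.induction_on with
    | zero => simp
    | of k f =>
      obtain ⟨_, f, rfl⟩ := f
      rw [DirectSum.coeAddMonoidHom_of, DirectSum.toModule_lof]
      simp [DirectSum.lof_eq_of]
      rfl
    | add x y hx hy => rw [map_add, map_add, hx, hy]

/-- The augmented differential graded algebra of cochains of a simplicial set `K` with base
vertex `v`, with the cup product. -/
def dgAlgebra (R : Type u) [CommRing R] (v : K _⦋0⦌) : AugDGAlgebra.{u} R where
  carrier := ⨁ k, SSetCochain K R k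
  grading := totalGrading K R
  d := totalD K R
  d_mem := by
    rintro p _ ⟨f, rfl⟩
    exact ⟨coboundary p f, (totalD_lof p f).symm⟩
  d_d a := by
    induction a using DirectSum.induction_on with
    | zero => simp
    | of k f =>
      rw [← DirectSum.lof_eq_of R, totalD_lof, totalD_lof, coboundary_coboundary, map_zero]
    | add x y hx hy => rw [map_add, map_add, hx, hy, add_zero]
  leibniz := by
    rintro p _ b ⟨f, rfl⟩
    induction b using DirectSum.induction_on with
    | zero => simp
    | of q g => exact totalD_lof_mul f g
    | add x y hx hy => simp only [mul_add, map_add, hx, hy]; abel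
  aug := totalAug v
  aug_of_mem := by
    rintro p _ ⟨f, rfl⟩ hp
    obtain ⟨k, rfl⟩ := Nat.exists_eq_succ_of_ne_zero hp
    exact DirectSum.toModule_lof R (φ := augComponent v) (k + 1) f

end SSetCochain

namespace AugDGAlgebra
variable {R : Type u} [CommRing R] (A : AugDGAlgebra.{u, v} R)

/-- The submodule of cocycles of degree `n`. -/
def cocycles (n : ℕ) : Submodule R A.carrier := A.grading n ⊓ LinearMap.ker A.d

/-- The cohomology `Hⁿ(A)`: cocycles of degree `n` modulo those which are coboundaries. -/
abbrev cohomology (n : ℕ) : Type v :=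
  A.cocycles n ⧸ (LinearMap.range A.d).submoduleOf (A.cocycles n)

/-- The augmentation ideal. -/
abbrev augIdeal : Submodule R A.carrier := LinearMap.ker A.aug.toLinearMap

/-- The differential of `A`, on the augmentation ideal. -/
def dBar : A.augIdeal →ₗ[R] A.augIdeal :=
  A.d.restrict fun a _ => A.aug_d a

/-- The product of `A`, on the augmentation ideal. -/
def mulBar : A.augIdeal →ₗ[R] A.augIdeal →ₗ[R] A.augIdeal :=
  LinearMap.mk₂ R
    (fun a b => ⟨a.1 * b.1, by
      have : A.aug a.1 = 0 := a.2
      change A.aug (a.1 * b.1) = 0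
      rw [map_mul, this, zero_mul]⟩)
    (fun _ _ _ => Subtype.ext (add_mul _ _ _)) (fun _ _ _ => Subtype.ext (smul_mul_assoc _ _ _))
    (fun _ _ _ => Subtype.ext (mul_add _ _ _)) (fun _ _ _ => Subtype.ext (mul_smul_comm _ _ _))

/-- The linear operator which multiplies an element of degree `p` by `(-1) ^ (p - 1)`. -/
def degSign : A.carrier →ₗ[R] A.carrier :=
  (DirectSum.toModule R ℕ A.carrier fun p => (-1 : R) ^ (p + 1) • (A.grading p).subtype) ∘ₗ
    (DirectSum.decomposeLinearEquiv A.grading).toLinearMap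

theorem degSign_of_mem {p : ℕ} {a : A.carrier} (ha : a ∈ A.grading p) :
    A.degSign a = (-1 : R) ^ (p + 1) • a := by
  lift a to A.grading p using ha
  simp [degSign]

theorem aug_degSign (a : A.carrier) : A.aug (A.degSign a) = - A.aug a := by
  induction a using DirectSum.Decomposition.inductionOn A.grading with
  | zero => simp
  | @homogeneous p m =>
    rw [A.degSign_of_mem m.2]
    rcases Nat.eq_zero_or_pos p with rfl | hp
    · simp
    · rw [map_smul, A.aug_of_mem m.2 hp.ne', smul_zero, neg_zero]
  | add a b ha hb => simp [ha, hb]; abel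

/-- The operator `degSign`, on the augmentation ideal. -/
def signBar : A.augIdeal →ₗ[R] A.augIdeal :=
  A.degSign.restrict fun a ha => by
    have : A.aug a = 0 := ha
    change A.aug (A.degSign a) = 0
    rw [aug_degSign, this, neg_zero]

/-- The underlying module of the (reduced) bar construction of `A`: the direct sum over all weights
`k` of the `k`-th tensor powers of the augmentation ideal. -/
abbrev Bar : Type (max u v) := ⨁ k : ℕ, ⨂[R]^k A.augIdeal

instance : AddCommGroup A.Bar := Module.addCommMonoidToAddCommGroup R

/-- The generator `|x₁|⋯|xₖ|` of weight `k`. -/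
def word {k : ℕ} (x : Fin k → A.augIdeal) : A.Bar :=
  DirectSum.lof R ℕ (fun k => ⨂[R]^k A.augIdeal) k (PiTensorProduct.tprod R x)

/-- The part of the bar differential which comes from the differential of `A`. It maps
`|x₁|⋯|xₖ|` to `∑ᵢ (-1) ^ ε |x₁|⋯|d xᵢ|⋯|xₖ|`, where `ε = ∑_{j < i} (deg xⱼ - 1)`. -/
def barD₁ (k : ℕ) : ⨂[R]^k A.augIdeal →ₗ[R] ⨂[R]^k A.augIdeal :=
  ∑ i : Fin k, PiTensorProduct.map fun j =>
    if j < i then A.signBar else if j = i then A.dBar else LinearMap.id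

/-- The letters of the word `± |x₁|⋯|xᵢ xᵢ₊₁|⋯|xₖ₊₁|`, where the sign is `(-1) ^ ε` for
`ε = ∑_{j ≤ i} (deg xⱼ - 1)`; it is distributed over the letters up to `xᵢ`. -/
def mergeLetters {k : ℕ} (i : Fin k) (x : Fin (k + 1) → A.augIdeal) (j : Fin k) : A.augIdeal :=
  if j < i then A.signBar (x j.castSucc)
  else if j = i then A.mulBar (A.signBar (x j.castSucc)) (x j.succ)
  else x j.succ

theorem mergeLetters_update {k : ℕ} (i : Fin k) (x : Fin (k + 1) → A.augIdeal) (m : Fin (k + 1)) :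
    ∃ L : A.augIdeal →ₗ[R] A.augIdeal, ∀ a : A.augIdeal,
      A.mergeLetters i (Function.update x m a) =
        Function.update (A.mergeLetters i x) (i.predAbove m) (L a) := by
  have hx : ∀ n : Fin (k + 1), n ≠ m → ∀ a, Function.update x m a n = x n :=
    fun n h a => Function.update_of_ne h a x
  have hne : ∀ {n n' : Fin (k + 1)}, (n : ℕ) ≠ n' → n ≠ n' := fun h h' => h (congrArg _ h')
  rcases lt_or_ge (m : ℕ) i with hm | hm
  · obtain ⟨j, rfl⟩ : ∃ j : Fin k, m = j.castSucc := ⟨⟨m, by omega⟩, rfl⟩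
    rw [Fin.val_castSucc] at hm
    refine ⟨A.signBar, fun a => funext fun l => ?_⟩
    have hp : i.predAbove j.castSucc = j :=
      Fin.predAbove_castSucc_of_le _ _ (Fin.le_def.2 hm.le)
    rw [hp]
    by_cases hl : l = j
    · subst hl
      simp [mergeLetters, Fin.lt_def, hm]
    · rw [Function.update_of_ne hl]
      have hl' : (l : ℕ) ≠ j := fun h => hl (Fin.ext h)
      unfold mergeLetters
      rw [hx l.castSucc (hne (by simpa using hl'))]
      split_ifs with h1 h2
      · rfl
      · subst h2
        rw [hx _ (hne (by simp; omega))]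
      · rw [Fin.lt_def] at h1
        rw [hx _ (hne (by simp; omega))]
  · rcases eq_or_lt_of_le hm with hm | hm
    · obtain rfl : m = i.castSucc := Fin.ext hm.symm
      refine ⟨A.mulBar.flip (x i.succ) ∘ₗ A.signBar, fun a => funext fun l => ?_⟩
      rw [Fin.predAbove_castSucc_self]
      by_cases hl : l = i
      · subst hl
        simp [mergeLetters, hx l.succ (hne (by simp))]
      · rw [Function.update_of_ne hl]
        have hl' : (l : ℕ) ≠ i := fun h => hl (Fin.ext h)
        unfold mergeLetters
        rw [hx l.castSucc (hne (by simpa using hl')), if_neg hl, if_neg hl]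
        split_ifs with h1
        · rfl
        · rw [Fin.lt_def] at h1
          rw [hx _ (hne (by simp; omega))]
    · obtain ⟨j, rfl⟩ : ∃ j : Fin k, m = j.succ :=
        ⟨⟨(m : ℕ) - 1, by omega⟩, Fin.ext (by simp; omega)⟩
      rw [Fin.val_succ] at hm
      have hp : i.predAbove j.succ = j := Fin.predAbove_succ_of_le _ _ (Fin.le_def.2 (by omega))
      rw [hp]
      refine ⟨if j = i then A.mulBar (A.signBar (x i.castSucc)) else LinearMap.id,
        fun a => funext fun l => ?_⟩
      by_cases hl : l = j
      · subst hl
        rw [Function.update_self]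
        unfold mergeLetters
        rw [Function.update_self, hx l.castSucc (hne (by simp)),
          if_neg (by rw [Fin.lt_def]; omega)]
        split_ifs with h1
        · subst h1; rfl
        · rfl
      · rw [Function.update_of_ne hl]
        have hl' : (l : ℕ) ≠ j := fun h => hl (Fin.ext h)
        unfold mergeLetters
        rw [hx l.succ (hne (by simpa using hl'))]
        split_ifs with h1 h2
        · rw [Fin.lt_def] at h1
          rw [hx _ (hne (by simp; omega))]
        · subst h2
          rw [hx _ (hne (by simp; omega))]
        · rfl

/-- The multilinear map `(x₁, …, xₖ₊₁) ↦ ± |x₁|⋯|xᵢ xᵢ₊₁|⋯|xₖ₊₁|`. -/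
def barMerge {k : ℕ} (i : Fin k) :
    MultilinearMap R (fun _ : Fin (k + 1) => A.augIdeal) (⨂[R]^k A.augIdeal) where
  toFun x := PiTensorProduct.tprod R (A.mergeLetters i x)
  map_update_add' {inst} x m a b := by
    rw [Subsingleton.elim inst (instDecidableEqFin _)]
    obtain ⟨L, hL⟩ := A.mergeLetters_update i x m
    rw [hL, hL, hL, map_add, MultilinearMap.map_update_add]
  map_update_smul' {inst} x m c a := by
    rw [Subsingleton.elim inst (instDecidableEqFin _)]
    obtain ⟨L, hL⟩ := A.mergeLetters_update i x m
    rw [hL, hL, map_smul, MultilinearMap.map_update_smul]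

/-- The part of the bar differential which comes from the product of `A`. It lowers the weight by
one: `|x₁|⋯|xₖ₊₁|` is sent to `∑ᵢ ± |x₁|⋯|xᵢ xᵢ₊₁|⋯|xₖ₊₁|`. -/
def barD₂ (k : ℕ) : ⨂[R]^(k + 1) A.augIdeal →ₗ[R] ⨂[R]^k A.augIdeal :=
  ∑ i : Fin k, PiTensorProduct.lift (A.barMerge i)

/-- The differential of the bar construction. -/
def barD : A.Bar →ₗ[R] A.Bar :=
  DirectSum.toModule R ℕ A.Bar fun k => match k with
    | 0 => 0
    | k + 1 =>
      DirectSum.lof R ℕ (fun k => ⨂[R]^k A.augIdeal) (k + 1) ∘ₗ A.barD₁ (k + 1) +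
        DirectSum.lof R ℕ (fun k => ⨂[R]^k A.augIdeal) k ∘ₗ A.barD₂ k

theorem barD_word {k : ℕ} (x : Fin (k + 1) → A.augIdeal) :
    A.barD (A.word x) =
      ∑ i : Fin (k + 1), A.word (fun j =>
        if j < i then A.signBar (x j) else if j = i then A.dBar (x j) else x j) +
      ∑ i : Fin k, A.word (A.mergeLetters i x) := by
  have h : ∀ (i j : Fin (k + 1)), (if j < i then A.signBar else if j = i then A.dBar
      else LinearMap.id) (x j) =
      if j < i then A.signBar (x j) else if j = i then A.dBar (x j) else x j := fun i j => by
    split_ifs <;> rfl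
  simp [barD, word, barD₁, barD₂, barMerge, map_sum, h]

/-- The elements of total degree `m` of the bar construction: the span of the words
`|x₁|⋯|xₖ|` with homogeneous letters and `∑ᵢ (deg xᵢ - 1) = m`. -/
def barGrading (m : ℤ) : Submodule R A.Bar :=
  Submodule.span R {w | ∃ (k : ℕ) (p : Fin k → ℕ) (x : Fin k → A.augIdeal),
    (∀ i, (x i : A.carrier) ∈ A.grading (p i)) ∧ ∑ i, ((p i : ℤ) - 1) = m ∧ w = A.word x}

/-- The cocycles of degree `m` of the bar construction. -/
def barCocycles (m : ℤ) : Submodule R A.Bar := A.barGrading m ⊓ LinearMap.ker A.barD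

/-- The cohomology of the bar construction in degree `m`. -/
abbrev barCohomology (m : ℤ) : Type (max u v) :=
  A.barCocycles m ⧸ ((A.barGrading (m - 1)).map A.barD).submoduleOf (A.barCocycles m)

/-- A cocycle of positive degree, as an element of the augmentation ideal. -/
def letter {n : ℕ} (hn : n ≠ 0) (ω : A.cocycles n) : A.augIdeal :=
  ⟨ω, A.aug_of_mem ω.2.1 hn⟩

/-- The cocycle `|ω|` of weight one and degree `n - 1` in the bar construction that is given by
a cocycle `ω` of degree `n` of `A`. -/
def weightOne {n : ℕ} (hn : n ≠ 0) (ω : A.cocycles n) : A.barCocycles ((n : ℤ) - 1) :=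
  ⟨A.word fun _ : Fin 1 => A.letter hn ω, by
    refine ⟨Submodule.subset_span ⟨1, fun _ => n, fun _ => A.letter hn ω, fun _ => ω.2.1,
      by simp, rfl⟩, ?_⟩
    have hd : A.dBar (A.letter hn ω) = 0 := Subtype.ext ω.2.2
    change A.barD _ = 0
    rw [barD_word]
    simp only [Fin.sum_univ_succ, Finset.univ_eq_empty, Finset.sum_empty, add_zero]
    exact (congrArg _ (MultilinearMap.map_coord_zero _ (0 : Fin 1) (by simp [hd]))).trans
      (map_zero _)⟩

/-- The class of a cocycle of `A` in cohomology. -/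
def cls {n : ℕ} (ω : A.cocycles n) : A.cohomology n := Submodule.Quotient.mk ω

/-- The class of a cocycle of the bar construction in cohomology. -/
def barCls {m : ℤ} (γ : A.barCocycles m) : A.barCohomology m := Submodule.Quotient.mk γ

end AugDGAlgebra

/-- The augmented differential graded algebra of singular cochains of a space `X` with base point
`x`, with the cup product. -/
def singularCochains (R : Type u) [CommRing R] (X : TopCat.{v}) (x : X) :
    AugDGAlgebra.{u, max u v} R :=
  SSetCochain.dgAlgebra R (TopCat.toSSetObj₀Equiv.symm x)

end

noncomputable section

/-! ### Chains of tuples -/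

/-! The augmentation ideal of the cochain algebra of the sphere is exact below degree $n$. If every
letter of a word of weight $k$ has degree at least $n$, the word has degree at least $k(n-1)$. A
Künneth argument therefore makes the $k$-th tensor power of the augmentation ideal exact in all
degrees below $k(n-1)$. Since $n\ge 2$, for $k\ge 2$ this covers every degree up to $n-1$. So a bar
cocycle of degree $n-1$, or a bar element of degree $n-2$ whose differential has weight one, can be
stripped of its components of weight at least two, from the top weight downwards, by subtracting
coboundaries. What remains has weight at most one, and the weight zero part has zero differential.
Hence $\omega\mapsto|\omega|$ induces an isomorphism $H^n\cong H_B^{n-1}$. The carriers are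
`SignedComplex.PartialContraction.exists_tensorD_eq`, `exists_sub_barD_weight_le_one` and
`cohomologyEquivBar`.

The Künneth argument must hold over every commutative ring, and for cochain modules that need not be
free. It therefore uses an explicit contraction $h$ in degrees below $n$. The map $1-(dh+hd)$ is
homotopic to the identity and kills letters of degree below $n$; applied to all letters of a word it
kills everything of low total degree. The contraction is dual to one of the augmented singular
chains, which exists because these are free and exact below the top degree.

The remaining input is the homology of the sphere. Operators on singular chains are built on tuples
of points in a convex space, where cones give all homotopies, and are transported along singular
simplices by naturality. Small chains give a Mayer–Vietoris step (`hasSphereHomology_of_union`).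
Induction on the dimension then treats punctured Euclidean spaces, starting from the empty space.
Finally `exists_coefficient` produces a cocycle dual to the fundamental cycle, which identifies
$H^n$ with $R$. -/

/-- The free module on the `k`-tuples of elements of `Y`. -/
abbrev TupleChain (R : Type*) [CommRing R] (Y : Type*) (k : ℕ) : Type _ := (Fin k → Y) →₀ R

namespace TupleChain

variable {R : Type*} [CommRing R] {Y Z Y' Z' : Type*}

/-- The alternating sum of the tuples with one entry left out. -/
def bd (k : ℕ) : TupleChain R Y (k + 1) →ₗ[R] TupleChain R Y k :=
  Finsupp.linearCombination R fun v =>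
    ∑ i : Fin (k + 1), (-1 : R) ^ (i : ℕ) • Finsupp.single (v ∘ i.succAbove) 1

/-- Adding a first entry. -/
def cone (c : Y) (k : ℕ) : TupleChain R Y k →ₗ[R] TupleChain R Y (k + 1) :=
  Finsupp.lmapDomain R R fun v => (Fin.cons c v : Fin (k + 1) → Y)

/-- The map induced by a map of sets. -/
def map (f : Y → Z) (k : ℕ) : TupleChain R Y k →ₗ[R] TupleChain R Z k :=
  Finsupp.lmapDomain R R fun v => f ∘ v

theorem bd_single {k : ℕ} (v : Fin (k + 1) → Y) :
    bd k (Finsupp.single v (1 : R)) =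
      ∑ i : Fin (k + 1), (-1 : R) ^ (i : ℕ) • Finsupp.single (v ∘ i.succAbove) 1 := by
  simp [bd]

@[simp] theorem cone_single (c : Y) {k : ℕ} (v : Fin k → Y) (r : R) :
    cone c k (Finsupp.single v r) = Finsupp.single (Fin.cons c v : Fin (k + 1) → Y) r := by
  simp [cone]

@[simp] theorem map_single (f : Y → Z) {k : ℕ} (v : Fin k → Y) (r : R) :
    map f k (Finsupp.single v r) = Finsupp.single (f ∘ v) r := by
  simp [map]

theorem hom_ext {M : Type*} [AddCommGroup M] [Module R M] {k : ℕ} {φ ψ : TupleChain R Y k →ₗ[R] M}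
    (h : ∀ v : Fin k → Y, φ (Finsupp.single v 1) = ψ (Finsupp.single v 1)) : φ = ψ :=
  Finsupp.lhom_ext' fun v => LinearMap.ext_ring (h v)

theorem map_map (g : Y' → Z) (f : Y → Y') (k : ℕ) (x : TupleChain R Y k) :
    map g k (map f k x) = map (g ∘ f) k x := by
  refine LinearMap.congr_fun (f := map g k ∘ₗ map f k) (g := map (g ∘ f) k)
    (hom_ext fun v => ?_) x
  simp [Function.comp_assoc]

theorem bd_map (f : Y → Z) (k : ℕ) (x : TupleChain R Y (k + 1)) :
    bd k (map f (k + 1) x) = map f k (bd k x) := by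
  refine LinearMap.congr_fun (f := bd k ∘ₗ map f (k + 1)) (g := map f k ∘ₗ bd k) (hom_ext fun v => ?_) x
  simp [bd_single, Function.comp_assoc]

theorem map_cone (f : Y → Z) (c : Y) (k : ℕ) (x : TupleChain R Y k) :
    map f (k + 1) (cone c k x) = cone (f c) k (map f k x) := by
  refine LinearMap.congr_fun (f := map f (k + 1) ∘ₗ cone c k) (g := cone (f c) k ∘ₗ map f k)
    (hom_ext fun v => ?_) x
  simp [Fin.comp_cons]

theorem bd_cone_zero (c : Y) (x : TupleChain R Y 0) : bd 0 (cone c 0 x) = x := by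
  refine LinearMap.congr_fun (f := bd 0 ∘ₗ cone c 0) (g := LinearMap.id) (hom_ext fun v => ?_) x
  simp [bd_single, Subsingleton.elim _ v]

/-- Leaving out the apex returns the tuple; leaving out a later entry gives the cone over a face,
with its index shifted by one and hence its sign reversed. The later sign computations for tuples
all reduce to this formula. -/
theorem bd_cone_succ (c : Y) (k : ℕ) (x : TupleChain R Y (k + 1)) :
    bd (k + 1) (cone c (k + 1) x) = x - cone c k (bd k x) := by
  refine LinearMap.congr_fun (f := bd (k + 1) ∘ₗ cone c (k + 1))
    (g := LinearMap.id - cone c k ∘ₗ bd k) (hom_ext fun v => ?_) x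
  have h : ∀ i : Fin (k + 1), (Fin.cons c v : Fin (k + 2) → Y) ∘ i.succ.succAbove =
      Fin.cons c (v ∘ i.succAbove) := fun i => by
    funext j
    cases j using Fin.cases <;> simp
  have h0 : (Fin.cons c v : Fin (k + 2) → Y) ∘ Fin.succ = v := by
    funext j; simp
  simp [bd_single, Fin.sum_univ_succ (n := k + 1), h, h0, pow_succ, sub_eq_add_neg]

/-- A nonempty tuple is a cone over its tail, so the cone formula applies to every generator. -/
theorem single_eq_cone {k : ℕ} (v : Fin (k + 1) → Y) (r : R) :
    Finsupp.single v r = cone (v 0) k (Finsupp.single (Fin.tail v) r) := by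
  simp

/-- On a cone over $x$ the cone formula, used twice, leaves only a cone over $\partial\partial x$,
which vanishes by induction. No double sum occurs. -/
theorem bd_bd (k : ℕ) (x : TupleChain R Y (k + 2)) : bd k (bd (k + 1) x) = 0 := by
  induction k with
  | zero =>
    refine LinearMap.congr_fun (f := bd 0 ∘ₗ bd 1) (g := 0) (hom_ext fun v => ?_) x
    rw [single_eq_cone]
    simp only [LinearMap.comp_apply, bd_cone_succ, bd_cone_zero, map_sub, sub_self,
      LinearMap.zero_apply]
  | succ k ih =>
    refine LinearMap.congr_fun (f := bd (k + 1) ∘ₗ bd (k + 2)) (g := 0) (hom_ext fun v => ?_) x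
    rw [single_eq_cone]
    simp only [LinearMap.comp_apply, bd_cone_succ, ih, map_sub, map_zero, sub_zero, sub_self,
      LinearMap.zero_apply]

/-- A homotopy between two chain maps `φ` and `ψ`, constructed recursively from cones with apices
`γ`. -/
def coneHomotopy (φ ψ : ∀ k, TupleChain R Y k →ₗ[R] TupleChain R Y' k)
    (γ : ∀ {k}, (Fin (k + 1) → Y) → Y') :
    ∀ k, TupleChain R Y k →ₗ[R] TupleChain R Y' (k + 1)
  | 0 => 0
  | k + 1 => Finsupp.linearCombination R fun v => cone (γ v) (k + 1)
      ((φ (k + 1) - ψ (k + 1)) (Finsupp.single v 1) -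
        coneHomotopy φ ψ γ k (bd k (Finsupp.single v 1)))

/-- The chain that is coned off, $\varphi v-\psi v-h(\partial v)$, is a cycle by the same identity
one index lower, and the boundary of a cone over a cycle is the cycle itself. The recursion starts
because the two maps agree on the empty tuple. -/
theorem bd_coneHomotopy {φ ψ : ∀ k, TupleChain R Y k →ₗ[R] TupleChain R Y' k}
    (hφ : ∀ k x, bd k (φ (k + 1) x) = φ k (bd k x)) (hψ : ∀ k x, bd k (ψ (k + 1) x) = ψ k (bd k x))
    (h0 : φ 0 = ψ 0) (γ : ∀ {k}, (Fin (k + 1) → Y) → Y') (k : ℕ) (x : TupleChain R Y (k + 1)) :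
    bd (k + 1) (coneHomotopy φ ψ γ (k + 1) x) =
      φ (k + 1) x - ψ (k + 1) x - coneHomotopy φ ψ γ k (bd k x) := by
  induction k with
  | zero =>
    refine LinearMap.congr_fun (f := bd 1 ∘ₗ coneHomotopy φ ψ γ 1)
      (g := φ 1 - ψ 1 - coneHomotopy φ ψ γ 0 ∘ₗ bd 0) (hom_ext fun v => ?_) x
    simp [coneHomotopy, bd_cone_succ, hφ, hψ, h0]
  | succ k ih =>
    refine LinearMap.congr_fun (f := bd (k + 2) ∘ₗ coneHomotopy φ ψ γ (k + 2))
      (g := φ (k + 2) - ψ (k + 2) - coneHomotopy φ ψ γ (k + 1) ∘ₗ bd (k + 1))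
      (hom_ext fun v => ?_) x
    rw [LinearMap.comp_apply, coneHomotopy, Finsupp.linearCombination_single, one_smul,
      bd_cone_succ]
    simp [ih, hφ, hψ, bd_bd]

/-- The recursion uses only $\varphi$, $\psi$, cones and the choice of apices, so it commutes with
any map that respects these. Applied to faces of a simplex, this turns homotopies on tuples into
operators on singular chains. -/
theorem map_coneHomotopy {φ ψ : ∀ k, TupleChain R Y k →ₗ[R] TupleChain R Y' k}
    {φ' ψ' : ∀ k, TupleChain R Z k →ₗ[R] TupleChain R Z' k} {f : Y → Z} {f' : Y' → Z'}
    (hφ : ∀ k x, map f' k (φ k x) = φ' k (map f k x))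
    (hψ : ∀ k x, map f' k (ψ k x) = ψ' k (map f k x))
    {γ : ∀ {k}, (Fin (k + 1) → Y) → Y'} {γ' : ∀ {k}, (Fin (k + 1) → Z) → Z'}
    (hγ : ∀ {k} (v : Fin (k + 1) → Y), f' (γ v) = γ' (f ∘ v)) (k : ℕ) (x : TupleChain R Y k) :
    map f' (k + 1) (coneHomotopy φ ψ γ k x) = coneHomotopy φ' ψ' γ' k (map f k x) := by
  induction k with
  | zero => simp [coneHomotopy]
  | succ k ih =>
    refine LinearMap.congr_fun (f := map f' (k + 2) ∘ₗ coneHomotopy φ ψ γ (k + 1))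
      (g := coneHomotopy φ' ψ' γ' (k + 1) ∘ₗ map f (k + 1)) (hom_ext fun v => ?_) x
    have h1 : (Finsupp.single (f ∘ v) 1 : TupleChain R Z (k + 1)) =
      map f (k + 1) (Finsupp.single v 1) := by simp
    rw [LinearMap.comp_apply, coneHomotopy, Finsupp.linearCombination_single, one_smul, map_cone,
      LinearMap.comp_apply, map_single, coneHomotopy, Finsupp.linearCombination_single, one_smul,
      hγ, h1, bd_map]
    simp [ih, hφ, hψ]

/-- The subdivision which is given by the choice of an interior point of every simplex. -/
def subdiv (β : ∀ {k}, (Fin (k + 1) → Y) → Y) : ∀ k, TupleChain R Y k →ₗ[R] TupleChain R Y k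
  | 0 => LinearMap.id
  | k + 1 => Finsupp.linearCombination R fun v =>
      cone (β v) k (subdiv β k (bd k (Finsupp.single v 1)))

theorem subdiv_succ_single (β : ∀ {k}, (Fin (k + 1) → Y) → Y) {k : ℕ} (v : Fin (k + 1) → Y) :
    subdiv β (k + 1) (Finsupp.single v (1 : R)) =
      cone (β v) k (subdiv β k (bd k (Finsupp.single v 1))) := by
  simp [subdiv]

/-- By induction the subdivided boundary of a simplex is a cycle, so coning it off gives a chain
with exactly this boundary. -/
theorem bd_subdiv (β : ∀ {k}, (Fin (k + 1) → Y) → Y) (k : ℕ) (x : TupleChain R Y (k + 1)) :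
    bd k (subdiv β (k + 1) x) = subdiv β k (bd k x) := by
  induction k with
  | zero =>
    refine LinearMap.congr_fun (f := bd 0 ∘ₗ subdiv β 1) (g := subdiv β 0 ∘ₗ bd 0)
      (hom_ext fun v => ?_) x
    simp [subdiv_succ_single, bd_cone_zero]
  | succ k ih =>
    refine LinearMap.congr_fun (f := bd (k + 1) ∘ₗ subdiv β (k + 2))
      (g := subdiv β (k + 1) ∘ₗ bd (k + 1)) (hom_ext fun v => ?_) x
    rw [LinearMap.comp_apply, subdiv_succ_single]
    simp [bd_cone_succ, ih, bd_bd]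

theorem map_subdiv {f : Y → Z} {β : ∀ {k}, (Fin (k + 1) → Y) → Y}
    {β' : ∀ {k}, (Fin (k + 1) → Z) → Z} (hβ : ∀ {k} (v : Fin (k + 1) → Y), f (β v) = β' (f ∘ v))
    (k : ℕ) (x : TupleChain R Y k) :
    map f k (subdiv β k x) = subdiv β' k (map f k x) := by
  induction k with
  | zero => rfl
  | succ k ih =>
    refine LinearMap.congr_fun (f := map f (k + 1) ∘ₗ subdiv β (k + 1))
      (g := subdiv β' (k + 1) ∘ₗ map f (k + 1)) (hom_ext fun v => ?_) x
    have h1 : (Finsupp.single (f ∘ v) 1 : TupleChain R Z (k + 1)) =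
      map f (k + 1) (Finsupp.single v 1) := by simp
    rw [LinearMap.comp_apply, LinearMap.comp_apply, map_single, subdiv_succ_single,
      subdiv_succ_single, map_cone, ih, hβ, h1, bd_map]

theorem bd_subdiv_pow (β : ∀ {k}, (Fin (k + 1) → Y) → Y) (m k : ℕ) (x : TupleChain R Y (k + 1)) :
    bd k ((subdiv β (k + 1) ^ m) x) = (subdiv β k ^ m) (bd k x) := by
  induction m generalizing x with
  | zero => rfl
  | succ m ih => rw [pow_succ, pow_succ, Module.End.mul_apply, ih, bd_subdiv, Module.End.mul_apply]

theorem map_subdiv_pow {f : Y → Z} {β : ∀ {k}, (Fin (k + 1) → Y) → Y}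
    {β' : ∀ {k}, (Fin (k + 1) → Z) → Z} (hβ : ∀ {k} (v : Fin (k + 1) → Y), f (β v) = β' (f ∘ v))
    (m k : ℕ) (x : TupleChain R Y k) :
    map f k ((subdiv β k ^ m) x) = (subdiv β' k ^ m) (map f k x) := by
  induction m generalizing x with
  | zero => rfl
  | succ m ih => rw [pow_succ, pow_succ, Module.End.mul_apply, ih, map_subdiv hβ, Module.End.mul_apply]

end TupleChain

end

noncomputable section

/-! ### Singular chains, indexed by the number of vertices -/

theorem map_mem_of_mem_supported {R : Type*} [CommRing R] {α M : Type*} [AddCommGroup M]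
    [Module R M] {S : Set α} {φ : (α →₀ R) →ₗ[R] M} {N : Submodule R M}
    (h : ∀ a ∈ S, φ (Finsupp.single a 1) ∈ N) {x : α →₀ R} (hx : x ∈ Finsupp.supported R R S) :
    φ x ∈ N := by
  rw [Finsupp.supported_eq_span_single] at hx
  refine Submodule.span_le (p := N.comap φ).2 ?_ hx
  rintro _ ⟨a, ha, rfl⟩
  exact h a ha

/-- The standard simplex with `k` vertices. -/
abbrev TopSimplex (k : ℕ) : Type := stdSimplex ℝ (Fin k)

namespace TopSimplex

/-- The inclusion of the face opposite to the vertex `i`. -/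
def face {k : ℕ} (i : Fin (k + 1)) : C(TopSimplex k, TopSimplex (k + 1)) :=
  ⟨stdSimplex.map i.succAbove, stdSimplex.continuous_map _⟩

/-- The induced map of simplices adds the barycentric coordinates over each fibre of `f`; the sum on
the right is regrouped by fibres. -/
theorem sum_map_smul {E : Type*} [AddCommGroup E] [Module ℝ E] {k l : ℕ} (f : Fin k → Fin l)
    (t : TopSimplex k) (v : Fin l → E) :
    ∑ i, (stdSimplex.map f t) i • v i = ∑ i, t i • v (f i) := by
  classical
  simp only [stdSimplex.map_coe, FunOnFinite.linearMap_apply_apply, Finset.sum_smul]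
  rw [← Finset.sum_fiberwise (s := Finset.univ) (g := f)]
  refine Finset.sum_congr rfl fun j _ => ?_
  refine Finset.sum_congr (by ext; simp) fun i hi => ?_
  rw [(Finset.mem_filter.1 hi).2]

end TopSimplex

/-- A space with convex combinations of finite families of points. -/
class ConvexComb (Y : Type*) [TopologicalSpace Y] where
  comb : ∀ {k : ℕ}, (Fin k → Y) → C(TopSimplex k, Y)
  comb_face : ∀ {k : ℕ} (v : Fin (k + 1) → Y) (i : Fin (k + 1)),
    (comb v).comp (TopSimplex.face i) = comb (v ∘ i.succAbove)

namespace ConvexComb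

/-- Convex combinations in a convex set. -/
abbrev ofConvex {E : Type*} [AddCommGroup E] [Module ℝ E] [TopologicalSpace E]
    [IsTopologicalAddGroup E] [ContinuousSMul ℝ E] {s : Set E} (hs : Convex ℝ s) :
    ConvexComb s where
  comb {k} v :=
    { toFun := fun t => ⟨∑ i, t i • (v i : E),
        hs.sum_mem (fun i _ => t.2.1 i) t.2.2 fun i _ => (v i).2⟩
      continuous_toFun := by
        refine Continuous.subtype_mk (continuous_finsetSum _ fun i _ => ?_) _
        exact ((continuous_apply i).comp continuous_subtype_val).smul continuous_const }
  comb_face v i := by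
    ext t
    exact TopSimplex.sum_map_smul i.succAbove t fun j => (v j : E)

instance (k : ℕ) : ConvexComb (TopSimplex k) := ofConvex (convex_stdSimplex ℝ (Fin k))

instance : ConvexComb unitInterval := ofConvex (convex_Icc 0 1)

instance {Y Z : Type*} [TopologicalSpace Y] [TopologicalSpace Z] [ConvexComb Y] [ConvexComb Z] :
    ConvexComb (Y × Z) where
  comb v := (comb (Prod.fst ∘ v)).prodMk (comb (Prod.snd ∘ v))
  comb_face v i := by
    ext t : 1
    exact Prod.ext (DFunLike.congr_fun (comb_face (Prod.fst ∘ v) i) t)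
      (DFunLike.congr_fun (comb_face (Prod.snd ∘ v) i) t)

/-- Maps which preserve convex combinations. -/
def Preserves {Y Z : Type*} [TopologicalSpace Y] [TopologicalSpace Z] [ConvexComb Y] [ConvexComb Z]
    (f : C(Y, Z)) : Prop :=
  ∀ (k : ℕ) (v : Fin k → Y), f.comp (comb v) = comb (f ∘ v)

theorem coe_comb {k l : ℕ} (v : Fin l → TopSimplex k) (t : TopSimplex l) :
    ((comb v t : TopSimplex k) : Fin k → ℝ) = ∑ i, t i • (v i : Fin k → ℝ) := rfl

theorem preserves_face {k : ℕ} (i : Fin (k + 1)) : Preserves (TopSimplex.face i) := by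
  intro l v
  ext t : 2
  change FunOnFinite.linearMap ℝ ℝ i.succAbove (∑ j, t j • (v j : Fin k → ℝ)) =
    ∑ j, t j • FunOnFinite.linearMap ℝ ℝ i.succAbove (v j)
  simp

theorem preserves_prodMap {Y Z Y' Z' : Type*} [TopologicalSpace Y] [TopologicalSpace Z]
    [ConvexComb Y] [ConvexComb Z] [TopologicalSpace Y'] [TopologicalSpace Z']
    [ConvexComb Y'] [ConvexComb Z'] {f : C(Y, Z)} {g : C(Y', Z')} (hf : Preserves f)
    (hg : Preserves g) : Preserves (f.prodMap g) := by
  intro l v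
  ext t : 1
  exact Prod.ext (DFunLike.congr_fun (hf l (Prod.fst ∘ v)) t)
    (DFunLike.congr_fun (hg l (Prod.snd ∘ v)) t)

theorem preserves_id {Y : Type*} [TopologicalSpace Y] [ConvexComb Y] :
    Preserves (ContinuousMap.id Y) := fun _ _ => rfl

/-- The tuple of the vertices of a simplex. -/
def vertices (k : ℕ) : Fin k → TopSimplex k := stdSimplex.vertex

/-- Barycentric coordinates are the coefficients with respect to the vertices. Thus the identity of
the simplex comes from a tuple, which makes every singular simplex the image of a tuple chain. -/
theorem comb_vertices (k : ℕ) : comb (vertices k) = ContinuousMap.id (TopSimplex k) := by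
  ext t : 2
  change ((comb (vertices k) t : TopSimplex k) : Fin k → ℝ) = t
  rw [coe_comb]
  funext j
  simp [vertices, Finset.sum_apply, Pi.single_apply]

theorem face_comp_vertices {k : ℕ} (i : Fin (k + 1)) :
    TopSimplex.face i ∘ vertices k = vertices (k + 1) ∘ i.succAbove := by
  funext j
  exact stdSimplex.map_vertex _ _

/-- The barycenter of a nonempty tuple. -/
def bary {Y : Type*} [TopologicalSpace Y] [ConvexComb Y] {k : ℕ} (v : Fin (k + 1) → Y) : Y :=
  comb v stdSimplex.barycenter

theorem Preserves.bary {Y Z : Type*} [TopologicalSpace Y] [TopologicalSpace Z] [ConvexComb Y]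
    [ConvexComb Z] {f : C(Y, Z)} (hf : Preserves f) {k : ℕ} (v : Fin (k + 1) → Y) :
    f (bary v) = ConvexComb.bary (f ∘ v) :=
  DFunLike.congr_fun (hf _ v) _

end ConvexComb

/-- The singular chains of `X` on the simplices with `k` vertices. -/
abbrev SingChain (R : Type*) [CommRing R] (X : Type*) [TopologicalSpace X] (k : ℕ) : Type _ :=
  C(TopSimplex k, X) →₀ R

namespace SingChain

open ConvexComb

variable {R : Type*} [CommRing R] {X Y Z : Type*} [TopologicalSpace X] [TopologicalSpace Y]
  [TopologicalSpace Z]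

/-- The boundary operator. -/
def bd (k : ℕ) : SingChain R X (k + 1) →ₗ[R] SingChain R X k :=
  Finsupp.linearCombination R fun σ =>
    ∑ i : Fin (k + 1), (-1 : R) ^ (i : ℕ) • Finsupp.single (σ.comp (TopSimplex.face i)) 1

/-- The map induced by a continuous map. -/
def push (f : C(X, Y)) (k : ℕ) : SingChain R X k →ₗ[R] SingChain R Y k :=
  Finsupp.lmapDomain R R fun σ => f.comp σ

/-- The singular chain which is given by a chain of tuples. -/
def real [ConvexComb Y] (k : ℕ) : TupleChain R Y k →ₗ[R] SingChain R Y k :=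
  Finsupp.lmapDomain R R comb

theorem hom_ext {M : Type*} [AddCommGroup M] [Module R M] {k : ℕ} {φ ψ : SingChain R Y k →ₗ[R] M}
    (h : ∀ σ : C(TopSimplex k, Y), φ (Finsupp.single σ 1) = ψ (Finsupp.single σ 1)) : φ = ψ :=
  Finsupp.lhom_ext' fun v => LinearMap.ext_ring (h v)

theorem bd_single {k : ℕ} (σ : C(TopSimplex (k + 1), X)) :
    bd k (Finsupp.single σ (1 : R)) =
      ∑ i : Fin (k + 1), (-1 : R) ^ (i : ℕ) • Finsupp.single (σ.comp (TopSimplex.face i)) 1 := by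
  simp [bd]

@[simp] theorem push_single (f : C(X, Y)) {k : ℕ} (σ : C(TopSimplex k, X)) (r : R) :
    push f k (Finsupp.single σ r) = Finsupp.single (f.comp σ) r := by
  simp [push]

@[simp] theorem real_single [ConvexComb Y] {k : ℕ} (v : Fin k → Y) (r : R) :
    real k (Finsupp.single v r) = Finsupp.single (comb v) r := by
  simp [real]

theorem push_push (g : C(Y, Z)) (f : C(X, Y)) (k : ℕ) (x : SingChain R X k) :
    push g k (push f k x) = push (g.comp f) k x := by
  refine LinearMap.congr_fun (f := push g k ∘ₗ push f k) (g := push (g.comp f) k)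
    (hom_ext fun v => ?_) x
  simp [ContinuousMap.comp_assoc]

theorem push_id (k : ℕ) (x : SingChain R X k) : push (ContinuousMap.id X) k x = x := by
  refine LinearMap.congr_fun (f := push _ k) (g := LinearMap.id) (hom_ext fun v => ?_) x
  simp

theorem bd_push (f : C(X, Y)) (k : ℕ) (x : SingChain R X (k + 1)) :
    bd k (push f (k + 1) x) = push f k (bd k x) := by
  refine LinearMap.congr_fun (f := bd k ∘ₗ push f (k + 1)) (g := push f k ∘ₗ bd k)
    (hom_ext fun v => ?_) x
  simp [bd_single, ContinuousMap.comp_assoc]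

theorem bd_real [ConvexComb Y] (k : ℕ) (x : TupleChain R Y (k + 1)) :
    bd k (real (k + 1) x) = real k (TupleChain.bd k x) := by
  refine LinearMap.congr_fun (f := bd k ∘ₗ real (k + 1)) (g := real k ∘ₗ TupleChain.bd k)
    (TupleChain.hom_ext fun v => ?_) x
  simp [bd_single, TupleChain.bd_single, comb_face]

theorem push_real [ConvexComb Y] [ConvexComb Z] {f : C(Y, Z)} (hf : Preserves f) (k : ℕ)
    (x : TupleChain R Y k) : push f k (real k x) = real k (TupleChain.map f k x) := by
  refine LinearMap.congr_fun (f := push f k ∘ₗ real k) (g := real k ∘ₗ TupleChain.map f k)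
    (TupleChain.hom_ext fun v => ?_) x
  simp [hf k v]

/-- The vertices of a simplex, as a chain. -/
def univ (R : Type*) [CommRing R] (k : ℕ) : TupleChain R (TopSimplex k) k :=
  Finsupp.single (vertices k) 1

/-- Natural identities between operators on singular chains need only be checked on the vertex tuple
of the standard simplex. -/
theorem single_eq_push {k : ℕ} (σ : C(TopSimplex k, X)) :
    (Finsupp.single σ 1 : SingChain R X k) = push σ k (real k (univ R k)) := by
  simp [univ, comb_vertices]

theorem bd_univ (k : ℕ) : TupleChain.bd k (univ R (k + 1)) =
    ∑ i : Fin (k + 1), (-1 : R) ^ (i : ℕ) • TupleChain.map (TopSimplex.face i) k (univ R k) := by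
  simp [univ, TupleChain.bd_single, face_comp_vertices]

theorem bd_bd (k : ℕ) (x : SingChain R X (k + 2)) : bd k (bd (k + 1) x) = 0 := by
  refine LinearMap.congr_fun (f := bd k ∘ₗ bd (k + 1)) (g := 0) (hom_ext fun σ => ?_) x
  rw [LinearMap.comp_apply, single_eq_push, bd_push, bd_push, bd_real, bd_real, TupleChain.bd_bd]
  simp

/-- The operator which maps a simplex `σ` to the image of a fixed chain under a map that is given
by `σ`. -/
def natOp {k l : ℕ} (K : C(TopSimplex k, X) → C(Z, Y)) (θ : SingChain R Z l) :
    SingChain R X k →ₗ[R] SingChain R Y l :=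
  Finsupp.linearCombination R fun σ => push (K σ) l θ

@[simp] theorem natOp_single {k l : ℕ} (K : C(TopSimplex k, X) → C(Z, Y)) (θ : SingChain R Z l)
    (σ : C(TopSimplex k, X)) : natOp K θ (Finsupp.single σ 1) = push (K σ) l θ := by
  simp [natOp]

/-! ### Homotopies -/

section Prism

/-- The universal prism. -/
def prism (R : Type*) [CommRing R] (T : Type*) [TopologicalSpace T] [ConvexComb T] (k : ℕ) :
    TupleChain R T k →ₗ[R] TupleChain R (T × unitInterval) (k + 1) :=
  TupleChain.coneHomotopy (TupleChain.map fun y => (y, 1)) (TupleChain.map fun y => (y, 0))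
    (fun v => (bary v, 0)) k

theorem bd_prism {T : Type*} [TopologicalSpace T] [ConvexComb T] (k : ℕ)
    (x : TupleChain R T (k + 1)) :
    TupleChain.bd (k + 1) (prism R T (k + 1) x) =
      TupleChain.map (fun y => (y, 1)) (k + 1) x - TupleChain.map (fun y => (y, 0)) (k + 1) x -
        prism R T k (TupleChain.bd k x) := by
  refine TupleChain.bd_coneHomotopy (fun k x => TupleChain.bd_map _ k x)
    (fun k x => TupleChain.bd_map _ k x) (TupleChain.hom_ext fun v => ?_) _ k x
  -- In index 0 the two ends of the prism agree, since the empty tuple is the only one.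
  simp only [TupleChain.map_single]
  congr 1
  exact Subsingleton.elim _ _

theorem map_prism {T T' : Type*} [TopologicalSpace T] [ConvexComb T] [TopologicalSpace T']
    [ConvexComb T'] {f : C(T, T')} (hf : Preserves f) (k : ℕ) (x : TupleChain R T k) :
    TupleChain.map (f.prodMap (ContinuousMap.id unitInterval)) (k + 1) (prism R T k x) =
      prism R T' k (TupleChain.map f k x) := by
  refine TupleChain.map_coneHomotopy (fun k x => ?_) (fun k x => ?_) (fun v => ?_) k x
  · rw [TupleChain.map_map, TupleChain.map_map]
    rfl
  · rw [TupleChain.map_map, TupleChain.map_map]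
    rfl
  · exact Prod.ext (hf.bary v) rfl

/-- The chain homotopy given by a homotopy. -/
def homotopyOp (R : Type*) [CommRing R] (H : C(X × unitInterval, Y)) (k : ℕ) :
    SingChain R X k →ₗ[R] SingChain R Y (k + 1) :=
  natOp (fun σ => H.comp (σ.prodMap (ContinuousMap.id unitInterval)))
    (real (k + 1) (prism R (TopSimplex k) k (univ R k)))

theorem preserves_prodMk_const {T : Type*} [TopologicalSpace T] [ConvexComb T] (r : unitInterval) :
    Preserves ((ContinuousMap.id T).prodMk (ContinuousMap.const T r)) := by
  intro k v
  ext t : 1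
  refine Prod.ext rfl (Subtype.ext ?_)
  change (r : ℝ) = ∑ i, t i • (r : ℝ)
  rw [← Finset.sum_smul]
  exact ((congrArg (· • (r : ℝ)) t.2.2).trans (one_smul _ _)).symm

/-- On a simplex this is the image of the identity for the universal prism. Naturality of the prism
under the face inclusions identifies the prism over the boundary with the homotopy operator applied
to the boundary. -/
theorem bd_homotopyOp (H : C(X × unitInterval, Y)) (k : ℕ) (x : SingChain R X (k + 1)) :
    bd (k + 1) (homotopyOp R H (k + 1) x) =
      push (H.comp ((ContinuousMap.id X).prodMk (ContinuousMap.const X 1))) (k + 1) x -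
      push (H.comp ((ContinuousMap.id X).prodMk (ContinuousMap.const X 0))) (k + 1) x -
      homotopyOp R H k (bd k x) := by
  refine LinearMap.congr_fun (f := bd (k + 1) ∘ₗ homotopyOp R H (k + 1)) (g := push _ (k + 1) -
    push _ (k + 1) - homotopyOp R H k ∘ₗ bd k) (hom_ext fun σ => ?_) x
  have key : ∀ r : unitInterval, push (H.comp (σ.prodMap (ContinuousMap.id unitInterval))) (k + 1)
      (real (k + 1) (TupleChain.map (fun y => (y, r)) (k + 1) (univ R (k + 1)))) =
      push (H.comp ((ContinuousMap.id X).prodMk (ContinuousMap.const X r))) (k + 1)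
        (Finsupp.single σ 1) := fun r => by
    have := push_real (R := R) (preserves_prodMk_const (T := TopSimplex (k + 1)) r) (k + 1)
      (univ R (k + 1))
    change _ = real (k + 1) (TupleChain.map (fun y => (y, r)) (k + 1) (univ R (k + 1))) at this
    rw [← this, push_push, single_eq_push, push_push]
    rfl
  have key2 : ∀ i : Fin (k + 1), push (H.comp (σ.prodMap (ContinuousMap.id unitInterval))) (k + 1)
      (real (k + 1) (prism R _ k (TupleChain.map (TopSimplex.face i) k (univ R k)))) =
      homotopyOp R H k (Finsupp.single (σ.comp (TopSimplex.face i)) 1) := fun i => by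
    rw [← map_prism (preserves_face i), ← push_real (preserves_prodMap (preserves_face i)
      preserves_id), push_push, homotopyOp, natOp_single]
    rfl
  simp only [LinearMap.comp_apply, LinearMap.sub_apply]
  rw [homotopyOp, natOp_single, bd_push, bd_real, bd_prism, map_sub, map_sub, map_sub, map_sub,
    key, key, bd_univ, bd_single]
  simp only [map_sum, map_smul, key2]

end Prism

/-! ### Barycentric subdivision of singular chains -/

section Subdivision

/-- The `m`-fold barycentric subdivision. -/
def subdivOp (R : Type*) [CommRing R] (X : Type*) [TopologicalSpace X] (m k : ℕ) :
    SingChain R X k →ₗ[R] SingChain R X k :=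
  natOp (fun σ => σ) (real k ((TupleChain.subdiv bary k ^ m) (univ R k)))

/-- The universal homotopy between the `m`-fold barycentric subdivision and the identity. -/
def subdivHomotopy (R : Type*) [CommRing R] (m : ℕ) (T : Type*) [TopologicalSpace T]
    [ConvexComb T] (k : ℕ) : TupleChain R T k →ₗ[R] TupleChain R T (k + 1) :=
  TupleChain.coneHomotopy (fun k => TupleChain.subdiv bary k ^ m) (fun _ => LinearMap.id) bary k

theorem bd_subdivHomotopy {T : Type*} [TopologicalSpace T] [ConvexComb T] (m k : ℕ)
    (x : TupleChain R T (k + 1)) :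
    TupleChain.bd (k + 1) (subdivHomotopy R m T (k + 1) x) =
      (TupleChain.subdiv bary (k + 1) ^ m) x - x -
        subdivHomotopy R m T k (TupleChain.bd k x) := by
  exact TupleChain.bd_coneHomotopy (φ := fun k => TupleChain.subdiv bary k ^ m)
    (ψ := fun _ => LinearMap.id) (fun k x => TupleChain.bd_subdiv_pow bary m k x)
    (fun _ _ => rfl) (one_pow (M := Module.End R (TupleChain R T 0)) m) bary k x

theorem map_subdivHomotopy {T T' : Type*} [TopologicalSpace T] [ConvexComb T] [TopologicalSpace T']
    [ConvexComb T'] {f : C(T, T')} (hf : Preserves f) (m k : ℕ) (x : TupleChain R T k) :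
    TupleChain.map f (k + 1) (subdivHomotopy R m T k x) =
      subdivHomotopy R m T' k (TupleChain.map f k x) :=
  TupleChain.map_coneHomotopy (φ := fun k => TupleChain.subdiv bary k ^ m)
    (φ' := fun k => TupleChain.subdiv bary k ^ m) (ψ := fun _ => LinearMap.id)
    (ψ' := fun _ => LinearMap.id)
    (fun k x => TupleChain.map_subdiv_pow (fun v => hf.bary v) m k x)
    (fun _ _ => rfl) (fun v => hf.bary v) k x

/-- The homotopy between the `m`-fold barycentric subdivision and the identity. -/
def subdivHomotopyOp (R : Type*) [CommRing R] (X : Type*) [TopologicalSpace X] (m k : ℕ) :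
    SingChain R X k →ₗ[R] SingChain R X (k + 1) :=
  natOp (fun σ => σ) (real (k + 1) (subdivHomotopy R m (TopSimplex k) k (univ R k)))

/-- Transport of the universal identity, as for the prism: barycenters are preserved by the face
inclusions. -/
theorem bd_subdivHomotopyOp (m k : ℕ) (x : SingChain R X (k + 1)) :
    bd (k + 1) (subdivHomotopyOp R X m (k + 1) x) =
      subdivOp R X m (k + 1) x - x - subdivHomotopyOp R X m k (bd k x) := by
  refine LinearMap.congr_fun (f := bd (k + 1) ∘ₗ subdivHomotopyOp R X m (k + 1))
    (g := subdivOp R X m (k + 1) - LinearMap.id - subdivHomotopyOp R X m k ∘ₗ bd k)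
    (hom_ext fun σ => ?_) x
  have key : ∀ i : Fin (k + 1), push σ (k + 1)
      (real (k + 1) (subdivHomotopy R m _ k (TupleChain.map (TopSimplex.face i) k (univ R k)))) =
      subdivHomotopyOp R X m k (Finsupp.single (σ.comp (TopSimplex.face i)) 1) := fun i => by
    rw [← map_subdivHomotopy (preserves_face i), ← push_real (preserves_face i), push_push,
      subdivHomotopyOp, natOp_single]
  simp only [LinearMap.comp_apply, LinearMap.sub_apply, LinearMap.id_apply]
  rw [subdivHomotopyOp, natOp_single, bd_push, bd_real, bd_subdivHomotopy, map_sub, map_sub,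
    map_sub, map_sub, bd_univ, bd_single, ← single_eq_push, subdivOp, natOp_single]
  simp only [map_sum, map_smul, key]

end Subdivision

/-! ### Chains in subsets -/

/-- The chains whose simplices lie in `U`. -/
def inSet (R : Type*) [CommRing R] (U : Set X) (k : ℕ) : Submodule R (SingChain R X k) :=
  Finsupp.supported R R {σ | Set.range σ ⊆ U}

theorem single_mem_inSet {U : Set X} {k : ℕ} {σ : C(TopSimplex k, X)} (h : Set.range σ ⊆ U) :
    Finsupp.single σ 1 ∈ inSet R U k :=
  Finsupp.single_mem_supported R 1 h

theorem map_mem_of_mem_inSet {M : Type*} [AddCommGroup M] [Module R M] {U : Set X} {k : ℕ}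
    {φ : SingChain R X k →ₗ[R] M} {N : Submodule R M}
    (h : ∀ σ : C(TopSimplex k, X), Set.range σ ⊆ U → φ (Finsupp.single σ 1) ∈ N)
    {x : SingChain R X k} (hx : x ∈ inSet R U k) : φ x ∈ N :=
  map_mem_of_mem_supported h hx

theorem bd_mem_inSet {U : Set X} {k : ℕ} {x : SingChain R X (k + 1)}
    (hx : x ∈ inSet R U (k + 1)) : bd k x ∈ inSet R U k := by
  refine map_mem_of_mem_inSet (fun σ hσ => ?_) hx
  rw [bd_single]
  exact Submodule.sum_mem _ fun i _ => Submodule.smul_mem _ _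
    (single_mem_inSet ((Set.range_comp_subset_range (TopSimplex.face i) σ).trans hσ))

theorem push_mem_inSet {U : Set Y} {f : C(X, Y)} (hf : Set.range f ⊆ U) (k : ℕ)
    (x : SingChain R X k) : push f k x ∈ inSet R U k := by
  have hx : x ∈ inSet R Set.univ k := by simp [inSet]
  refine map_mem_of_mem_inSet (fun σ _ => ?_) hx
  rw [push_single]
  exact single_mem_inSet ((Set.range_comp_subset_range σ f).trans hf)

theorem subdivHomotopyOp_mem_inSet {U : Set X} (m : ℕ) {k : ℕ} {x : SingChain R X k}
    (hx : x ∈ inSet R U k) : subdivHomotopyOp R X m k x ∈ inSet R U (k + 1) := by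
  refine map_mem_of_mem_inSet (fun σ hσ => ?_) hx
  rw [subdivHomotopyOp, natOp_single]
  exact push_mem_inSet hσ _ _

theorem inSet_inter (U V : Set X) (k : ℕ) : inSet R (U ∩ V) k = inSet R U k ⊓ inSet R V k := by
  rw [inSet, inSet, inSet, ← Finsupp.supported_inter]
  congr 1
  ext σ
  exact Set.subset_inter_iff

end SingChain

end

noncomputable section

/-! ### Barycentric subdivisions become small -/

namespace SingChain

open ConvexComb

variable {R : Type*} [CommRing R] {X : Type*} [TopologicalSpace X]

/-- Since the coordinates sum to one, $y-\sum t_iv_i=\sum t_i(y-v_i)$, and the triangle inequality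
applies. -/
theorem dist_comb_le {n k : ℕ} (v : Fin k → TopSimplex n) (t : TopSimplex k) (y : TopSimplex n)
    {ε : Fin k → ℝ} (h : ∀ i, dist y (v i) ≤ ε i) : dist y (comb v t) ≤ ∑ i, t i * ε i := by
  have h1 : y.1 - (comb v t).1 = ∑ i, t i • (y.1 - (v i).1) := by
    simp only [smul_sub, Finset.sum_sub_distrib, ← Finset.sum_smul]
    rw [stdSimplex.sum_eq_one, one_smul]
    rfl
  rw [Subtype.dist_eq, dist_eq_norm, h1]
  refine (norm_sum_le _ _).trans (Finset.sum_le_sum fun i _ => ?_)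
  rw [norm_smul, Real.norm_of_nonneg (stdSimplex.zero_le t i)]
  refine mul_le_mul_of_nonneg_left ?_ (stdSimplex.zero_le t i)
  have := h i
  rwa [Subtype.dist_eq, dist_eq_norm] at this

theorem dist_comb_le_const {n k : ℕ} (v : Fin k → TopSimplex n) (t : TopSimplex k)
    (y : TopSimplex n) {ε : ℝ} (h : ∀ i, dist y (v i) ≤ ε) : dist y (comb v t) ≤ ε := by
  refine (dist_comb_le v t y h).trans_eq ?_
  rw [← Finset.sum_mul, stdSimplex.sum_eq_one, one_mul]

theorem dist_bary_le {n k N : ℕ} (hk : k ≤ N) (v : Fin (k + 1) → TopSimplex n) {δ : ℝ}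
    (h : ∀ i j, dist (v i) (v j) ≤ δ) (j : Fin (k + 1)) :
    dist (bary v) (v j) ≤ (N / (N + 1) : ℝ) * δ := by
  have hδ : 0 ≤ δ := dist_nonneg.trans (h j j)
  rw [dist_comm]
  -- The vertex $v_j$ is at distance 0 from itself, so only $k$ of the $k+1$ equal weights
  -- contribute. This gives the factor $k/(k+1)$, which is at most $N/(N+1)$.
  refine (dist_comb_le v stdSimplex.barycenter (v j) (ε := fun i => if i = j then 0 else δ)
    fun i => ?_).trans ?_
  · split_ifs with hi
    · rw [hi, dist_self]
    · exact h j i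
  · have h2 : ∀ i : Fin (k + 1), (stdSimplex.barycenter : TopSimplex (k + 1)) i =
        ((k : ℝ) + 1)⁻¹ := fun i => by
      exact (stdSimplex.barycenter_apply i).trans (by simp)
    simp only [h2]
    rw [← Finset.mul_sum, Fin.sum_univ_succAbove _ j]
    simp only [if_true, Fin.succAbove_ne, if_false, zero_add, Finset.sum_const, Finset.card_univ,
      Fintype.card_fin, nsmul_eq_mul]
    have hk' : (k : ℝ) ≤ N := by exact_mod_cast hk
    rw [← mul_assoc]
    refine mul_le_mul_of_nonneg_right ?_ hδ
    rw [inv_mul_eq_div, div_le_div_iff₀ (by positivity) (by positivity)]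
    nlinarith

/-- The second property says that a closed ball containing the old vertices contains the new ones.
The induction needs it to carry the bound for the barycenter from the vertices of a face to the
vertices of its subdivision. Fixing `N` gives the same contraction factor in all dimensions. -/
theorem subdiv_single_mem_supported {n N : ℕ} {δ : ℝ} {k : ℕ} (hk : k ≤ N + 1)
    (v : Fin k → TopSimplex n) (h : ∀ i j, dist (v i) (v j) ≤ δ) :
    TupleChain.subdiv bary k (Finsupp.single v (1 : R)) ∈ Finsupp.supported R R
      {w : Fin k → TopSimplex n | (∀ i j, dist (w i) (w j) ≤ (N / (N + 1) : ℝ) * δ) ∧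
        ∀ y ε, (∀ i, dist y (v i) ≤ ε) → ∀ j, dist y (w j) ≤ ε} := by
  induction k with
  | zero =>
    exact Finsupp.single_mem_supported R 1 ⟨fun i => i.elim0, fun _ _ _ j => j.elim0⟩
  | succ k ih =>
    rw [TupleChain.subdiv_succ_single, TupleChain.bd_single]
    simp only [map_sum, map_smul]
    refine Submodule.sum_mem _ fun i _ => Submodule.smul_mem _ _ ?_
    have hi := ih (by omega) (v ∘ i.succAbove) (fun _ _ => h _ _)
    refine map_mem_of_mem_supported ?_ hi
    rintro w ⟨hw1, hw2⟩
    rw [TupleChain.cone_single]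
    refine Finsupp.single_mem_supported R 1 ⟨?_, fun y ε hy => ?_⟩
    · have hb : ∀ j, dist (bary v) (w j) ≤ (N / (N + 1) : ℝ) * δ :=
        hw2 _ _ fun j => dist_bary_le (by omega) v h _
      have hδ : 0 ≤ (N / (N + 1) : ℝ) * δ :=
        mul_nonneg (by positivity) (dist_nonneg.trans (h 0 0))
      intro a b
      cases a using Fin.cases <;> cases b using Fin.cases
      · simpa using hδ
      · simpa using hb _
      · simpa [dist_comm] using hb _
      · simpa using hw1 _ _
    · intro j
      cases j using Fin.cases
      · exact dist_comb_le_const v _ y hy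
      · simpa using hw2 y ε (fun j => hy _) _

theorem subdiv_pow_univ_mem_supported (m k : ℕ) :
    (TupleChain.subdiv bary k ^ m) (univ R k) ∈ Finsupp.supported R R
      {w : Fin k → TopSimplex k | ∀ i j, dist (w i) (w j) ≤ (k / (k + 1) : ℝ) ^ m} := by
  induction m with
  | zero =>
    refine Finsupp.single_mem_supported R 1 fun i j => ?_
    rw [pow_zero]
    exact (Metric.dist_le_diam_of_mem (bounded_stdSimplex _) (vertices k i).2
      (vertices k j).2).trans diam_stdSimplex_le
  | succ m ih =>
    simp only [pow_succ' _ m, Module.End.mul_apply]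
    refine map_mem_of_mem_supported (fun w hw => ?_) ih
    exact Finsupp.supported_mono (fun w hw => hw.1) (subdiv_single_mem_supported (by omega) w hw)

theorem exists_subdivOp_single_mem {U V : Set X} (hU : IsOpen U) (hV : IsOpen V)
    (hUV : U ∪ V = Set.univ) {k : ℕ} (σ : C(TopSimplex k, X)) :
    ∃ m₀, ∀ m ≥ m₀, subdivOp R X m k (Finsupp.single σ 1) ∈ inSet R U k ⊔ inSet R V k := by
  -- A Lebesgue number of the cover of the simplex by the preimages of `U` and `V`; pieces of
  -- diameter below it map into one of the two sets.
  obtain ⟨δ, hδ, hb⟩ := lebesgue_number_lemma_of_metric (s := (Set.univ : Set (TopSimplex k)))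
    (c := fun i : Bool => σ ⁻¹' (bif i then U else V)) isCompact_univ
    (fun i => (by cases i <;> assumption : IsOpen (bif i then U else V)).preimage σ.continuous)
    (fun x _ => by
      have hx : σ x ∈ U ∪ V := hUV ▸ Set.mem_univ _
      rw [Set.mem_iUnion]
      rcases hx with hx | hx
      exacts [⟨true, hx⟩, ⟨false, hx⟩])
  have hq : (k / (k + 1) : ℝ) < 1 := by
    rw [div_lt_one (by positivity)]
    linarith
  obtain ⟨m₀, hm₀⟩ := exists_pow_lt_of_lt_one hδ hq
  refine ⟨m₀, fun m hm => ?_⟩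
  rw [subdivOp, natOp_single]
  have h := subdiv_pow_univ_mem_supported (R := R) m k
  refine map_mem_of_mem_supported (φ := push σ k ∘ₗ real k) (fun w hw => ?_) h
  rw [LinearMap.comp_apply, real_single, push_single]
  rcases k with _ | k
  -- The simplex without vertices is empty, so it lies in `U` for trivial reasons.
  · refine Submodule.mem_sup_left (single_mem_inSet ?_)
    rintro _ ⟨t, rfl⟩
    have := t.2.2
    simp at this
  · obtain ⟨i, hi⟩ := hb (w 0) (Set.mem_univ _)
    have hr : Set.range (σ.comp (comb w)) ⊆ bif i then U else V := by
      rintro _ ⟨t, rfl⟩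
      refine hi (Metric.mem_ball'.2 ?_)
      refine (dist_comb_le_const w t _ (hw 0)).trans_lt (lt_of_le_of_lt ?_ hm₀)
      exact pow_le_pow_of_le_one (by positivity) hq.le hm
    cases i
    · exact Submodule.mem_sup_right (single_mem_inSet hr)
    · exact Submodule.mem_sup_left (single_mem_inSet hr)

/-- Sufficiently fine subdivisions of a chain are sums of chains in the members of an open
cover. -/
theorem exists_subdivOp_mem {U V : Set X} (hU : IsOpen U) (hV : IsOpen V)
    (hUV : U ∪ V = Set.univ) {k : ℕ} (x : SingChain R X k) :
    ∃ m₀, ∀ m ≥ m₀, subdivOp R X m k x ∈ inSet R U k ⊔ inSet R V k := by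
  induction x using Finsupp.induction_linear with
  | zero => exact ⟨0, fun m _ => by simp⟩
  | add x y hx hy =>
    obtain ⟨a, ha⟩ := hx
    obtain ⟨b, hb⟩ := hy
    refine ⟨max a b, fun m hm => ?_⟩
    rw [map_add]
    exact Submodule.add_mem _ (ha m (le_of_max_le_left hm)) (hb m (le_of_max_le_right hm))
  | single σ r =>
    obtain ⟨m₀, h⟩ := exists_subdivOp_single_mem (R := R) hU hV hUV σ
    refine ⟨m₀, fun m hm => ?_⟩
    rw [← mul_one r, ← smul_eq_mul, ← Finsupp.smul_single, map_smul]
    exact Submodule.smul_mem _ _ (h m hm)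

end SingChain

end

/-! ### Reduced homology of subsets and the Mayer–Vietoris step -/

noncomputable section

namespace SingChain

open ConvexComb

variable {R : Type*} [CommRing R] {X Y : Type*} [TopologicalSpace X] [TopologicalSpace Y]

/-- The cycles of the augmented singular chain complex. -/
def cycles (R : Type*) [CommRing R] (X : Type*) [TopologicalSpace X] :
    ∀ k, Submodule R (SingChain R X k)
  | 0 => ⊤
  | k + 1 => LinearMap.ker (bd k)

theorem bd_mem_cycles (k : ℕ) (x : SingChain R X (k + 1)) : bd k x ∈ cycles R X k := by
  cases k with
  | zero => trivial
  | succ k => exact bd_bd k x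

theorem push_mem_cycles (f : C(X, Y)) {k : ℕ} {x : SingChain R X k} (hx : x ∈ cycles R X k) :
    push f k x ∈ cycles R Y k := by
  cases k with
  | zero => trivial
  | succ k =>
    have hx : bd k x = 0 := hx
    change bd k _ = 0
    rw [bd_push, hx, map_zero]

/-- The simplex with no vertices is empty. Hence chains in index 0 form a copy of $R$, and the
boundary into index 0 is the augmentation. -/
instance : Subsingleton C(TopSimplex 0, X) :=
  ⟨fun σ τ => ContinuousMap.ext fun t => absurd t.2.2 (by simp)⟩

theorem push_zero_eq (f g : C(X, Y)) (x : SingChain R X 0) : push f 0 x = push g 0 x :=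
  LinearMap.congr_fun (hom_ext (φ := push f 0) (ψ := push g 0) fun σ => by
    rw [push_single, push_single, Subsingleton.elim (f.comp σ) (g.comp σ)]) x

/-- In index 0 both sides vanish: the homotopy operator is zero there, and any two maps induce the
same map on the augmentation term. -/
theorem bd_homotopyOp_of_mem_cycles (H : C(X × unitInterval, Y)) {k : ℕ} {x : SingChain R X k}
    (hx : x ∈ cycles R X k) : bd k (homotopyOp R H k x) =
      push (H.comp ((ContinuousMap.id X).prodMk (ContinuousMap.const X 1))) k x -
      push (H.comp ((ContinuousMap.id X).prodMk (ContinuousMap.const X 0))) k x := by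
  cases k with
  | zero =>
    rw [push_zero_eq _ (H.comp ((ContinuousMap.id X).prodMk (ContinuousMap.const X 0))), sub_self]
    simp [homotopyOp, natOp, prism, TupleChain.coneHomotopy, Finsupp.linearCombination_apply]
  | succ k =>
    have hx : bd k x = 0 := hx
    rw [bd_homotopyOp, hx, map_zero, sub_zero]

theorem exists_bd_eq_push_sub_push {f g : C(X, Y)} (h : f.Homotopic g) {k : ℕ}
    {x : SingChain R X k} (hx : x ∈ cycles R X k) :
    ∃ y, bd k y = push f k x - push g k x := by
  obtain ⟨H⟩ := h.symm
  refine ⟨homotopyOp R (H.toContinuousMap.comp ContinuousMap.prodSwap) k x, ?_⟩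
  rw [bd_homotopyOp_of_mem_cycles _ hx]
  congr 3 <;> ext a <;> simp

theorem bd_subdivHomotopyOp_of_mem_cycles (m : ℕ) {k : ℕ} {x : SingChain R X k}
    (hx : x ∈ cycles R X k) :
    bd k (subdivHomotopyOp R X m k x) = subdivOp R X m k x - x := by
  cases k with
  | zero =>
    have h1 : (TupleChain.subdiv bary 0 ^ m : Module.End R (TupleChain R (TopSimplex 0) 0)) = 1 :=
      one_pow m
    have h2 : subdivOp R X m 0 = LinearMap.id := hom_ext fun σ => by
      rw [subdivOp, natOp_single, h1]
      exact (single_eq_push σ).symm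
    rw [h2, LinearMap.id_apply, sub_self]
    simp [subdivHomotopyOp, natOp, subdivHomotopy, TupleChain.coneHomotopy,
      Finsupp.linearCombination_apply]
  | succ k =>
    have hx : bd k x = 0 := hx
    rw [bd_subdivHomotopyOp, hx, map_zero, sub_zero]

/-- The vanishing of the reduced homology of a subset. -/
def IsAcyclic (R : Type*) [CommRing R] (U : Set X) : Prop :=
  ∀ k, ∀ x ∈ inSet R U k, x ∈ cycles R X k → ∃ y ∈ inSet R U (k + 1), bd k y = x

/-- The reduced homology of `W` is zero in the degrees below `N`, counted by the number of vertices,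
and it is free of rank one in the degree `N`. -/
structure HasSphereHomology (R : Type*) [CommRing R] (W : Set X) (N : ℕ) : Prop where
  exact : ∀ k < N, ∀ x ∈ inSet R W k, x ∈ cycles R X k → ∃ y ∈ inSet R W (k + 1), bd k y = x
  exists_generator : ∃ z ∈ inSet R W N, z ∈ cycles R X N ∧
    (∀ x ∈ inSet R W N, x ∈ cycles R X N →
      ∃ r : R, ∃ y ∈ inSet R W (N + 1), x = r • z + bd N y) ∧
    ∀ r : R, ∀ y ∈ inSet R W (N + 1), bd N y = r • z → r = 0

/-- A continuous map which maps `V` to `W` and is an isomorphism on reduced homology. -/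
structure IsHomologyIso (R : Type*) [CommRing R] (f : C(X, Y)) (V : Set X) (W : Set Y) :
    Prop where
  push_mem : ∀ k, ∀ x ∈ inSet R V k, push f k x ∈ inSet R W k
  surj : ∀ k, ∀ y ∈ inSet R W k, y ∈ cycles R Y k →
    ∃ x ∈ inSet R V k, x ∈ cycles R X k ∧ ∃ c ∈ inSet R W (k + 1), y = push f k x + bd k c
  inj : ∀ k, ∀ x ∈ inSet R V k, x ∈ cycles R X k → ∀ c ∈ inSet R W (k + 1),
    bd k c = push f k x → ∃ b ∈ inSet R V (k + 1), bd k b = x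

theorem IsHomologyIso.isAcyclic {f : C(X, Y)} {V : Set X} {W : Set Y} (h : IsHomologyIso R f V W)
    (hV : IsAcyclic R V) : IsAcyclic R W := by
  intro k y hy hyc
  obtain ⟨x, hx, hxc, c, hc, rfl⟩ := h.surj k y hy hyc
  obtain ⟨b, hb, rfl⟩ := hV k x hx hxc
  exact ⟨push f (k + 1) b + c, add_mem (h.push_mem _ _ hb) hc, by rw [map_add, bd_push]⟩

theorem IsHomologyIso.hasSphereHomology {f : C(X, Y)} {V : Set X} {W : Set Y} {N : ℕ}
    (h : IsHomologyIso R f V W) (hV : HasSphereHomology R V N) : HasSphereHomology R W N where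
  exact k hk y hy hyc := by
    obtain ⟨x, hx, hxc, c, hc, rfl⟩ := h.surj k y hy hyc
    obtain ⟨b, hb, rfl⟩ := hV.exact k hk x hx hxc
    exact ⟨push f (k + 1) b + c, add_mem (h.push_mem _ _ hb) hc, by rw [map_add, bd_push]⟩
  exists_generator := by
    obtain ⟨z, hz, hzc, h1, h2⟩ := hV.exists_generator
    refine ⟨push f N z, h.push_mem _ _ hz, push_mem_cycles f hzc, fun y hy hyc => ?_,
      fun r y hy hyr => ?_⟩
    · obtain ⟨x, hx, hxc, c, hc, rfl⟩ := h.surj N y hy hyc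
      obtain ⟨r, b, hb, rfl⟩ := h1 x hx hxc
      refine ⟨r, push f (N + 1) b + c, add_mem (h.push_mem _ _ hb) hc, ?_⟩
      rw [map_add, map_add, map_smul, bd_push, add_assoc]
    · obtain ⟨b, hb, hbz⟩ := h.inj N (r • z) (Submodule.smul_mem _ _ hz)
        (Submodule.smul_mem _ _ hzc) y hy (by rw [hyr, map_smul])
      exact h2 r b hb hbz

theorem mem_inSet_univ {k : ℕ} (x : SingChain R X k) : x ∈ inSet R Set.univ k := by
  simp [inSet]

/-- With a homotopy inverse $g$ of $f$, a cycle $y$ differs from $f_*g_*y$ by a boundary, and $x$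
from $g_*f_*x$. The first gives surjectivity and the second injectivity. -/
theorem isHomologyIso_homotopyEquiv (e : ContinuousMap.HomotopyEquiv X Y) :
    IsHomologyIso R e.toFun Set.univ Set.univ where
  push_mem _ _ _ := mem_inSet_univ _
  surj k y _ hyc := by
    obtain ⟨c, hc⟩ := exists_bd_eq_push_sub_push e.right_inv hyc
    refine ⟨push e.invFun k y, mem_inSet_univ _, push_mem_cycles _ hyc, -c, mem_inSet_univ _, ?_⟩
    rw [map_neg, hc, push_push, push_id]
    abel
  inj k x _ hxc c _ hc := by
    obtain ⟨b, hb⟩ := exists_bd_eq_push_sub_push e.left_inv hxc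
    refine ⟨push e.invFun (k + 1) c - b, mem_inSet_univ _, ?_⟩
    rw [map_sub, hb, bd_push, hc, push_push, push_id]
    abel

theorem push_injective {f : C(X, Y)} (hf : Function.Injective f) (k : ℕ) :
    Function.Injective (push (R := R) f k) :=
  Finsupp.mapDomain_injective fun _ _ h => ContinuousMap.ext fun t =>
    hf (DFunLike.congr_fun h t)

theorem exists_push_eq {f : C(X, Y)} (hf : Topology.IsInducing f) {k : ℕ} {y : SingChain R Y k}
    (hy : y ∈ inSet R (Set.range f) k) : ∃ x, push f k x = y := by
  refine map_mem_of_mem_inSet (φ := LinearMap.id) (N := LinearMap.range (push f k))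
    (fun σ hσ => ?_) hy
  choose g hg using fun t => hσ (Set.mem_range_self t)
  refine ⟨Finsupp.single ⟨g, hf.continuous_iff.2 ?_⟩ 1, ?_⟩
  · rw [show f ∘ g = σ from funext hg]
    exact σ.continuous
  · rw [push_single]
    congr 1
    exact ContinuousMap.ext hg

/-- Simplices in the image of an embedding lift uniquely and continuously, so the chain complexes
are already isomorphic. This passes between a subset as a space and chains supported in it. -/
theorem isHomologyIso_isEmbedding {f : C(X, Y)} (hf : Topology.IsEmbedding f) :
    IsHomologyIso R f Set.univ (Set.range f) where
  push_mem _ _ _ := push_mem_inSet subset_rfl _ _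
  surj k y hy hyc := by
    obtain ⟨x, rfl⟩ := exists_push_eq hf.isInducing hy
    refine ⟨x, mem_inSet_univ _, ?_, 0, zero_mem _, by simp⟩
    cases k with
    | zero => trivial
    | succ k =>
      have hyc : bd k _ = 0 := hyc
      rw [bd_push] at hyc
      exact push_injective hf.injective k (hyc.trans (map_zero _).symm)
  inj k x _ hxc c hc hcx := by
    obtain ⟨b, rfl⟩ := exists_push_eq hf.isInducing hc
    exact ⟨b, mem_inSet_univ _, push_injective hf.injective k (by rw [← hcx, bd_push])⟩

/-- Each index has exactly one singular simplex of a point and exactly one tuple, so singular chains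
and tuple chains coincide and the cone is a contraction. -/
theorem isAcyclic_unit : IsAcyclic R (Set.univ : Set Unit) := by
  let _ : ConvexComb Unit :=
    { comb := fun _ => ContinuousMap.const _ (), comb_face := fun _ _ => rfl }
  intro k x _ hxc
  have hinj : ∀ k, Function.Injective (real (R := R) (Y := Unit) k) := fun k =>
    Finsupp.mapDomain_injective fun _ _ _ => Subsingleton.elim _ _
  obtain ⟨y, rfl⟩ : ∃ y, real k y = x := by
    refine map_mem_of_mem_inSet (φ := LinearMap.id) (N := LinearMap.range (real (R := R) k))
      (fun σ _ => ⟨Finsupp.single (fun _ => ()) 1, ?_⟩) (mem_inSet_univ x)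
    rw [real_single]
    rfl
  refine ⟨real (k + 1) (TupleChain.cone () k y), mem_inSet_univ _, ?_⟩
  rw [bd_real]
  cases k with
  | zero => rw [TupleChain.bd_cone_zero]
  | succ k =>
    have hxc : bd k _ = 0 := hxc
    rw [bd_real] at hxc
    rw [TupleChain.bd_cone_succ, hinj k (hxc.trans (map_zero _).symm), map_zero, sub_zero]

theorem isAcyclic_of_contractibleSpace [ContractibleSpace X] :
    IsAcyclic R (Set.univ : Set X) := by
  obtain ⟨e⟩ := ContractibleSpace.hequiv_unit X
  exact (isHomologyIso_homotopyEquiv e.symm).isAcyclic isAcyclic_unit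

/-- A fine subdivision splits into a part in `U` and a part in `V`, and a cycle is homologous to its
subdivisions. -/
theorem exists_eq_add_add_bd {U V : Set X} (hU : IsOpen U) (hV : IsOpen V)
    (hUV : U ∪ V = Set.univ) {k : ℕ} {x : SingChain R X k} (hx : x ∈ cycles R X k) :
    ∃ a ∈ inSet R U k, ∃ b ∈ inSet R V k, ∃ y, x = a + b + bd k y := by
  obtain ⟨m, hm⟩ := exists_subdivOp_mem hU hV hUV x
  obtain ⟨a, ha, b, hb, hab⟩ := Submodule.mem_sup.1 (hm m le_rfl)
  refine ⟨a, ha, b, hb, -subdivHomotopyOp R X m k x, ?_⟩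
  rw [hab, map_neg, bd_subdivHomotopyOp_of_mem_cycles m hx]
  abel

theorem inSet_mono {U V : Set X} (h : U ⊆ V) (k : ℕ) : inSet R U k ≤ inSet R V k :=
  Finsupp.supported_mono fun _ hσ => Set.Subset.trans hσ h

/-- A space which is the union of two open acyclic sets is a homology suspension of their
intersection. -/
theorem hasSphereHomology_of_union {U V : Set X} (hU : IsOpen U) (hV : IsOpen V)
    (hUV : U ∪ V = Set.univ) (aU : IsAcyclic R U) (aV : IsAcyclic R V) {N : ℕ}
    (h : HasSphereHomology R (U ∩ V) N) : HasSphereHomology R (Set.univ : Set X) (N + 1) where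
  exact k hk x _ hxc := by
    obtain ⟨a, ha, b, hb, y, rfl⟩ := exists_eq_add_add_bd hU hV hUV hxc
    cases k with
    | zero =>
      obtain ⟨a', -, rfl⟩ := aU 0 a ha trivial
      obtain ⟨b', -, rfl⟩ := aV 0 b hb trivial
      exact ⟨a' + b' + y, mem_inSet_univ _, by simp⟩
    | succ k =>
      have hab : bd k a + bd k b = 0 := by
        have : bd k (a + b + bd (k + 1) y) = 0 := hxc
        simpa [bd_bd] using this
      -- The boundaries of the two parts cancel, so their common support lies in both sets. Once it
      -- is bounded in the intersection, both parts can be closed up to cycles in acyclic sets.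
      have hW : bd k a ∈ inSet R (U ∩ V) k := by
        rw [inSet_inter]
        refine ⟨bd_mem_inSet ha, ?_⟩
        rw [eq_neg_of_add_eq_zero_left hab]
        exact neg_mem (bd_mem_inSet hb)
      obtain ⟨f, hf, hfa⟩ := h.exact k (by omega) _ hW (bd_mem_cycles k a)
      obtain ⟨a', -, ha'⟩ := aU (k + 1) (a - f)
        (sub_mem ha (inSet_mono Set.inter_subset_left _ hf))
        (show bd k (a - f) = 0 by rw [map_sub, hfa, sub_self])
      obtain ⟨b', -, hb'⟩ := aV (k + 1) (b + f)
        (add_mem hb (inSet_mono Set.inter_subset_right _ hf))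
        (show bd k (b + f) = 0 by rw [map_add, hfa, add_comm, hab])
      refine ⟨a' + b' + y, mem_inSet_univ _, ?_⟩
      rw [map_add, map_add, ha', hb']
      abel
  exists_generator := by
    obtain ⟨z, hz, hzc, h1, h2⟩ := h.exists_generator
    -- Two fillings of the old generator, one on each side. Their difference is the suspended
    -- generator.
    obtain ⟨a₀, ha₀, ha₀z⟩ := aU N z (inSet_mono Set.inter_subset_left _ hz) hzc
    obtain ⟨b₀, hb₀, hb₀z⟩ := aV N z (inSet_mono Set.inter_subset_right _ hz) hzc
    refine ⟨a₀ - b₀, mem_inSet_univ _,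
      show bd N (a₀ - b₀) = 0 by rw [map_sub, ha₀z, hb₀z, sub_self], fun x _ hxc => ?_,
      fun r y _ hy => ?_⟩
    · obtain ⟨a, ha, b, hb, y, rfl⟩ := exists_eq_add_add_bd hU hV hUV hxc
      have hab : bd N a + bd N b = 0 := by
        have : bd N (a + b + bd (N + 1) y) = 0 := hxc
        simpa [bd_bd] using this
      have hW : bd N a ∈ inSet R (U ∩ V) N := by
        rw [inSet_inter]
        refine ⟨bd_mem_inSet ha, ?_⟩
        rw [eq_neg_of_add_eq_zero_left hab]
        exact neg_mem (bd_mem_inSet hb)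
      obtain ⟨r, f, hf, hfa⟩ := h1 _ hW (bd_mem_cycles N a)
      obtain ⟨a', -, ha'⟩ := aU (N + 1) (a - r • a₀ - f)
        (sub_mem (sub_mem ha (Submodule.smul_mem _ _ ha₀))
          (inSet_mono Set.inter_subset_left _ hf))
        (show bd N (a - r • a₀ - f) = 0 by
          rw [map_sub, map_sub, map_smul, hfa, ha₀z]; abel)
      obtain ⟨b', -, hb'⟩ := aV (N + 1) (b + r • b₀ + f)
        (add_mem (add_mem hb (Submodule.smul_mem _ _ hb₀))
          (inSet_mono Set.inter_subset_right _ hf))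
        (show bd N (b + r • b₀ + f) = 0 by
          rw [map_add, map_add, map_smul, hb₀z, add_assoc, ← hfa, add_comm, hab])
      refine ⟨r, a' + b' + y, mem_inSet_univ _, ?_⟩
      rw [map_add, map_add, ha', hb', smul_sub]
      abel
    -- The bounding chain `y` need not split, but a subdivision of it does. Subdivision changes its
    -- boundary by the boundary of `T` applied to `r • (a₀ - b₀)`. As `T` preserves supports, this
    -- correction splits as well.
    · obtain ⟨m, hm⟩ := exists_subdivOp_mem hU hV hUV y
      obtain ⟨a, ha, b, hb, hab⟩ := Submodule.mem_sup.1 (hm m le_rfl)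
      set T := subdivHomotopyOp R X m (N + 1)
      have e1 : bd (N + 1) a + bd (N + 1) b =
          r • (a₀ - b₀) + r • (bd (N + 1) (T a₀) - bd (N + 1) (T b₀)) := by
        have e2 := congrArg (bd (N + 1)) (bd_subdivHomotopyOp m (N + 1) y)
        rw [bd_bd, ← hab, hy] at e2
        simp only [map_sub, map_add, map_smul, hy] at e2
        rw [eq_comm, sub_eq_zero, sub_eq_iff_eq_add'] at e2
        rw [e2]
      -- The terms on the `U` side equal minus those on the `V` side, so `g` lies in the
      -- intersection. The boundary of `-g` is `r • z`, which forces `r = 0` by the hypothesis on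
      -- the intersection.
      set g := bd (N + 1) a - r • (a₀ + bd (N + 1) (T a₀)) with hg
      have hg' : g = -bd (N + 1) b - r • (b₀ + bd (N + 1) (T b₀)) := by
        rw [hg, sub_eq_iff_eq_add, ← sub_eq_zero]
        rw [← sub_eq_zero] at e1
        rw [← e1]
        simp only [smul_sub, smul_add]
        abel
      refine h2 r (-g) (neg_mem ?_) ?_
      · rw [inSet_inter]
        constructor
        · exact sub_mem (bd_mem_inSet ha) (Submodule.smul_mem _ _
            (add_mem ha₀ (bd_mem_inSet (subdivHomotopyOp_mem_inSet m ha₀))))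
        · rw [hg']
          exact sub_mem (neg_mem (bd_mem_inSet hb)) (Submodule.smul_mem _ _
            (add_mem hb₀ (bd_mem_inSet (subdivHomotopyOp_mem_inSet m hb₀))))
      · simp [hg, bd_bd, ha₀z]

end SingChain

end

noncomputable section

/-! ### The homology of spheres -/

namespace SingChain

open ConvexComb

variable {R : Type*} [CommRing R]

/-- The empty space is the sphere of dimension $-1$. Its augmented complex is $R$ in index 0 and
zero elsewhere, because a simplex with a vertex has no map to it. -/
theorem hasSphereHomology_of_isEmpty {X : Type*} [TopologicalSpace X] [IsEmpty X] :
    HasSphereHomology R (Set.univ : Set X) 0 where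
  exact k hk := absurd hk k.not_lt_zero
  exists_generator := by
    have σ₀ : C(TopSimplex 0, X) := ⟨fun t => absurd t.2.2 (by simp), by
      rw [continuous_iff_continuousAt]
      exact fun t => absurd t.2.2 (by simp)⟩
    refine ⟨Finsupp.single σ₀ 1, mem_inSet_univ _, trivial, fun x _ _ => ⟨x σ₀, 0, zero_mem _, ?_⟩,
      fun r y _ hy => ?_⟩
    · ext σ
      rw [Subsingleton.elim σ σ₀]
      simp
    · have : IsEmpty C(TopSimplex 1, X) :=
        ⟨fun σ => isEmptyElim (σ (stdSimplex.vertex 0))⟩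
      rw [Subsingleton.elim y 0, map_zero] at hy
      simpa using (DFunLike.congr_fun hy σ₀).symm

/-- A space times a contractible space. -/
def homotopyEquivProd (X Y : Type*) [TopologicalSpace X] [TopologicalSpace Y]
    [ContractibleSpace Y] : ContinuousMap.HomotopyEquiv X (X × Y) :=
  (Homeomorph.prodPUnit X).symm.toHomotopyEquiv.trans
    ((ContinuousMap.HomotopyEquiv.refl X).prodCongr
      (ContractibleSpace.hequiv_unit Y).some.symm)

section Punctured

variable {F : Type*} [NormedAddCommGroup F]

/-- The product of `F` and `ℝ` without a closed half-line, for a sign `ε`. -/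
def slit (F : Type*) [NormedAddCommGroup F] (ε : ℝ) : Set (F × ℝ) := {p | p.1 ≠ 0 ∨ 0 < ε * p.2}

theorem isOpen_slit (ε : ℝ) : IsOpen {p : {p : F × ℝ // p ≠ 0} | p.1 ∈ slit F ε} := by
  refine IsOpen.preimage continuous_subtype_val (IsOpen.union ?_ ?_)
  · exact isOpen_ne_fun continuous_fst continuous_const
  · exact isOpen_lt continuous_const (continuous_const.mul continuous_snd)

variable [NormedSpace ℝ F]

/-- On the segment to the centre $(0,\varepsilon)$ the quantity $\varepsilon t$ becomes
$a+b\,\varepsilon t$, using $\varepsilon^2=1$. A nonzero first coordinate stays nonzero until the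
centre is reached, and a positive $\varepsilon t$ stays positive. -/
theorem starConvex_slit {ε : ℝ} (hε : ε * ε = 1) : StarConvex ℝ ((0 : F), ε) (slit F ε) := by
  rintro ⟨x, t⟩ hp a b ha hb hab
  simp only [slit, Set.mem_ofPred_eq, Prod.smul_mk, smul_zero, Prod.mk_add_mk, zero_add,
    smul_eq_mul] at hp ⊢
  have h : ε * (a * ε + b * t) = a + b * (ε * t) := by linear_combination a * hε
  rw [h]
  rcases hb.eq_or_lt with rfl | hb
  · right; simp; linarith
  · rcases hp with hp | hp
    · left
      exact smul_ne_zero hb.ne' hp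
    · right
      positivity

theorem isAcyclic_slit {ε : ℝ} (hε : ε * ε = 1) :
    IsAcyclic R {p : {p : F × ℝ // p ≠ 0} | p.1 ∈ slit F ε} := by
  have : ContractibleSpace (slit F ε) := (starConvex_slit hε).contractibleSpace
    ⟨(0, ε), Or.inr (by simp [hε])⟩
  have hne : ∀ p : slit F ε, p.1 ≠ 0 := by
    rintro ⟨p, hp | hp⟩ h <;> simp [show p = 0 from h] at hp
  let f : C(slit F ε, {p : F × ℝ // p ≠ 0}) :=
    ⟨fun p => ⟨p.1, hne p⟩,
      continuous_subtype_val.subtype_mk _⟩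
  have hf : Topology.IsEmbedding f := Topology.IsEmbedding.of_comp f.continuous
    continuous_subtype_val (Topology.IsEmbedding.subtypeVal (p := (· ∈ slit F ε)))
  have hr : Set.range f = {p : {p : F × ℝ // p ≠ 0} | p.1 ∈ slit F ε} := by
    ext p
    exact ⟨fun ⟨q, hq⟩ => hq ▸ q.2, fun hp => ⟨⟨p.1, hp⟩, rfl⟩⟩
  rw [← hr]
  exact (isHomologyIso_isEmbedding hf).isAcyclic isAcyclic_of_contractibleSpace

/-- Removing either of two opposite closed half-lines from $F\times\mathbb R$ leaves a contractible
open set. The two sets cover the punctured product and meet in $(F\setminus 0)\times\mathbb R\simeq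
F\setminus 0$, so passing from $F$ to $F\times\mathbb R$ is a homology suspension. -/
theorem hasSphereHomology_punctured_prod {N : ℕ}
    (h : HasSphereHomology R (Set.univ : Set {x : F // x ≠ 0}) N) :
    HasSphereHomology R (Set.univ : Set {p : F × ℝ // p ≠ 0}) (N + 1) := by
  refine hasSphereHomology_of_union (isOpen_slit 1) (isOpen_slit (-1)) ?_
    (isAcyclic_slit (by norm_num)) (isAcyclic_slit (by norm_num)) ?_
  · ext ⟨⟨x, t⟩, hp⟩
    simp only [slit, Set.mem_union, Set.mem_ofPred_eq, Set.mem_univ, iff_true]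
    by_cases hx : x = 0
    · subst hx
      have : t ≠ 0 := fun ht => hp (by rw [ht]; rfl)
      rcases this.lt_or_gt with ht | ht
      · right; right; linarith
      · left; right; linarith
    · exact Or.inl (Or.inl hx)
  · let f : C({x : F // x ≠ 0} × ℝ, {p : F × ℝ // p ≠ 0}) :=
      ⟨fun p => ⟨(p.1.1, p.2), fun h => p.1.2 (congrArg Prod.fst h)⟩, by fun_prop⟩
    have hf : Topology.IsEmbedding f := Topology.IsEmbedding.of_comp f.continuous
      continuous_subtype_val
      ((Topology.IsEmbedding.subtypeVal (p := (· ≠ (0 : F)))).prodMap Topology.IsEmbedding.id)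
    have hr : Set.range f = {p : {p : F × ℝ // p ≠ 0} | p.1 ∈ slit F 1} ∩
        {p : {p : F × ℝ // p ≠ 0} | p.1 ∈ slit F (-1)} := by
      ext ⟨⟨x, t⟩, hp⟩
      constructor
      · rintro ⟨⟨⟨y, hy⟩, s⟩, h⟩
        obtain rfl : y = x := congrArg (fun p => p.1.1) h
        exact ⟨Or.inl hy, Or.inl hy⟩
      · rintro ⟨h1, h2⟩
        have hx : x ≠ 0 := by
          rintro rfl
          simp only [slit, Set.mem_ofPred_eq, ne_eq, not_true_eq_false, false_or] at h1 h2
          linarith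
        exact ⟨(⟨x, hx⟩, t), rfl⟩
    rw [← hr]
    exact (isHomologyIso_isEmbedding hf).hasSphereHomology
      ((isHomologyIso_homotopyEquiv (homotopyEquivProd _ ℝ)).hasSphereHomology h)

end Punctured

/-- Suspension is applied to punctured vector spaces because these decompose as products without
spherical coordinates. The induction starts with the zero space, which becomes empty when punctured.
-/
theorem hasSphereHomology_punctured (N : ℕ) (E : Type) [NormedAddCommGroup E] [NormedSpace ℝ E]
    [FiniteDimensional ℝ E] (hE : Module.finrank ℝ E = N) :
    HasSphereHomology R (Set.univ : Set {x : E // x ≠ 0}) N := by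
  induction N generalizing E with
  | zero =>
    have := Module.finrank_zero_iff.1 hE
    have : IsEmpty {x : E // x ≠ 0} := ⟨fun x => x.2 (Subsingleton.elim _ _)⟩
    exact hasSphereHomology_of_isEmpty
  | succ N ih =>
    have h := hasSphereHomology_punctured_prod (ih (EuclideanSpace ℝ (Fin N)) (by simp))
    obtain ⟨e⟩ := FiniteDimensional.nonempty_continuousLinearEquiv_of_finrank_eq (𝕜 := ℝ)
      (E := EuclideanSpace ℝ (Fin N) × ℝ) (F := E) (by simp [hE])
    let e' : {p : EuclideanSpace ℝ (Fin N) × ℝ // p ≠ 0} ≃ₜ {x : E // x ≠ 0} :=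
      e.toHomeomorph.subtype fun p => by simp
    exact (isHomologyIso_homotopyEquiv e'.toHomotopyEquiv).hasSphereHomology h

/-- Polar coordinates write $E\setminus 0$ as sphere times open ray, and the ray is contractible.
The index is $n+1$ because an $n$-simplex has $n+1$ vertices. -/
theorem hasSphereHomology_sphere (n : ℕ) :
    HasSphereHomology R (Set.univ : Set (TopCat.sphere.{0} n)) (n + 1) := by
  let E := EuclideanSpace ℝ (Fin (n + 1))
  have h := hasSphereHomology_punctured (R := R) (n + 1) E (by simp [E])
  have : ContractibleSpace (Set.Ioi (0 : ℝ)) := (convex_Ioi 0).contractibleSpace ⟨1, by simp⟩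
  let e₁ : {x : E // x ≠ 0} ≃ₜ Metric.sphere (0 : E) 1 × Set.Ioi (0 : ℝ) :=
    homeomorphUnitSphereProd E
  let e₂ : Metric.sphere (0 : E) 1 ≃ₜ TopCat.sphere.{0} n := Homeomorph.ulift.symm
  have e := (e₁.toHomotopyEquiv.trans (homotopyEquivProd _ _).symm).trans e₂.toHomotopyEquiv
  exact (isHomologyIso_homotopyEquiv e).hasSphereHomology h

end SingChain

end

noncomputable section

/-! ### Contractions and the dual of the singular chains -/

namespace SingChain

variable {R : Type*} [CommRing R] {X : Type*} [TopologicalSpace X]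

open Classical in
/-- A contraction of the augmented singular chain complex, in the degrees in which it is exact. -/
def contraction (R : Type*) [CommRing R] (X : Type*) [TopologicalSpace X] :
    ∀ k, SingChain R X k →ₗ[R] SingChain R X (k + 1)
  | 0 => Finsupp.linearCombination R fun σ =>
      -- The value 0 is only a default; where the complex is exact a preimage exists.
      if h : ∃ y, bd 0 y = Finsupp.single σ (1 : R) then h.choose else 0
  | k + 1 => Finsupp.linearCombination R fun σ =>
      if h : ∃ y, bd (k + 1) y = Finsupp.single σ (1 : R) -
        contraction R X k (bd k (Finsupp.single σ 1)) then h.choose else 0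

theorem bd_contraction_zero {N : ℕ} (hX : HasSphereHomology R (Set.univ : Set X) N) (hN : 0 < N)
    (x : SingChain R X 0) : bd 0 (contraction R X 0 x) = x := by
  refine LinearMap.congr_fun (f := bd 0 ∘ₗ contraction R X 0) (g := LinearMap.id)
    (hom_ext fun σ => ?_) x
  obtain ⟨y, -, hy⟩ := hX.exact 0 hN (Finsupp.single σ 1) (mem_inSet_univ _) trivial
  have h : ∃ y, bd 0 y = Finsupp.single σ (1 : R) := ⟨y, hy⟩
  rw [LinearMap.comp_apply, contraction, Finsupp.linearCombination_single, one_smul, dif_pos h,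
    h.choose_spec, LinearMap.id_apply]

/-- If $c$ inverts the boundary on cycles one index lower, then $\sigma-c(\partial\sigma)$ is a
cycle, and exactness supplies the chain chosen in the definition. -/
theorem bd_contraction_succ_aux {N : ℕ} (hX : HasSphereHomology R (Set.univ : Set X) N) {k : ℕ}
    (hk : k + 1 < N) (h : ∀ x ∈ cycles R X k, bd k (contraction R X k x) = x)
    (x : SingChain R X (k + 1)) :
    bd (k + 1) (contraction R X (k + 1) x) = x - contraction R X k (bd k x) := by
  refine LinearMap.congr_fun (f := bd (k + 1) ∘ₗ contraction R X (k + 1))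
    (g := LinearMap.id - contraction R X k ∘ₗ bd k) (hom_ext fun σ => ?_) x
  obtain ⟨y, -, hy⟩ := hX.exact (k + 1) hk
    (Finsupp.single σ 1 - contraction R X k (bd k (Finsupp.single σ 1))) (mem_inSet_univ _)
    (show bd k _ = 0 by rw [map_sub, h _ (bd_mem_cycles k _), sub_self])
  have h : ∃ y, bd (k + 1) y = Finsupp.single σ (1 : R) -
    contraction R X k (bd k (Finsupp.single σ 1)) := ⟨y, hy⟩
  rw [LinearMap.comp_apply, contraction, Finsupp.linearCombination_single, one_smul, dif_pos h,
    h.choose_spec]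
  rfl

theorem bd_contraction_of_mem_cycles {N : ℕ} (hX : HasSphereHomology R (Set.univ : Set X) N) {k : ℕ}
    (hk : k < N) {x : SingChain R X k} (hx : x ∈ cycles R X k) :
    bd k (contraction R X k x) = x := by
  induction k with
  | zero => exact bd_contraction_zero hX hk x
  | succ k ih =>
    have hx : bd k x = 0 := hx
    rw [bd_contraction_succ_aux hX hk (fun x hx => ih (by omega) hx), hx, map_zero, sub_zero]

theorem bd_contraction_succ {N : ℕ} (hX : HasSphereHomology R (Set.univ : Set X) N) {k : ℕ}
    (hk : k + 1 < N) (x : SingChain R X (k + 1)) :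
    bd (k + 1) (contraction R X (k + 1) x) = x - contraction R X k (bd k x) :=
  bd_contraction_succ_aux hX hk
    (fun _ hx => bd_contraction_of_mem_cycles hX (by omega) hx) x

/-- The chain $x-c(\partial x)$ is always a cycle, and $\rho(x)$ is its coefficient at the
fundamental cycle $z$. This makes $\rho$ a cocycle with value 1 on $z$, and the last clause is what
later makes cocycles vanishing on $z$ exact. -/
theorem exists_coefficient {n : ℕ} (hX : HasSphereHomology R (Set.univ : Set X) (n + 1)) :
    ∃ z : SingChain R X (n + 1), bd n z = 0 ∧ ∃ ρ : SingChain R X (n + 1) →ₗ[R] R,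
      ρ z = 1 ∧ (∀ y, ρ (bd (n + 1) y) = 0) ∧
        ∀ x, ∃ y, x - contraction R X n (bd n x) = ρ x • z + bd (n + 1) y := by
  obtain ⟨z, -, hz, h1, h2⟩ := hX.exists_generator
  have hz : bd n z = 0 := hz
  have hx : ∀ x, ∃ r : R, ∃ y, x - contraction R X n (bd n x) = r • z + bd (n + 1) y := fun x => by
    obtain ⟨r, y, -, h⟩ := h1 (x - contraction R X n (bd n x)) (mem_inSet_univ _)
      (show bd n _ = 0 by
        rw [map_sub, bd_contraction_of_mem_cycles hX (by omega) (bd_mem_cycles n x), sub_self])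
    exact ⟨r, y, h⟩
  choose ρ y hρ using hx
  -- The coefficient is unique because no nonzero multiple of `z` bounds. This makes the chosen `ρ`
  -- linear, although the chosen chains `y` need not depend linearly on `x`.
  have uniq : ∀ r s : R, ∀ a b, r • z + bd (n + 1) a = s • z + bd (n + 1) b → r = s := by
    intro r s a b h
    refine sub_eq_zero.1 (h2 (r - s) (b - a) (mem_inSet_univ _) ?_)
    rw [map_sub, sub_smul, sub_eq_sub_iff_add_eq_add]
    exact (add_comm _ _).trans h.symm
  refine ⟨z, hz, ⟨⟨ρ, fun a b => ?_⟩, fun r a => ?_⟩, ?_, fun a => ?_, fun x => ⟨y x, hρ x⟩⟩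
  · refine uniq _ _ (y (a + b)) (y a + y b) ?_
    have e : (ρ a + ρ b) • z + bd (n + 1) (y a + y b) =
        (ρ a • z + bd (n + 1) (y a)) + (ρ b • z + bd (n + 1) (y b)) := by
      rw [map_add, add_smul, add_add_add_comm]
    rw [e, ← hρ (a + b), ← hρ a, ← hρ b, map_add, map_add, add_sub_add_comm]
  · refine uniq _ _ (y (r • a)) (r • y a) ?_
    have e : (r * ρ a) • z + bd (n + 1) (r • y a) = r • (ρ a • z + bd (n + 1) (y a)) := by
      rw [LinearMap.map_smul, smul_add, mul_smul]
    have e' : r • a - contraction R X n (bd n (r • a)) =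
        r • (a - contraction R X n (bd n a)) := by
      rw [LinearMap.map_smul, LinearMap.map_smul, smul_sub]
    exact (hρ _).symm.trans (e'.trans ((congrArg (r • ·) (hρ a)).trans e.symm))
  · refine uniq (ρ z) 1 (y z) 0 ((hρ z).symm.trans ?_)
    rw [hz]
    simp
  · refine uniq (ρ (bd (n + 1) a)) 0 (y _) a ((hρ _).symm.trans ?_)
    rw [bd_bd]
    simp

end SingChain

/-! ### Cochains as functionals on chains -/

namespace SSetCochain

open CategoryTheory Simplicial Opposite SingChain

variable {R : Type*} [CommRing R] {X : TopCat.{0}}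

/-- Cochains are linear functionals on chains. -/
def dual (R : Type*) [CommRing R] (X : TopCat.{0}) (k : ℕ) :
    SSetCochain (TopCat.toSSet.obj X) R k ≃ₗ[R] (SingChain R X (k + 1) →ₗ[R] R) where
  toFun φ := Finsupp.linearCombination R fun σ => φ ((X.toSSetObjEquiv (op ⦋k⦌)).symm σ)
  invFun ψ := fun σ => ψ (Finsupp.single (X.toSSetObjEquiv (op ⦋k⦌) σ) 1)
  map_add' φ ψ := SingChain.hom_ext fun σ => by
    simp only [Finsupp.linearCombination_single, one_smul, LinearMap.add_apply]
    rfl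
  map_smul' r φ := SingChain.hom_ext fun σ => by
    simp only [Finsupp.linearCombination_single, one_smul, LinearMap.smul_apply]
    rfl
  left_inv φ := by
    funext σ
    simp
  right_inv ψ := SingChain.hom_ext fun σ => by simp

theorem dual_single {k : ℕ} (φ : SSetCochain (TopCat.toSSet.obj X) R k)
    (σ : C(TopSimplex (k + 1), X)) :
    dual R X k φ (Finsupp.single σ 1) = φ ((X.toSSetObjEquiv (op ⦋k⦌)).symm σ) :=
  (Finsupp.linearCombination_single _ _ _).trans (one_smul _ _)

theorem dual_coboundary {k : ℕ} (φ : SSetCochain (TopCat.toSSet.obj X) R k) :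
    dual R X (k + 1) (coboundary k φ) = dual R X k φ ∘ₗ bd (k + 1) := by
  refine SingChain.hom_ext fun σ => ?_
  rw [dual_single, LinearMap.comp_apply, bd_single, coboundary_apply, map_sum]
  refine Finset.sum_congr rfl fun i _ => ?_
  rw [map_smul, dual_single, smul_eq_mul]
  congr 2

/-- The dual of the contraction of the singular chains. -/
def cocontraction (R : Type*) [CommRing R] (X : TopCat.{0}) (k : ℕ) :
    SSetCochain (TopCat.toSSet.obj X) R (k + 1) →ₗ[R] SSetCochain (TopCat.toSSet.obj X) R k :=
  (dual R X k).symm.toLinearMap ∘ₗ LinearMap.lcomp R R (contraction R X (k + 1)) ∘ₗ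
    (dual R X (k + 1)).toLinearMap

theorem dual_cocontraction {k : ℕ} (φ : SSetCochain (TopCat.toSSet.obj X) R (k + 1)) :
    dual R X k (cocontraction R X k φ) = dual R X (k + 1) φ ∘ₗ contraction R X (k + 1) :=
  (dual R X k).apply_symm_apply _

/-- The dual of the homotopy identity for the contraction of chains, evaluated on chains with $k+2$
vertices. -/
theorem coboundary_cocontraction {N : ℕ}
    (hX : HasSphereHomology R (Set.univ : Set X) N) {k : ℕ} (hk : k + 2 < N)
    (φ : SSetCochain (TopCat.toSSet.obj X) R (k + 1)) :
    coboundary k (cocontraction R X k φ) + cocontraction R X (k + 1) (coboundary (k + 1) φ) = φ := by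
  apply (dual R X (k + 1)).injective
  rw [map_add, dual_coboundary, dual_cocontraction, dual_cocontraction, dual_coboundary]
  refine LinearMap.ext fun x => ?_
  simp only [LinearMap.add_apply, LinearMap.comp_apply]
  rw [bd_contraction_succ hX hk, map_sub]
  abel

/-- The chains are augmented but the cochains are not. The term through index 0 survives as a
constant, namely the value of the cochain on the chosen chain of augmentation one. -/
theorem exists_cocontraction_coboundary_zero {N : ℕ}
    (hX : HasSphereHomology R (Set.univ : Set X) N) (hN : 1 < N)
    (φ : SSetCochain (TopCat.toSSet.obj X) R 0) :
    ∃ c : R, cocontraction R X 0 (coboundary 0 φ) = φ - const c := by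
  have σ₀ : C(TopSimplex 0, X) := ⟨fun t => absurd t.2.2 (by simp), by
    rw [continuous_iff_continuousAt]
    exact fun t => absurd t.2.2 (by simp)⟩
  refine ⟨dual R X 0 φ (contraction R X 0 (Finsupp.single σ₀ 1)), ?_⟩
  apply (dual R X 0).injective
  rw [dual_cocontraction, dual_coboundary, map_sub]
  refine SingChain.hom_ext fun σ => ?_
  simp only [LinearMap.sub_apply, LinearMap.comp_apply]
  rw [bd_contraction_succ hX hN, map_sub, dual_single (const _), bd_single]
  simp [const, Subsingleton.elim _ σ₀]

end SSetCochain

end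

noncomputable section

/-! ### The square of the bar differential -/

namespace AugDGAlgebra

open scoped DirectSum TensorProduct

variable {R : Type u} [CommRing R] (A : AugDGAlgebra.{u, v} R)

theorem d_algebraMap (r : R) : A.d (algebraMap R A.carrier r) = 0 := by
  have h1 : A.d 1 = 0 := by
    have := A.leibniz (p := 0) (a := 1) 1 SetLike.GradedOne.one_mem
    simpa using this
  rw [Algebra.algebraMap_eq_smul_one, map_smul, h1, smul_zero]

/-- The projection to the augmentation ideal. -/
def toAugIdeal : A.carrier →ₗ[R] A.augIdeal :=
  (LinearMap.id - Algebra.linearMap R A.carrier ∘ₗ A.aug.toLinearMap).codRestrict A.augIdeal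
    fun a => by simp

theorem coe_toAugIdeal (a : A.carrier) :
    (A.toAugIdeal a : A.carrier) = a - algebraMap R A.carrier (A.aug a) := rfl

theorem toAugIdeal_coe (x : A.augIdeal) : A.toAugIdeal x = x := by
  have hx : A.aug x = 0 := x.2
  ext
  rw [coe_toAugIdeal, hx, map_zero, sub_zero]

theorem toAugIdeal_mem {p : ℕ} {a : A.carrier} (ha : a ∈ A.grading p) :
    (A.toAugIdeal a : A.carrier) ∈ A.grading p := by
  rw [coe_toAugIdeal]
  rcases eq_or_ne p 0 with rfl | hp
  · exact sub_mem ha (SetLike.algebraMap_mem_graded _ _)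
  · rwa [A.aug_of_mem ha hp, map_zero, sub_zero]

/-- The projection to the augmentation ideal preserves degrees, so the ideal is spanned by its
homogeneous elements and signs can be checked on these. -/
theorem augIdeal_hom_ext {M : Type*} [AddCommMonoid M] [Module R M] {f g : A.augIdeal →ₗ[R] M}
    (h : ∀ (p : ℕ) (x : A.augIdeal), (x : A.carrier) ∈ A.grading p → f x = g x) : f = g := by
  have h1 : f ∘ₗ A.toAugIdeal = g ∘ₗ A.toAugIdeal := by
    ext a
    induction a using DirectSum.Decomposition.inductionOn A.grading with
    | zero => simp
    | @homogeneous p a => exact h p _ (A.toAugIdeal_mem a.2)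
    | add a b ha hb => rw [map_add, map_add, ha, hb]
  ext x
  have := LinearMap.congr_fun h1 (x : A.carrier)
  simpa [toAugIdeal_coe] using this

theorem neg_smul_augIdeal (r : R) (x : A.augIdeal) : (-r) • x = -(r • x) :=
  Subtype.ext (neg_smul r (x : A.carrier))

theorem coe_dBar (x : A.augIdeal) : (A.dBar x : A.carrier) = A.d x := rfl

theorem dBar_dBar (x : A.augIdeal) : A.dBar (A.dBar x) = 0 := Subtype.ext (A.d_d x)

theorem dBar_mem {p : ℕ} {x : A.augIdeal} (hx : (x : A.carrier) ∈ A.grading p) :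
    (A.dBar x : A.carrier) ∈ A.grading (p + 1) := A.d_mem hx

theorem mulBar_mem {p q : ℕ} {x y : A.augIdeal} (hx : (x : A.carrier) ∈ A.grading p)
    (hy : (y : A.carrier) ∈ A.grading q) : (A.mulBar x y : A.carrier) ∈ A.grading (p + q) :=
  SetLike.GradedMul.mul_mem hx hy

theorem signBar_of_mem {p : ℕ} {x : A.augIdeal} (hx : (x : A.carrier) ∈ A.grading p) :
    A.signBar x = (-1 : R) ^ (p + 1) • x := Subtype.ext (A.degSign_of_mem hx)

theorem signBar_mem {p : ℕ} {x : A.augIdeal} (hx : (x : A.carrier) ∈ A.grading p) :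
    (A.signBar x : A.carrier) ∈ A.grading p := by
  rw [A.signBar_of_mem hx]
  exact Submodule.smul_mem _ _ hx

theorem neg_one_pow_mul_self (p : ℕ) : (-1 : R) ^ p * (-1 : R) ^ p = 1 := by
  rw [← mul_pow]; simp

theorem signBar_mul_signBar : A.signBar * A.signBar = 1 := by
  refine A.augIdeal_hom_ext fun p x hx => ?_
  rw [Module.End.mul_apply, A.signBar_of_mem hx, map_smul, A.signBar_of_mem hx, smul_smul,
    neg_one_pow_mul_self, one_smul]
  rfl

theorem signBar_signBar (x : A.augIdeal) : A.signBar (A.signBar x) = x :=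
  LinearMap.congr_fun A.signBar_mul_signBar x

theorem dBar_mul_signBar : A.dBar * A.signBar = -(A.signBar * A.dBar) := by
  refine A.augIdeal_hom_ext fun p x hx => ?_
  rw [Module.End.mul_apply, A.signBar_of_mem hx, map_smul, LinearMap.neg_apply,
    Module.End.mul_apply, A.signBar_of_mem (A.dBar_mem hx), pow_succ _ (p + 1), mul_neg, mul_one,
    neg_smul_augIdeal, neg_neg]

theorem dBar_signBar (x : A.augIdeal) : A.dBar (A.signBar x) = -A.signBar (A.dBar x) :=
  LinearMap.congr_fun A.dBar_mul_signBar x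

/-- The Leibniz rule for shifted degrees: the sign $(-1)^{p+1}$ of the first letter times the
Leibniz sign $(-1)^p$ is $-1$. -/
theorem dBar_mulBar_signBar (x y : A.augIdeal) : A.dBar (A.mulBar (A.signBar x) y) =
    A.mulBar (A.dBar (A.signBar x)) y - A.mulBar x (A.dBar y) := by
  refine LinearMap.congr_fun (f := A.dBar ∘ₗ A.mulBar.flip y ∘ₗ A.signBar)
    (g := A.mulBar.flip y ∘ₗ A.dBar ∘ₗ A.signBar - A.mulBar.flip (A.dBar y))
    (A.augIdeal_hom_ext fun p x hx => Subtype.ext ?_) x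
  simp only [LinearMap.comp_apply, LinearMap.sub_apply, LinearMap.flip_apply, A.signBar_of_mem hx,
    map_smul]
  change (-1 : R) ^ (p + 1) • A.d (x * y) = (-1 : R) ^ (p + 1) • (A.d x * y) - x * A.d y
  have e : ∀ a : A.carrier, (-1 : A.carrier) ^ p * a = (-1 : R) ^ p • a := fun a => by
    rw [Algebra.smul_def]; simp
  have h : (-1 : R) ^ (p + 1) * (-1) ^ p = -1 := by
    rw [pow_succ, mul_right_comm, neg_one_pow_mul_self, one_mul]
  rw [A.leibniz _ hx, e, smul_add, smul_smul, h, neg_one_smul, sub_eq_add_neg]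

/-- Multiplication has shifted degree one: $p+q-1=(p-1)+(q-1)+1$. This accounts for the single minus
sign. -/
theorem signBar_mulBar_signBar (x y : A.augIdeal) :
    A.signBar (A.mulBar (A.signBar x) y) = -A.mulBar x (A.signBar y) := by
  refine LinearMap.congr_fun (f := A.signBar ∘ₗ A.mulBar.flip y ∘ₗ A.signBar)
    (g := -A.mulBar.flip (A.signBar y)) (A.augIdeal_hom_ext fun p x hx => ?_) x
  refine LinearMap.congr_fun (f := A.signBar ∘ₗ A.mulBar (A.signBar x))
    (g := -(A.mulBar x ∘ₗ A.signBar)) (A.augIdeal_hom_ext fun q y hy => ?_) y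
  simp only [LinearMap.comp_apply, LinearMap.neg_apply, A.signBar_of_mem hx, A.signBar_of_mem hy,
    map_smul, LinearMap.smul_apply, A.signBar_of_mem (A.mulBar_mem hx hy), smul_smul,
    ← neg_smul_augIdeal]
  congr 1
  rw [pow_succ, pow_succ, pow_succ, pow_add]
  linear_combination (-1 : R) ^ q * neg_one_pow_mul_self (R := R) p

theorem mulBar_assoc (x y z : A.augIdeal) :
    A.mulBar (A.mulBar x y) z = A.mulBar x (A.mulBar y z) := Subtype.ext (mul_assoc _ _ _)

theorem bar_hom_ext {M : Type*} [AddCommMonoid M] [Module R M] {f g : A.Bar →ₗ[R] M}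
    (h : ∀ (k : ℕ) (v : Fin k → A.augIdeal), f (A.word v) = g (A.word v)) : f = g := by
  refine DirectSum.linearMap_ext R fun k => PiTensorProduct.ext (MultilinearMap.ext fun v => ?_)
  exact h k v

/-- Adding a first letter. -/
def consLetter (x : A.augIdeal) : A.Bar →ₗ[R] A.Bar :=
  DirectSum.toModule R ℕ A.Bar fun k =>
    DirectSum.lof R ℕ (fun k => ⨂[R]^k A.augIdeal) (k + 1) ∘ₗ
      PiTensorProduct.lift
        (MultilinearMap.curryLeft (M := fun _ : Fin (k + 1) => A.augIdeal)
          (PiTensorProduct.tprod R) x)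

/-- Multiplication of the first letter. -/
def mulLetter (a : A.augIdeal) : A.Bar →ₗ[R] A.Bar :=
  DirectSum.toModule R ℕ A.Bar fun k => match k with
    | 0 => 0
    | k + 1 => DirectSum.lof R ℕ (fun k => ⨂[R]^k A.augIdeal) (k + 1) ∘ₗ
        PiTensorProduct.map (Function.update 1 (0 : Fin (k + 1)) (A.mulBar a))

theorem consLetter_word (x : A.augIdeal) {k : ℕ} (v : Fin k → A.augIdeal) :
    A.consLetter x (A.word v) = A.word (Fin.cons x v : Fin (k + 1) → A.augIdeal) := by
  simp [consLetter, word]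

theorem mulLetter_word_zero (a : A.augIdeal) (v : Fin 0 → A.augIdeal) :
    A.mulLetter a (A.word v) = 0 := by
  simp [mulLetter, word]

theorem mulLetter_word_cons (a x : A.augIdeal) {k : ℕ} (v : Fin k → A.augIdeal) :
    A.mulLetter a (A.word (Fin.cons x v : Fin (k + 1) → A.augIdeal)) =
      A.word (Fin.cons (A.mulBar a x) v : Fin (k + 1) → A.augIdeal) := by
  simp only [mulLetter, word, DirectSum.toModule_lof, LinearMap.comp_apply,
    PiTensorProduct.map_tprod]
  congr 2
  funext j
  cases j using Fin.cases <;> simp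

theorem word_cons_sub (x y : A.augIdeal) {k : ℕ} (v : Fin k → A.augIdeal) :
    A.word (Fin.cons (x - y) v : Fin (k + 1) → A.augIdeal) =
      A.word (Fin.cons x v : Fin (k + 1) → A.augIdeal) -
        A.word (Fin.cons y v : Fin (k + 1) → A.augIdeal) := by
  rw [eq_sub_iff_add_eq]
  refine (map_add (DirectSum.lof R ℕ (fun k => ⨂[R]^k A.augIdeal) (k + 1)) _ _).symm.trans ?_
  rw [← MultilinearMap.cons_add, sub_add_cancel]
  rfl

theorem consLetter_sub (x y : A.augIdeal) :
    A.consLetter (x - y) = A.consLetter x - A.consLetter y :=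
  A.bar_hom_ext fun k v => by
    rw [LinearMap.sub_apply, consLetter_word, consLetter_word, consLetter_word, word_cons_sub]

theorem consLetter_neg (x : A.augIdeal) : A.consLetter (-x) = -A.consLetter x := by
  have h := A.consLetter_sub 0 x
  have h0 := A.consLetter_sub 0 0
  rw [sub_self, sub_self] at h0
  rwa [h0, zero_sub, zero_sub] at h

theorem mulLetter_consLetter (a x : A.augIdeal) (w : A.Bar) :
    A.mulLetter a (A.consLetter x w) = A.consLetter (A.mulBar a x) w :=
  LinearMap.congr_fun (f := A.mulLetter a ∘ₗ A.consLetter x) (A.bar_hom_ext fun k v => by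
    rw [LinearMap.comp_apply, consLetter_word, mulLetter_word_cons, consLetter_word]) w

theorem word_eq_consLetter {k : ℕ} (v : Fin (k + 1) → A.augIdeal) :
    A.word v = A.consLetter (v 0) (A.word (Fin.tail v)) := by
  rw [consLetter_word, Fin.cons_self_tail]

theorem mulLetter_mulLetter (a b : A.augIdeal) (w : A.Bar) :
    A.mulLetter a (A.mulLetter b w) = A.mulLetter (A.mulBar a b) w := by
  refine LinearMap.congr_fun (f := A.mulLetter a ∘ₗ A.mulLetter b) (A.bar_hom_ext fun k v => ?_) w
  rw [LinearMap.comp_apply]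
  cases k with
  | zero => rw [mulLetter_word_zero, mulLetter_word_zero, map_zero]
  | succ k =>
    rw [word_eq_consLetter, mulLetter_consLetter, mulLetter_consLetter, mulLetter_consLetter,
      mulBar_assoc]

theorem mulLetter_neg (a : A.augIdeal) : A.mulLetter (-a) = -A.mulLetter a := by
  refine A.bar_hom_ext fun k v => ?_
  rw [LinearMap.neg_apply]
  cases k with
  | zero => rw [mulLetter_word_zero, mulLetter_word_zero, neg_zero]
  | succ k =>
    rw [word_eq_consLetter, mulLetter_consLetter, mulLetter_consLetter, map_neg,
      LinearMap.neg_apply, consLetter_neg, LinearMap.neg_apply]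

theorem barD_word_zero (v : Fin 0 → A.augIdeal) : A.barD (A.word v) = 0 := by
  simp [barD, word]

/-- Only three things can happen at the first letter: it is differentiated, it is passed over with
its sign, or it is merged with the second letter. The recursion replaces double sums over positions
in the proof that the differential squares to zero. -/
theorem barD_word_cons (x : A.augIdeal) {k : ℕ} (v : Fin k → A.augIdeal) :
    A.barD (A.word (Fin.cons x v : Fin (k + 1) → A.augIdeal)) =
      A.word (Fin.cons (A.dBar x) v : Fin (k + 1) → A.augIdeal) +
        A.consLetter (A.signBar x) (A.barD (A.word v)) +
        A.mulLetter (A.signBar x) (A.word v) := by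
  have h1 : ∀ i : Fin k, A.word (fun j : Fin (k + 1) =>
      if j < i.succ then A.signBar ((Fin.cons x v : Fin (k + 1) → A.augIdeal) j)
      else if j = i.succ then A.dBar ((Fin.cons x v : Fin (k + 1) → A.augIdeal) j)
      else (Fin.cons x v : Fin (k + 1) → A.augIdeal) j) = A.consLetter (A.signBar x)
        (A.word fun j => if j < i then A.signBar (v j) else if j = i then A.dBar (v j) else v j) :=
    fun i => by
      rw [consLetter_word]
      congr 1
      funext j
      cases j using Fin.cases <;> simp
  have h0 : A.word (fun j : Fin (k + 1) =>
      if j < 0 then A.signBar ((Fin.cons x v : Fin (k + 1) → A.augIdeal) j)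
      else if j = 0 then A.dBar ((Fin.cons x v : Fin (k + 1) → A.augIdeal) j)
      else (Fin.cons x v : Fin (k + 1) → A.augIdeal) j) =
        A.word (Fin.cons (A.dBar x) v : Fin (k + 1) → A.augIdeal) := by
    congr 1
    funext j
    cases j using Fin.cases <;> simp
  rw [barD_word, Fin.sum_univ_succ, h0]
  simp only [h1]
  cases k with
  | zero =>
    rw [barD_word_zero, mulLetter_word_zero]
    simp
  | succ k =>
    have h2 : ∀ i : Fin k, A.word (A.mergeLetters i.succ (Fin.cons x v : Fin (k + 2) → A.augIdeal)) =
        A.consLetter (A.signBar x) (A.word (A.mergeLetters i v)) := fun i => by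
      rw [consLetter_word]
      congr 1
      funext j
      cases j using Fin.cases <;> simp [mergeLetters]
    have h3 : A.word (A.mergeLetters 0 (Fin.cons x v : Fin (k + 2) → A.augIdeal)) =
        A.mulLetter (A.signBar x) (A.word v) := by
      rw [← Fin.cons_self_tail v, mulLetter_word_cons]
      congr 1
      funext j
      cases j using Fin.cases <;> simp [mergeLetters, Fin.tail]
    rw [Fin.sum_univ_succ (f := fun i : Fin (k + 1) => A.word (A.mergeLetters i _)), h3, barD_word, map_add, map_sum, map_sum]
    simp only [h2]
    abel

theorem barD_consLetter (x : A.augIdeal) (w : A.Bar) : A.barD (A.consLetter x w) =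
    A.consLetter (A.dBar x) w + A.consLetter (A.signBar x) (A.barD w) +
      A.mulLetter (A.signBar x) w :=
  LinearMap.congr_fun (f := A.barD ∘ₗ A.consLetter x) (g := A.consLetter (A.dBar x) +
    A.consLetter (A.signBar x) ∘ₗ A.barD + A.mulLetter (A.signBar x)) (A.bar_hom_ext fun k v => by
      simp only [LinearMap.comp_apply, LinearMap.add_apply]
      rw [consLetter_word, barD_word_cons, consLetter_word]) w

theorem barD_mulLetter_signBar (x : A.augIdeal) (w : A.Bar) :
    A.barD (A.mulLetter (A.signBar x) w) =
      A.mulLetter (A.dBar (A.signBar x)) w - A.mulLetter x (A.barD w) := by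
  refine LinearMap.congr_fun (f := A.barD ∘ₗ A.mulLetter (A.signBar x))
    (g := A.mulLetter (A.dBar (A.signBar x)) - A.mulLetter x ∘ₗ A.barD)
    (A.bar_hom_ext fun k v => ?_) w
  simp only [LinearMap.comp_apply, LinearMap.sub_apply]
  cases k with
  | zero =>
    rw [mulLetter_word_zero, mulLetter_word_zero, barD_word_zero, map_zero, map_zero, sub_zero]
  | succ k =>
    rw [word_eq_consLetter, mulLetter_consLetter, barD_consLetter, barD_consLetter, map_add,
      map_add, mulLetter_consLetter, mulLetter_consLetter, mulLetter_consLetter,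
      mulLetter_mulLetter, dBar_mulBar_signBar, signBar_mulBar_signBar, consLetter_sub,
      consLetter_neg, mulLetter_neg]
    simp only [LinearMap.sub_apply, LinearMap.neg_apply]
    abel

/-- After splitting off the first letter, the terms cancel because $d^2=0$, $d$ anticommutes with
the sign operator, the sign operator is an involution, and the shorter word is covered by induction.
Merges with the first letter cancel by `barD_mulLetter_signBar`. -/
theorem barD_barD (w : A.Bar) : A.barD (A.barD w) = 0 := by
  refine LinearMap.congr_fun (f := A.barD ∘ₗ A.barD) (g := 0) (A.bar_hom_ext fun k v => ?_) w
  rw [LinearMap.comp_apply, LinearMap.zero_apply]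
  induction k with
  | zero => rw [barD_word_zero, map_zero]
  | succ k ih =>
    rw [word_eq_consLetter, barD_consLetter, map_add, map_add, barD_consLetter, barD_consLetter,
      barD_mulLetter_signBar, ih, dBar_dBar, signBar_signBar, dBar_signBar, consLetter_neg,
      mulLetter_neg, map_zero]
    have h0 : A.consLetter 0 = 0 := by
      have := A.consLetter_sub 0 0
      rwa [sub_self, sub_self] at this
    rw [h0]
    simp only [LinearMap.neg_apply, LinearMap.zero_apply]
    abel

end AugDGAlgebra

end

noncomputable section

/-! ### Contractions of tensor powers -/

open scoped DirectSum TensorProduct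

/-- A differential of degree one together with an operator of order two which anticommutes with
it, on a graded module. -/
structure SignedComplex (R : Type u) [CommRing R] (V : Type v) [AddCommGroup V] [Module R V] where
  grading : ℕ → Submodule R V
  hom_ext : ∀ f g : Module.End R V, (∀ p, ∀ x ∈ grading p, f x = g x) → f = g
  sign : Module.End R V
  sign_of_mem : ∀ {p : ℕ} {x : V}, x ∈ grading p → sign x = (-1 : R) ^ (p + 1) • x
  d : Module.End R V
  d_mul_d : d * d = 0
  d_mem : ∀ {p : ℕ} {x : V}, x ∈ grading p → d x ∈ grading (p + 1)

namespace SignedComplex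

variable {R : Type u} [CommRing R] {V : Type v} [AddCommGroup V] [Module R V]
  (A : SignedComplex R V)

theorem sign_mem {p : ℕ} {x : V} (hx : x ∈ A.grading p) : A.sign x ∈ A.grading p := by
  rw [A.sign_of_mem hx]
  exact Submodule.smul_mem _ _ hx

theorem sign_mul_sign : A.sign * A.sign = 1 := by
  refine A.hom_ext _ _ fun p x hx => ?_
  rw [Module.End.mul_apply, A.sign_of_mem hx, map_smul, A.sign_of_mem hx, smul_smul,
    ← mul_pow, neg_one_mul, neg_neg, one_pow, one_smul]
  rfl

theorem d_mul_sign : A.d * A.sign = -(A.sign * A.d) := by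
  refine A.hom_ext _ _ fun p x hx => ?_
  rw [Module.End.mul_apply, A.sign_of_mem hx, map_smul, LinearMap.neg_apply,
    Module.End.mul_apply, A.sign_of_mem (A.d_mem hx), pow_succ _ (p + 1), mul_neg, mul_one,
    neg_smul, neg_neg]

/-- A contraction in the degrees below `n`. -/
structure PartialContraction (n : ℕ) where
  h : Module.End R V
  of_mem_zero : ∀ x ∈ A.grading 0, h x = 0
  mem : ∀ (p : ℕ), ∀ x ∈ A.grading (p + 1), h x ∈ A.grading p
  homotopy : ∀ p < n, ∀ x ∈ A.grading p, A.d (h x) + h (A.d x) = x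

namespace PartialContraction

variable {A} {n : ℕ} (h : A.PartialContraction n)

/-- A map lowering the degree by one reverses the sign; in degree 0 it vanishes. -/
theorem mul_sign : h.h * A.sign = -(A.sign * h.h) := by
  refine A.hom_ext _ _ fun p x hx => ?_
  rw [LinearMap.neg_apply, Module.End.mul_apply, Module.End.mul_apply, A.sign_of_mem hx,
    map_smul]
  cases p with
  | zero => rw [h.of_mem_zero x hx, smul_zero, map_zero, neg_zero]
  | succ p =>
    rw [A.sign_of_mem (h.mem p x hx), pow_succ _ (p + 1), mul_neg, mul_one, neg_smul]

/-- The projection which is homotopic to the identity. -/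
def proj : Module.End R V := 1 - (A.d * h.h + h.h * A.d)

theorem proj_apply (x : V) : h.proj x = x - (A.d (h.h x) + h.h (A.d x)) := rfl

theorem proj_of_lt {p : ℕ} (hp : p < n) {x : V} (hx : x ∈ A.grading p) : h.proj x = 0 := by
  rw [proj_apply, h.homotopy p hp x hx, sub_self]

theorem proj_mem {p : ℕ} {x : V} (hx : x ∈ A.grading p) : h.proj x ∈ A.grading p := by
  rw [proj_apply]
  refine sub_mem hx (add_mem ?_ (h.mem p _ (A.d_mem hx)))
  cases p with
  | zero => rw [h.of_mem_zero x hx, map_zero]; exact zero_mem _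
  | succ p => exact A.d_mem (h.mem p x hx)

theorem commute_d_proj : Commute A.d h.proj := by
  have hd := A.d_mul_d
  change A.d * (1 - _) = (1 - _) * A.d
  rw [mul_sub, sub_mul, mul_add, add_mul, ← mul_assoc, hd, mul_assoc h.h, hd, mul_assoc]
  simp

theorem commute_sign_proj : Commute A.sign h.proj := by
  have hd : A.sign * A.d = -(A.d * A.sign) := by rw [d_mul_sign, neg_neg]
  have hh : A.sign * h.h = -(h.h * A.sign) := by rw [h.mul_sign, neg_neg]
  have h1 : A.sign * (A.d * h.h) = A.d * h.h * A.sign := by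
    rw [← mul_assoc, hd, neg_mul, mul_assoc, hh, mul_neg, neg_neg, mul_assoc]
  have h2 : A.sign * (h.h * A.d) = h.h * A.d * A.sign := by
    rw [← mul_assoc, hh, neg_mul, mul_assoc, hd, mul_neg, neg_neg, mul_assoc]
  change A.sign * (1 - _) = (1 - _) * A.sign
  rw [mul_sub, sub_mul, mul_add, add_mul, h1, h2, mul_one, one_mul]

end PartialContraction

/-! ### Operators on single letters of tensor powers -/

/-- The operator `f` on the letter `i`, with the signs on the letters before it. -/
def signedAt {k : ℕ} (i : Fin k) (f : Module.End R V) (j : Fin k) :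
    Module.End R V :=
  if j < i then A.sign else if j = i then f else LinearMap.id

theorem map_neg_update {k : ℕ} (C : Fin k → Module.End R V) (i : Fin k)
    (u : Module.End R V) :
    PiTensorProduct.map (Function.update C i (-u)) =
      -PiTensorProduct.map (Function.update C i u) := by
  refine eq_neg_of_add_eq_zero_left ?_
  rw [← PiTensorProduct.map_update_add, neg_add_cancel]
  exact (PiTensorProduct.mapMultilinear R (fun _ => V) fun _ => V).map_update_zero
    C i

/-- In the two orders the operators differ only at letter `i`, where `f` meets the sign that belongs
to the operator at `j`. Anticommutation of `f` with the sign is all that is needed. -/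
theorem map_signedAt_anticomm_of_lt {k : ℕ} {i j : Fin k} (hij : i < j)
    {f g : Module.End R V} (hf : f * A.sign = -(A.sign * f)) :
    PiTensorProduct.map (A.signedAt i f) * PiTensorProduct.map (A.signedAt j g) =
      -(PiTensorProduct.map (A.signedAt j g) * PiTensorProduct.map (A.signedAt i f)) := by
  rw [← PiTensorProduct.map_mul, ← PiTensorProduct.map_mul]
  set C := fun l => A.signedAt j g l * A.signedAt i f l
  have h1 : C = Function.update C i (A.sign * f) := by
    rw [eq_comm, Function.update_eq_self_iff]
    simp [C, signedAt, hij]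
  have h2 : (fun l => A.signedAt i f l * A.signedAt j g l) =
      Function.update C i (-(A.sign * f)) := by
    funext l
    rcases lt_trichotomy l i with hl | rfl | hl
    · simp [C, signedAt, hl, hl.trans hij, hl.ne]
    · simp [signedAt, hij, hf]
    · rw [Function.update_of_ne hl.ne']
      simp only [C, signedAt, hl.not_gt, hl.ne', if_false]
      rfl
  rw [h2, map_neg_update, ← h1]

theorem map_signedAt_anticomm {k : ℕ} {i j : Fin k} (hij : i ≠ j)
    {f g : Module.End R V} (hf : f * A.sign = -(A.sign * f))
    (hg : g * A.sign = -(A.sign * g)) :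
    PiTensorProduct.map (A.signedAt i f) * PiTensorProduct.map (A.signedAt j g) +
      PiTensorProduct.map (A.signedAt j g) * PiTensorProduct.map (A.signedAt i f) = 0 := by
  rcases hij.lt_or_gt with h | h
  · rw [A.map_signedAt_anticomm_of_lt h hf, neg_add_cancel]
  · rw [A.map_signedAt_anticomm_of_lt h hg, add_neg_cancel]

/-- The differential of the tensor powers. -/
def tensorD (k : ℕ) : Module.End R (⨂[R]^k V) := ∑ i, PiTensorProduct.map (A.signedAt i A.d)

theorem map_signedAt_mul_self {k : ℕ} (i : Fin k) (f g : Module.End R V) :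
    PiTensorProduct.map (A.signedAt i f) * PiTensorProduct.map (A.signedAt i g) =
      PiTensorProduct.map (Function.update (1 : Fin k → Module.End R V) i (f * g)) := by
  rw [← PiTensorProduct.map_mul]
  congr 1
  funext l
  rcases lt_trichotomy l i with hl | rfl | hl
  · simp [signedAt, hl, hl.ne, sign_mul_sign]
  · simp [signedAt]
  · simp only [signedAt, hl.not_gt, hl.ne', if_false, Function.update_of_ne hl.ne']
    rfl

namespace PartialContraction

variable {A} {n : ℕ} (h : A.PartialContraction n)

/-- The cross terms cancel by anticommutation and the signs before letter `i` square to one. What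
remains is $dh+hd$ on that letter, which is the identity minus the projection. -/
theorem tensorD_homotopy {k : ℕ} (i : Fin k) :
    A.tensorD k * PiTensorProduct.map (A.signedAt i h.h) +
      PiTensorProduct.map (A.signedAt i h.h) * A.tensorD k =
    1 - PiTensorProduct.map (Function.update (1 : Fin k → Module.End R V) i h.proj) := by
  rw [tensorD, Finset.sum_mul, Finset.mul_sum, ← Finset.sum_add_distrib,
    Finset.sum_eq_single i (fun j _ hj =>
      A.map_signedAt_anticomm hj A.d_mul_sign h.mul_sign) (by simp),
    map_signedAt_mul_self, map_signedAt_mul_self, ← PiTensorProduct.map_update_add,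
    eq_sub_iff_add_eq, ← PiTensorProduct.map_update_add, proj, add_sub_cancel]
  have : Function.update (1 : Fin k → Module.End R V) i 1 = 1 :=
    Function.update_eq_self i 1
  rw [this]
  exact PiTensorProduct.map_one

/-- The projection on the letters in `S`. -/
def projAt {k : ℕ} (S : Finset (Fin k)) (j : Fin k) : Module.End R V :=
  if j ∈ S then h.proj else 1

theorem commute_tensorD_projAt {k : ℕ} (S : Finset (Fin k)) :
    Commute (A.tensorD k) (PiTensorProduct.map (h.projAt S)) := by
  rw [tensorD]
  refine Commute.sum_left _ _ _ fun i _ => ?_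
  rw [Commute, SemiconjBy, ← PiTensorProduct.map_mul, ← PiTensorProduct.map_mul]
  congr 1
  funext l
  have : Commute (A.signedAt i A.d l) (h.projAt S l) := by
    unfold signedAt projAt
    split_ifs
    exacts [h.commute_sign_proj, Commute.one_right _, h.commute_d_proj, Commute.one_right _,
      Commute.one_left _, Commute.one_right _]
  exact this

theorem projAt_insert {k : ℕ} {S : Finset (Fin k)} {i : Fin k} (hi : i ∉ S) :
    PiTensorProduct.map (h.projAt (insert i S)) =
      PiTensorProduct.map (Function.update (1 : Fin k → Module.End R V) i h.proj) *
        PiTensorProduct.map (h.projAt S) := by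
  rw [← PiTensorProduct.map_mul]
  congr 1
  funext l
  rcases eq_or_ne l i with rfl | hl
  · simp [projAt, hi]
  · simp [projAt, hl]

end PartialContraction

/-- The elements of total degree `m` in weight `k`. -/
def tensorGrading (k : ℕ) (m : ℤ) : Submodule R (⨂[R]^k V) :=
  Submodule.span R {t | ∃ (p : Fin k → ℕ) (x : Fin k → V),
    (∀ i, x i ∈ A.grading (p i)) ∧ ∑ i, ((p i : ℤ) - 1) = m ∧
      t = PiTensorProduct.tprod R x}

theorem map_mem_of_mem_tensorGrading {M : Type*} [AddCommGroup M] [Module R M] {k : ℕ} {m : ℤ}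
    {f : (⨂[R]^k V) →ₗ[R] M} {N : Submodule R M}
    (hf : ∀ (p : Fin k → ℕ) (x : Fin k → V),
      (∀ i, x i ∈ A.grading (p i)) → ∑ i, ((p i : ℤ) - 1) = m →
        f (PiTensorProduct.tprod R x) ∈ N)
    {t : ⨂[R]^k V} (ht : t ∈ A.tensorGrading k m) : f t ∈ N := by
  refine Submodule.span_le (p := N.comap f).2 ?_ ht
  rintro _ ⟨p, x, hx, hm, rfl⟩
  exact hf p x hx hm

/-- `e` records the degree shift of each factor. The alternative of vanishing is needed for the
contraction in degree 0, where there is no degree to land in. -/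
theorem map_mem_tensorGrading {k : ℕ} {f : Fin k → Module.End R V} (e : Fin k → ℤ)
    (hf : ∀ (j : Fin k) (p : ℕ) (x : V), x ∈ A.grading p →
      f j x = 0 ∨ ∃ q : ℕ, f j x ∈ A.grading q ∧ (q : ℤ) = p + e j)
    {m : ℤ} {t : ⨂[R]^k V} (ht : t ∈ A.tensorGrading k m) :
    PiTensorProduct.map f t ∈ A.tensorGrading k (m + ∑ j, e j) := by
  refine A.map_mem_of_mem_tensorGrading (fun p x hx hm => ?_) ht
  rw [PiTensorProduct.map_tprod]
  by_cases h0 : ∃ j, f j (x j) = 0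
  · obtain ⟨j, hj⟩ := h0
    rw [MultilinearMap.map_coord_zero _ j hj]
    exact zero_mem _
  · push Not at h0
    choose q hq hqe using fun j => (hf j (p j) (x j) (hx j)).resolve_left (h0 j)
    refine Submodule.subset_span ⟨q, _, hq, ?_, rfl⟩
    rw [← hm, ← Finset.sum_add_distrib]
    exact Finset.sum_congr rfl fun j _ => by rw [hqe]; ring

theorem map_signedAt_mem {k : ℕ} (i : Fin k) {f : Module.End R V} {e : ℤ}
    (hf : ∀ (p : ℕ) (x : V), x ∈ A.grading p →
      f x = 0 ∨ ∃ q : ℕ, f x ∈ A.grading q ∧ (q : ℤ) = p + e)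
    {m : ℤ} {t : ⨂[R]^k V} (ht : t ∈ A.tensorGrading k m) :
    PiTensorProduct.map (A.signedAt i f) t ∈ A.tensorGrading k (m + e) := by
  have := A.map_mem_tensorGrading (f := A.signedAt i f) (fun j => if j = i then e else 0)
    (fun j p x hx => ?_) ht
  · simpa using this
  · unfold signedAt
    rcases lt_trichotomy j i with hj | rfl | hj
    · simp only [if_pos hj, if_neg hj.ne]
      exact Or.inr ⟨p, A.sign_mem hx, by simp⟩
    · simpa using hf p x hx
    · simp only [if_neg hj.not_gt, if_neg hj.ne']
      exact Or.inr ⟨p, hx, by simp⟩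

theorem tensorD_mem {k : ℕ} {m : ℤ} {t : ⨂[R]^k V} (ht : t ∈ A.tensorGrading k m) :
    A.tensorD k t ∈ A.tensorGrading k (m + 1) := by
  rw [tensorD, LinearMap.sum_apply]
  exact Submodule.sum_mem _ fun i _ => A.map_signedAt_mem i
    (fun p x hx => Or.inr ⟨p + 1, A.d_mem hx, by simp⟩) ht

namespace PartialContraction

variable {A} {n : ℕ} (h : A.PartialContraction n)

theorem map_signedAt_mem {k : ℕ} (i : Fin k) {m : ℤ} {t : ⨂[R]^k V}
    (ht : t ∈ A.tensorGrading k m) :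
    PiTensorProduct.map (A.signedAt i h.h) t ∈ A.tensorGrading k (m - 1) := by
  refine A.map_signedAt_mem i (fun p x hx => ?_) ht
  cases p with
  | zero => exact Or.inl (h.of_mem_zero x hx)
  | succ p => exact Or.inr ⟨p, h.mem p x hx, by push_cast; ring⟩

theorem map_projAt_mem {k : ℕ} (S : Finset (Fin k)) {m : ℤ} {t : ⨂[R]^k V}
    (ht : t ∈ A.tensorGrading k m) : PiTensorProduct.map (h.projAt S) t ∈ A.tensorGrading k m := by
  have := A.map_mem_tensorGrading (f := h.projAt S) (fun _ => 0) (fun j p x hx =>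
    Or.inr ⟨p, ?_, by simp⟩) ht
  · simpa using this
  · unfold projAt
    split_ifs
    exacts [h.proj_mem hx, hx]

/-- Letters are projected one at a time. The partly projected cocycle is still a cocycle, so the
homotopy at the next letter supplies the next correction. -/
theorem exists_tensorD_eq_sub {k : ℕ} {m : ℤ} {t : ⨂[R]^k V}
    (ht : t ∈ A.tensorGrading k m) (hd : A.tensorD k t = 0) (S : Finset (Fin k)) :
    ∃ y ∈ A.tensorGrading k (m - 1), A.tensorD k y = t - PiTensorProduct.map (h.projAt S) t := by
  induction S using Finset.induction_on with
  | empty =>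
    refine ⟨0, zero_mem _, ?_⟩
    have : PiTensorProduct.map (h.projAt (∅ : Finset (Fin k))) = 1 := by
      rw [← PiTensorProduct.map_one]
      congr 1
    rw [this, map_zero, Module.End.one_apply, sub_self]
  | insert i S hi ih =>
    obtain ⟨y, hy, hyt⟩ := ih
    set u := PiTensorProduct.map (h.projAt S) t with hu
    have hdu : A.tensorD k u = 0 := by
      have := LinearMap.congr_fun (h.commute_tensorD_projAt S).eq t
      rw [Module.End.mul_apply, Module.End.mul_apply, hd, map_zero] at this
      exact this
    have hH := LinearMap.congr_fun (h.tensorD_homotopy i) u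
    rw [LinearMap.add_apply, Module.End.mul_apply, Module.End.mul_apply, hdu, map_zero, add_zero,
      LinearMap.sub_apply, Module.End.one_apply] at hH
    refine ⟨y + PiTensorProduct.map (A.signedAt i h.h) u,
      add_mem hy (h.map_signedAt_mem i (h.map_projAt_mem S ht)), ?_⟩
    rw [map_add, hyt, hH, h.projAt_insert hi, Module.End.mul_apply, ← hu, sub_add_sub_cancel]

/-- If all letters had degree at least $n$, the total degree would be at least $k(n-1)$. So some
letter has degree below $n$, and the projection kills it. -/
theorem map_projAt_univ_eq_zero {k : ℕ} {m : ℤ} (hm : m < k * ((n : ℤ) - 1))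
    {t : ⨂[R]^k V} (ht : t ∈ A.tensorGrading k m) :
    PiTensorProduct.map (h.projAt Finset.univ) t = 0 := by
  refine (Submodule.mem_bot R).1 (A.map_mem_of_mem_tensorGrading (fun p x hx hp => ?_) ht)
  obtain ⟨j, hj⟩ : ∃ j, p j < n := by
    by_contra! hc
    have : ∑ j : Fin k, ((n : ℤ) - 1) ≤ ∑ j, ((p j : ℤ) - 1) :=
      Finset.sum_le_sum fun j _ => by have := hc j; omega
    simp only [Finset.sum_const, Finset.card_univ, Fintype.card_fin, nsmul_eq_mul] at this
    omega
  rw [Submodule.mem_bot, PiTensorProduct.map_tprod]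
  refine MultilinearMap.map_coord_zero _ j ?_
  simp only [projAt, Finset.mem_univ, if_true]
  exact h.proj_of_lt hj (hx j)

/-- The tensor powers of the augmentation ideal are exact in low degrees. -/
theorem exists_tensorD_eq (H : A.PartialContraction n) {k : ℕ} {m : ℤ}
    (hm : m < k * ((n : ℤ) - 1)) {t : ⨂[R]^k V}
    (ht : t ∈ A.tensorGrading k m) (hd : A.tensorD k t = 0) :
    ∃ y ∈ A.tensorGrading k (m - 1), A.tensorD k y = t := by
  obtain ⟨y, hy, h'⟩ := H.exists_tensorD_eq_sub ht hd Finset.univ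
  exact ⟨y, hy, by rw [h', H.map_projAt_univ_eq_zero hm ht, sub_zero]⟩

end PartialContraction

end SignedComplex

end

noncomputable section

/-! ### The cohomology of the bar construction in low degrees -/

namespace AugDGAlgebra

open scoped DirectSum TensorProduct

variable {R : Type u} [CommRing R] (A : AugDGAlgebra.{u, v} R)

/-- The augmentation ideal with its differential. -/
def signedComplex : SignedComplex R A.augIdeal where
  grading p := (A.grading p).comap A.augIdeal.subtype
  hom_ext _ _ h := A.augIdeal_hom_ext h
  sign := A.signBar
  sign_of_mem hx := A.signBar_of_mem hx
  d := A.dBar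
  d_mul_d := LinearMap.ext A.dBar_dBar
  d_mem hx := A.dBar_mem hx

/-- The elements of total degree `m` in weight `k`. -/
abbrev tensorGrading (k : ℕ) (m : ℤ) : Submodule R (⨂[R]^k A.augIdeal) :=
  A.signedComplex.tensorGrading k m

theorem barD₁_eq (k : ℕ) : A.barD₁ k = A.signedComplex.tensorD k := rfl

theorem barD₁_mem {k : ℕ} {m : ℤ} {t : ⨂[R]^k A.augIdeal} (ht : t ∈ A.tensorGrading k m) :
    A.barD₁ k t ∈ A.tensorGrading k (m + 1) :=
  A.signedComplex.tensorD_mem ht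

theorem barD₂_mem {k : ℕ} {m : ℤ} {t : ⨂[R]^(k + 1) A.augIdeal}
    (ht : t ∈ A.tensorGrading (k + 1) m) : A.barD₂ k t ∈ A.tensorGrading k (m + 1) := by
  rw [barD₂, LinearMap.sum_apply]
  refine Submodule.sum_mem _ fun i _ => ?_
  refine Submodule.span_le
    (p := (A.tensorGrading k (m + 1)).comap (PiTensorProduct.lift (A.barMerge i))).2 ?_ ht
  rintro _ ⟨p, x, hx, hm, rfl⟩
  rw [SetLike.mem_coe, Submodule.mem_comap, PiTensorProduct.lift.tprod]
  -- Merging adds the degrees of two neighbours, so their sum is assigned to position `i`. One fewer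
  -- letter means one fewer $-1$, which raises the shifted degree by one.
  refine Submodule.subset_span ⟨fun j => p (i.castSucc.succAbove j) +
    if j = i then p i.castSucc else 0, _, fun j => ?_, ?_, rfl⟩
  · unfold mergeLetters
    beta_reduce
    rcases lt_trichotomy j i with hj | rfl | hj
    · rw [if_pos hj, if_neg hj.ne, Fin.succAbove_of_castSucc_lt _ _ (by simpa using hj), add_zero]
      exact A.signBar_mem (hx _)
    · rw [if_neg (lt_irrefl _), if_pos rfl, if_pos rfl, Fin.succAbove_castSucc_self, add_comm]
      exact A.mulBar_mem (A.signBar_mem (hx _)) (hx _)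
    · rw [if_neg hj.not_gt, if_neg hj.ne', if_neg hj.ne',
        Fin.succAbove_of_le_castSucc _ _ (by simpa using hj.le), add_zero]
      exact hx _
  · rw [Fin.sum_univ_succAbove _ i.castSucc] at hm
    push_cast
    simp only [add_sub_right_comm, Finset.sum_add_distrib, 
      Finset.sum_ite_eq', Finset.mem_univ, if_true]
    rw [← hm]
    ring

/-- The elements of weight `k`, inside the bar construction. -/
abbrev ofWeight (k : ℕ) : (⨂[R]^k A.augIdeal) →ₗ[R] A.Bar :=
  DirectSum.lof R ℕ (fun k => ⨂[R]^k A.augIdeal) k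

/-- The component of weight `k`. -/
abbrev weight (k : ℕ) : A.Bar →ₗ[R] (⨂[R]^k A.augIdeal) :=
  DirectSum.component R ℕ (fun k => ⨂[R]^k A.augIdeal) k

theorem weight_ofWeight_self (k : ℕ) (t : ⨂[R]^k A.augIdeal) : A.weight k (A.ofWeight k t) = t :=
  DirectSum.component.lof_self (M := fun k => ⨂[R]^k A.augIdeal) R k t

theorem weight_ofWeight_of_ne {k l : ℕ} (h : l ≠ k) (t : ⨂[R]^l A.augIdeal) :
    A.weight k (A.ofWeight l t) = 0 := by
  rw [weight, ofWeight, DirectSum.component.of, dif_neg h]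

theorem barD_ofWeight_zero (t : ⨂[R]^0 A.augIdeal) : A.barD (A.ofWeight 0 t) = 0 := by
  simp [barD, ofWeight]

theorem barD_ofWeight_succ {k : ℕ} (t : ⨂[R]^(k + 1) A.augIdeal) :
    A.barD (A.ofWeight (k + 1) t) =
      A.ofWeight (k + 1) (A.barD₁ (k + 1) t) + A.ofWeight k (A.barD₂ k t) := by
  simp [barD, ofWeight]

theorem barD₁_zero : A.barD₁ 0 = 0 := by
  rw [barD₁]
  exact Finset.sum_empty

/-- Weight $k$ of the differential sees only weights $k$ and $k+1$. In the top weight of an element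
only the internal differential acts. -/
theorem weight_barD (k : ℕ) (w : A.Bar) :
    A.weight k (A.barD w) = A.barD₁ k (A.weight k w) + A.barD₂ k (A.weight (k + 1) w) := by
  refine LinearMap.congr_fun (f := A.weight k ∘ₗ A.barD) (g := A.barD₁ k ∘ₗ A.weight k +
    A.barD₂ k ∘ₗ A.weight (k + 1)) (DirectSum.linearMap_ext R fun j => LinearMap.ext fun t => ?_) w
  simp only [LinearMap.comp_apply, LinearMap.add_apply]
  change A.weight k (A.barD (A.ofWeight j t)) = A.barD₁ k (A.weight k (A.ofWeight j t)) +
    A.barD₂ k (A.weight (k + 1) (A.ofWeight j t))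
  cases j with
  | zero =>
    rw [barD_ofWeight_zero, map_zero, A.weight_ofWeight_of_ne (Nat.succ_ne_zero k).symm, map_zero,
      add_zero]
    cases k with
    | zero => rw [barD₁_zero, LinearMap.zero_apply]
    | succ k => rw [A.weight_ofWeight_of_ne (Nat.succ_ne_zero k).symm, map_zero]
  | succ j =>
    rw [barD_ofWeight_succ, map_add]
    rcases eq_or_ne k j with rfl | h1
    · rw [A.weight_ofWeight_of_ne (Nat.succ_ne_self k), A.weight_ofWeight_of_ne
        (Nat.succ_ne_self k), weight_ofWeight_self, weight_ofWeight_self, map_zero]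
    · rw [A.weight_ofWeight_of_ne h1.symm, A.weight_ofWeight_of_ne (k := k + 1) (l := j + 1)
        (fun h => h1 (by omega)), map_zero, add_zero, add_zero]
      rcases eq_or_ne k (j + 1) with rfl | h2
      · rw [weight_ofWeight_self, weight_ofWeight_self]
      · rw [A.weight_ofWeight_of_ne h2.symm, A.weight_ofWeight_of_ne h2.symm, map_zero]

theorem ofWeight_mem_barGrading {k : ℕ} {m : ℤ} {t : ⨂[R]^k A.augIdeal}
    (ht : t ∈ A.tensorGrading k m) : A.ofWeight k t ∈ A.barGrading m := by
  refine Submodule.span_le (p := (A.barGrading m).comap (A.ofWeight k)).2 ?_ ht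
  rintro _ ⟨p, x, hx, hm, rfl⟩
  exact Submodule.subset_span ⟨k, p, x, hx, hm, rfl⟩

theorem weight_mem_tensorGrading (k : ℕ) {m : ℤ} {w : A.Bar} (hw : w ∈ A.barGrading m) :
    A.weight k w ∈ A.tensorGrading k m := by
  refine Submodule.span_le (p := (A.tensorGrading k m).comap (A.weight k)).2 ?_ hw
  rintro _ ⟨l, p, x, hx, hm, rfl⟩
  change A.weight k (A.ofWeight l _) ∈ A.tensorGrading k m
  rcases eq_or_ne l k with rfl | h
  · rw [weight_ofWeight_self]
    exact Submodule.subset_span ⟨p, x, hx, hm, rfl⟩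
  · rw [A.weight_ofWeight_of_ne h]
    exact zero_mem _

theorem barD_ofWeight_mem {k : ℕ} {m : ℤ} {t : ⨂[R]^k A.augIdeal}
    (ht : t ∈ A.tensorGrading k m) : A.barD (A.ofWeight k t) ∈ A.barGrading (m + 1) := by
  cases k with
  | zero => rw [barD_ofWeight_zero]; exact zero_mem _
  | succ k =>
    rw [barD_ofWeight_succ]
    exact add_mem (A.ofWeight_mem_barGrading (A.barD₁_mem ht))
      (A.ofWeight_mem_barGrading (A.barD₂_mem ht))

theorem exists_weight_bound (w : A.Bar) : ∃ K, ∀ k, K < k → A.weight k w = 0 := by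
  induction w using DirectSum.induction_on with
  | zero => exact ⟨0, fun k _ => map_zero _⟩
  | of j t => exact ⟨j, fun k hk => A.weight_ofWeight_of_ne hk.ne t⟩
  | add v w hv hw =>
    obtain ⟨K, hK⟩ := hv
    obtain ⟨L, hL⟩ := hw
    refine ⟨max K L, fun k hk => ?_⟩
    rw [map_add, hK k (lt_of_le_of_lt (le_max_left _ _) hk),
      hL k (lt_of_le_of_lt (le_max_right _ _) hk), add_zero]

/-- In low degrees, an element of the bar construction whose differential has weight at most one is
homologous to an element of weight at most one. -/
theorem exists_sub_barD_weight_le_one {n : ℕ} (hn : 2 ≤ n)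
    (h : A.signedComplex.PartialContraction n) {m : ℤ} (hm : m ≤ (n : ℤ) - 1) {w : A.Bar}
    (hw : w ∈ A.barGrading m) (hd : ∀ k, 1 < k → A.weight k (A.barD w) = 0) :
    ∃ v ∈ A.barGrading (m - 1), ∀ k, 1 < k → A.weight k (w - A.barD v) = 0 := by
  obtain ⟨K, hK⟩ := A.exists_weight_bound w
  induction K generalizing w with
  | zero => exact ⟨0, zero_mem _, fun k hk => by rw [map_zero, sub_zero]; exact hK k (by omega)⟩
  | succ K ih =>
    rcases Nat.eq_zero_or_pos K with rfl | hpos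
    · exact ⟨0, zero_mem _, fun k hk => by rw [map_zero, sub_zero]; exact hK k (by omega)⟩
    -- The top component has weight $K+1\ge 2$ and degree $m\le n-1<(K+1)(n-1)$, so it is exact for
    -- the internal differential once it is closed.
    obtain ⟨y, hy, hyw⟩ := h.exists_tensorD_eq (k := K + 1) (m := m) (t := A.weight (K + 1) w)
      (by
        push_cast
        have h1 : (1 : ℤ) ≤ K := by omega
        nlinarith)
      (A.weight_mem_tensorGrading _ hw) (by
        have := hd (K + 1) (by omega)
        rwa [weight_barD, hK (K + 1 + 1) (by omega), map_zero, add_zero] at this)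
    rw [← barD₁_eq] at hyw
    -- The coboundary removes weight $K+1$ and otherwise alters only weight $K$, so the weight bound
    -- drops by one.
    obtain ⟨v, hv, hvw⟩ := ih (w := w - A.barD (A.ofWeight (K + 1) y))
      (sub_mem hw (by simpa using A.barD_ofWeight_mem hy))
      (fun k hk => by rw [map_sub, barD_barD, sub_zero, hd k hk])
      (fun k hk => by
        rw [map_sub, weight_barD]
        rcases eq_or_ne k (K + 1) with rfl | hk'
        · rw [weight_ofWeight_self, hyw, A.weight_ofWeight_of_ne (Nat.succ_ne_self _).symm,
            map_zero, add_zero, sub_self]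
        · rw [A.weight_ofWeight_of_ne hk'.symm, A.weight_ofWeight_of_ne (by omega),
            hK k (by omega), map_zero, map_zero, add_zero, sub_zero])
    refine ⟨A.ofWeight (K + 1) y + v, add_mem (A.ofWeight_mem_barGrading hy) hv, fun k hk => ?_⟩
    rw [map_add, ← sub_sub]
    exact hvw k hk

theorem tensorGrading_zero {m : ℤ} (hm : m ≠ 0) {t : ⨂[R]^0 A.augIdeal}
    (ht : t ∈ A.tensorGrading 0 m) : t = 0 := by
  refine (Submodule.mem_bot R).1 (Submodule.span_le (p := ⊥).2 ?_ ht)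
  rintro _ ⟨p, x, hx, hp, rfl⟩
  exact absurd hp.symm (by simpa using hm)

theorem exists_eq_tprod_of_mem {n : ℕ} {t : ⨂[R]^1 A.augIdeal}
    (ht : t ∈ A.tensorGrading 1 ((n : ℤ) - 1)) :
    ∃ a : A.augIdeal, (a : A.carrier) ∈ A.grading n ∧
      t = PiTensorProduct.tprod R fun _ : Fin 1 => a := by
  refine ⟨PiTensorProduct.subsingletonEquiv (0 : Fin 1) t, ?_, ?_⟩
  · refine Submodule.span_le (p := (A.signedComplex.grading n).comap
      (PiTensorProduct.subsingletonEquiv (s := fun _ : Fin 1 => A.augIdeal) (R := R)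
        (0 : Fin 1)).toLinearMap).2 ?_ ht
    rintro _ ⟨p, x, hx, hp, rfl⟩
    have hp' : p 0 = n := by simpa using hp
    rw [SetLike.mem_coe, Submodule.mem_comap, LinearEquiv.coe_coe,
      PiTensorProduct.subsingletonEquiv_apply_tprod, ← hp']
    exact hx 0
  · rw [← PiTensorProduct.subsingletonEquiv_symm_apply', LinearEquiv.symm_apply_apply]

end AugDGAlgebra

end

noncomputable section

/-! ### The classes of weight one -/

namespace AugDGAlgebra

open scoped DirectSum TensorProduct

variable {R : Type u} [CommRing R] (A : AugDGAlgebra.{u, v} R)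

/-- The word of weight one with a given letter. -/
def singleton : A.augIdeal →ₗ[R] A.Bar :=
  A.ofWeight 1 ∘ₗ
    (PiTensorProduct.subsingletonEquiv (s := fun _ : Fin 1 => A.augIdeal) (R := R)
      (0 : Fin 1)).symm.toLinearMap

theorem singleton_apply (x : A.augIdeal) :
    A.singleton x = A.ofWeight 1 (PiTensorProduct.tprod R fun _ : Fin 1 => x) := by
  rw [singleton, LinearMap.comp_apply, LinearEquiv.coe_coe,
    PiTensorProduct.subsingletonEquiv_symm_apply']

theorem singleton_eq_word (x : A.augIdeal) : A.singleton x = A.word fun _ : Fin 1 => x :=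
  A.singleton_apply x

theorem singleton_injective : Function.Injective A.singleton := by
  refine Function.Injective.comp (g := A.ofWeight 1) ?_ (LinearEquiv.injective _)
  exact DirectSum.of_injective 1

theorem barD_singleton (x : A.augIdeal) : A.barD (A.singleton x) = A.singleton (A.dBar x) := by
  rw [singleton_eq_word, singleton_eq_word, barD_word, Fin.sum_univ_one, Finset.univ_eq_empty,
    Finset.sum_empty, add_zero]
  congr 1
  funext j
  rw [if_neg (by omega), if_pos (by omega)]

theorem singleton_mem {n : ℕ} {x : A.augIdeal} (hx : (x : A.carrier) ∈ A.grading n) :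
    A.singleton x ∈ A.barGrading ((n : ℤ) - 1) :=
  Submodule.subset_span ⟨1, fun _ => n, fun _ => x, fun _ => hx, by simp, A.singleton_eq_word x⟩

theorem bar_ext {v w : A.Bar} (h : ∀ k, A.weight k v = A.weight k w) : v = w :=
  DFinsupp.ext h

theorem barD_mem {m : ℤ} {w : A.Bar} (hw : w ∈ A.barGrading m) :
    A.barD w ∈ A.barGrading (m + 1) := by
  refine Submodule.span_le (p := (A.barGrading (m + 1)).comap A.barD).2 ?_ hw
  rintro _ ⟨k, p, x, hx, hm, rfl⟩
  exact A.barD_ofWeight_mem (Submodule.subset_span ⟨p, x, hx, hm, rfl⟩)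

theorem exists_eq_add_singleton {w : A.Bar} {n : ℕ} (hw : w ∈ A.barGrading ((n : ℤ) - 1))
    (h : ∀ k, 1 < k → A.weight k w = 0) :
    ∃ a : A.augIdeal, (a : A.carrier) ∈ A.grading n ∧
      w = A.ofWeight 0 (A.weight 0 w) + A.singleton a := by
  obtain ⟨a, ha, haw⟩ := A.exists_eq_tprod_of_mem (A.weight_mem_tensorGrading 1 hw)
  refine ⟨a, ha, A.bar_ext fun k => ?_⟩
  rw [singleton_apply, ← haw, map_add]
  rcases lt_trichotomy k 1 with hk | rfl | hk
  · obtain rfl : k = 0 := by omega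
    rw [A.weight_ofWeight_of_ne one_ne_zero, weight_ofWeight_self, add_zero]
  · rw [weight_ofWeight_self, A.weight_ofWeight_of_ne zero_ne_one, zero_add]
  · rw [A.weight_ofWeight_of_ne hk.ne, A.weight_ofWeight_of_ne (by omega), h k hk, add_zero]

/-- The map `ω ↦ |ω|` on cocycles. -/
def weightOneHom {n : ℕ} (hn : n ≠ 0) : A.cocycles n →ₗ[R] A.barCocycles ((n : ℤ) - 1) where
  toFun := A.weightOne hn
  map_add' ω η := Subtype.ext <| by
    change A.word _ = A.word _ + A.word _
    rw [← singleton_eq_word, ← singleton_eq_word, ← singleton_eq_word, ← map_add]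
    rfl
  map_smul' r ω := Subtype.ext <| by
    change A.word _ = r • A.word _
    rw [← singleton_eq_word, ← singleton_eq_word, ← map_smul]
    rfl

/-- The map which sends a cocycle `ω` to the class of `|ω|`. -/
def barClsWeightOne {n : ℕ} (hn : n ≠ 0) : A.cocycles n →ₗ[R] A.barCohomology ((n : ℤ) - 1) :=
  Submodule.mkQ _ ∘ₗ A.weightOneHom hn

theorem coe_weightOne {n : ℕ} (hn : n ≠ 0) (ω : A.cocycles n) :
    (A.weightOne hn ω : A.Bar) = A.singleton (A.letter hn ω) :=
  (A.singleton_eq_word _).symm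

/-- Coboundaries were defined without a degree condition; since $d$ is homogeneous, the component of
degree $n$ of a primitive is a primitive. -/
theorem exists_d_eq_of_mem {n : ℕ} {ω : A.carrier} (hω : ω ∈ A.grading (n + 1))
    (h : ω ∈ LinearMap.range A.d) : ∃ a ∈ A.grading n, A.d a = ω := by
  obtain ⟨a, rfl⟩ := h
  refine ⟨DirectSum.decompose A.grading a n, SetLike.coe_mem _, ?_⟩
  have key : ∀ a : A.carrier, A.d (DirectSum.decompose A.grading a n) =
      DirectSum.decompose A.grading (A.d a) (n + 1) := fun a => by
    induction a using DirectSum.Decomposition.inductionOn A.grading with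
    | zero => simp
    | @homogeneous p a =>
      rw [DirectSum.decompose_coe]
      rcases eq_or_ne p n with rfl | hp
      · rw [DirectSum.of_eq_same, DirectSum.decompose_of_mem_same _ (A.d_mem a.2)]
      · rw [DirectSum.of_eq_of_ne _ _ _ hp.symm, DirectSum.decompose_of_mem_ne _ (A.d_mem a.2)
          (by omega), ZeroMemClass.coe_zero, map_zero]
    | add a b ha hb => simp [ha, hb]
  rw [key, DirectSum.decompose_of_mem_same _ hω]

variable {A}

/-- The cocycle is reduced to weight at most one. Its weight zero part has degree $n-1\neq 0$ and
hence vanishes, and the remaining letter is closed since words of weight one embed the augmentation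
ideal. -/
theorem exists_weightOne_eq {n : ℕ} (hn : 2 ≤ n) (hn0 : n ≠ 0) (h : A.signedComplex.PartialContraction n)
    (γ : A.barCocycles ((n : ℤ) - 1)) :
    ∃ ω : A.cocycles n, A.barCls (A.weightOne hn0 ω) = A.barCls γ := by
  have hγ : A.barD γ = 0 := γ.2.2
  obtain ⟨v, hv, hk⟩ := A.exists_sub_barD_weight_le_one hn h le_rfl γ.2.1
    (fun k _ => by rw [hγ, map_zero])
  have hw : (γ : A.Bar) - A.barD v ∈ A.barGrading ((n : ℤ) - 1) :=
    sub_mem γ.2.1 (by simpa using A.barD_mem hv)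
  obtain ⟨a, ha, haw⟩ := A.exists_eq_add_singleton hw hk
  rw [A.tensorGrading_zero (by omega) (A.weight_mem_tensorGrading 0 hw), map_zero, zero_add] at haw
  have hd : A.dBar a = 0 := A.singleton_injective <| by
    rw [← barD_singleton, ← haw, map_sub, hγ, barD_barD, sub_zero, map_zero]
  refine ⟨⟨a, ha, congrArg Subtype.val hd⟩, ?_⟩
  refine (Submodule.Quotient.eq _).2 ⟨-v, neg_mem hv, ?_⟩
  change A.barD (-v) = A.word _ - (γ : A.Bar)
  rw [← singleton_eq_word, map_neg, eq_sub_iff_add_eq, neg_add_eq_sub, haw]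
  rfl

/-- Products could make $|\omega|$ bound without $\omega$ bounding. But a bounding element has
degree $n-2$, so it can be reduced to weight at most one, where only the internal differential is
left. -/
theorem barCls_weightOne_eq_zero_iff {n : ℕ} (hn : 2 ≤ n) (hn0 : n ≠ 0)
    (h : A.signedComplex.PartialContraction n) (ω : A.cocycles n) :
    A.barCls (A.weightOne hn0 ω) = 0 ↔ (ω : A.carrier) ∈ LinearMap.range A.d := by
  obtain ⟨m, rfl⟩ : ∃ m, n = m + 1 := ⟨n - 1, by omega⟩
  have e : ((m + 1 : ℕ) : ℤ) - 1 - 1 = (m : ℤ) - 1 := by push_cast; ring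
  refine (Submodule.Quotient.mk_eq_zero _).trans ⟨?_, fun hω => ?_⟩
  · rintro ⟨y, hy, hyω⟩
    replace hyω : A.barD y = A.singleton (A.letter hn0 ω) :=
      hyω.trans (A.coe_weightOne _ ω)
    rw [SetLike.mem_coe, e] at hy
    obtain ⟨v, hv, hk⟩ := A.exists_sub_barD_weight_le_one hn h (by push_cast; omega) hy
      (fun k hk => by rw [hyω, singleton_apply, A.weight_ofWeight_of_ne hk.ne])
    obtain ⟨a, -, haw⟩ := A.exists_eq_add_singleton
      (sub_mem hy (by simpa using A.barD_mem hv)) hk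
    -- For $n=2$ the weight zero part may be nonzero, but its differential vanishes.
    have hd := congrArg A.barD haw
    rw [map_sub, barD_barD, sub_zero, hyω, map_add, barD_ofWeight_zero, zero_add,
      barD_singleton] at hd
    exact ⟨a, congrArg Subtype.val (A.singleton_injective hd).symm⟩
  · obtain ⟨a, ha, haω⟩ := A.exists_d_eq_of_mem ω.2.1 hω
    have hm : m ≠ 0 := by omega
    -- Here $n\ge 2$ is used: a primitive of degree $n-1>0$ lies in the augmentation ideal
    -- automatically.
    let a' : A.augIdeal := ⟨a, A.aug_of_mem ha hm⟩
    refine ⟨A.singleton a', ?_, ?_⟩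
    · rw [SetLike.mem_coe, e]
      exact A.singleton_mem ha
    · refine (A.barD_singleton a').trans (Eq.trans ?_ (A.coe_weightOne _ ω).symm)
      exact congrArg A.singleton (Subtype.ext haω)

/-- In the presence of a contraction in low degrees, the cohomology of the bar construction in
degree `n - 1` is the cohomology in degree `n`. -/
def cohomologyEquivBar {n : ℕ} (hn : 2 ≤ n) (hn0 : n ≠ 0) (h : A.signedComplex.PartialContraction n) :
    A.cohomology n ≃ₗ[R] A.barCohomology ((n : ℤ) - 1) :=
  Submodule.quotEquivOfEq _ (LinearMap.ker (A.barClsWeightOne _)) (Submodule.ext fun ω =>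
    (barCls_weightOne_eq_zero_iff hn hn0 h ω).symm) ≪≫ₗ
    LinearMap.quotKerEquivOfSurjective (A.barClsWeightOne hn0) (fun γ => by
        obtain ⟨γ, rfl⟩ := Submodule.Quotient.mk_surjective _ γ
        exact exists_weightOne_eq hn hn0 h γ)

theorem cohomologyEquivBar_cls {n : ℕ} (hn : 2 ≤ n) (hn0 : n ≠ 0) (h : A.signedComplex.PartialContraction n)
    (ω : A.cocycles n) :
    cohomologyEquivBar hn hn0 h (A.cls ω) = A.barCls (A.weightOne hn0 ω) := rfl

end AugDGAlgebra

end

noncomputable section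

/-! ### The cochains of the sphere -/

open CategoryTheory Simplicial Opposite

open scoped DirectSum TensorProduct

theorem LinearEquiv.span_singleton_eq_top {R M N : Type*} [Semiring R] [AddCommMonoid M]
    [AddCommMonoid N] [Module R M] [Module R N] (f : M ≃ₗ[R] N) {x : M}
    (hx : Submodule.span R {x} = ⊤) : Submodule.span R {f x} = ⊤ := by
  rw [← Set.image_singleton, ← LinearEquiv.coe_coe, Submodule.span_image, hx,
    Submodule.map_top, LinearEquiv.range]

namespace AugDGAlgebra

variable {R : Type u} [CommRing R] (A : AugDGAlgebra.{u, v} R)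

theorem dBar_toAugIdeal (a : A.carrier) : A.dBar (A.toAugIdeal a) = A.toAugIdeal (A.d a) := by
  ext
  rw [coe_dBar, coe_toAugIdeal, coe_toAugIdeal, map_sub, d_algebraMap, aug_d, map_zero]

theorem toAugIdeal_algebraMap (r : R) : A.toAugIdeal (algebraMap R A.carrier r) = 0 := by
  ext
  rw [coe_toAugIdeal, AlgHom.commutes, Algebra.algebraMap_self_apply, sub_self,
    ZeroMemClass.coe_zero]

/-- A contraction up to constants gives a contraction of the augmentation ideal. -/
def partialContraction {n : ℕ} (h : A.carrier →ₗ[R] A.carrier)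
    (h0 : ∀ a ∈ A.grading 0, h a = 0) (hmem : ∀ p, ∀ a ∈ A.grading (p + 1), h a ∈ A.grading p)
    (hd : ∀ p < n, ∀ a ∈ A.grading p,
      ∃ c : R, A.d (h a) + h (A.d a) = a - algebraMap R A.carrier c) :
    A.signedComplex.PartialContraction n where
  h := A.toAugIdeal ∘ₗ h ∘ₗ A.augIdeal.subtype
  of_mem_zero x hx := (congrArg A.toAugIdeal (h0 x hx)).trans (map_zero _)
  mem p x hx := A.toAugIdeal_mem (hmem p x hx)
  homotopy p hp x hx := by
    obtain ⟨c, hc⟩ := hd p hp x hx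
    change A.dBar (A.toAugIdeal (h x)) + A.toAugIdeal (h (A.d x)) = x
    rw [dBar_toAugIdeal, ← map_add, hc, map_sub, toAugIdeal_algebraMap, sub_zero, toAugIdeal_coe]

theorem bar_generated_by_weightOne {n : ℕ} (hn : 2 ≤ n) (hn0 : n ≠ 0)
    (h : Nonempty (A.signedComplex.PartialContraction n)) (he : Nonempty (A.cohomology n ≃ₗ[R] R)) :
    Nonempty (A.barCohomology ((n : ℤ) - 1) ≃ₗ[R] R) ∧
      (∃ ω : A.cocycles n, Submodule.span R {A.cls ω} = ⊤) ∧
      ∀ ω : A.cocycles n, Submodule.span R {A.cls ω} = ⊤ →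
        Submodule.span R {A.barCls (A.weightOne hn0 ω)} = ⊤ := by
  obtain ⟨h⟩ := h
  obtain ⟨e⟩ := he
  refine ⟨⟨(cohomologyEquivBar hn hn0 h).symm ≪≫ₗ e⟩, ?_, fun ω hω => ?_⟩
  · obtain ⟨ω, hω⟩ := Submodule.Quotient.mk_surjective _ (e.symm 1)
    refine ⟨ω, ?_⟩
    rw [cls, hω]
    exact e.symm.span_singleton_eq_top Ideal.span_singleton_one
  · rw [← cohomologyEquivBar_cls hn hn0 h]
    exact LinearEquiv.span_singleton_eq_top _ hω

end AugDGAlgebra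

/-! ### Contraction and top cohomology of the singular cochains -/

namespace SSetCochain

open SingChain

variable {R : Type u} [CommRing R] {X : TopCat.{0}}

/-- The dual contraction on the direct sum of the cochain groups. -/
def totalCocontraction (R : Type u) [CommRing R] (X : TopCat.{0}) :
    (⨁ k, SSetCochain (TopCat.toSSet.obj X) R k) →ₗ[R]
      ⨁ k, SSetCochain (TopCat.toSSet.obj X) R k :=
  DirectSum.toModule R ℕ _ fun k => match k with
    | 0 => 0
    | k + 1 => DirectSum.lof R ℕ (SSetCochain (TopCat.toSSet.obj X) R) k ∘ₗ cocontraction R X k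

theorem totalCocontraction_lof_zero (φ : SSetCochain (TopCat.toSSet.obj X) R 0) :
    totalCocontraction R X (DirectSum.lof R ℕ (SSetCochain (TopCat.toSSet.obj X) R) 0 φ) = 0 := by
  simp [totalCocontraction]

theorem totalCocontraction_lof_succ {k : ℕ} (φ : SSetCochain (TopCat.toSSet.obj X) R (k + 1)) :
    totalCocontraction R X (DirectSum.lof R ℕ (SSetCochain (TopCat.toSSet.obj X) R) (k + 1) φ) =
      DirectSum.lof R ℕ (SSetCochain (TopCat.toSSet.obj X) R) k (cocontraction R X k φ) := by
  simp [totalCocontraction]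

theorem exists_totalD_totalCocontraction {n : ℕ}
    (hX : HasSphereHomology R (Set.univ : Set X) (n + 1)) {p : ℕ} (hp : p < n)
    (φ : SSetCochain (TopCat.toSSet.obj X) R p) :
    ∃ c : R, totalD _ R (totalCocontraction R X (DirectSum.lof R ℕ _ p φ)) +
      totalCocontraction R X (totalD _ R (DirectSum.lof R ℕ _ p φ)) =
        DirectSum.lof R ℕ _ p φ -
          DirectSum.lof R ℕ (SSetCochain (TopCat.toSSet.obj X) R) 0 (const c) := by
  rw [totalD_lof, totalCocontraction_lof_succ]
  cases p with
  | zero =>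
    obtain ⟨c, hc⟩ := exists_cocontraction_coboundary_zero hX (by omega) φ
    refine ⟨c, ?_⟩
    rw [totalCocontraction_lof_zero, hc, map_zero, zero_add, map_sub]
  | succ p =>
    -- A correction by a constant occurs only in degree 0.
    refine ⟨0, ?_⟩
    rw [totalCocontraction_lof_succ, totalD_lof, ← map_add,
      coboundary_cocontraction hX (by omega), show (const 0 : SSetCochain _ R 0) = 0 from rfl,
      map_zero, sub_zero]

theorem algebraMap_eq_lof_const (b : X) (r : R) :
    algebraMap R (singularCochains R X b).carrier r =
      DirectSum.lof R ℕ (SSetCochain (TopCat.toSSet.obj X) R) 0 (const r) := by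
  have h : (const r : SSetCochain (TopCat.toSSet.obj X) R 0) = r • const 1 :=
    funext fun _ => (mul_one r).symm
  rw [h, map_smul, Algebra.algebraMap_eq_smul_one]
  rfl

/-- The contraction of the cochains of a space with the homology of a sphere, below the top
degree. -/
def partialContraction {n : ℕ} (hX : HasSphereHomology R (Set.univ : Set X) (n + 1)) (b : X) :
    (singularCochains R X b).signedComplex.PartialContraction n :=
  (singularCochains R X b).partialContraction (totalCocontraction R X)
    (by
      rintro _ ⟨φ, rfl⟩
      exact totalCocontraction_lof_zero φ)
    (by
      rintro p _ ⟨φ, rfl⟩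
      exact ⟨_, (totalCocontraction_lof_succ φ).symm⟩)
    (by
      rintro p hp _ ⟨φ, rfl⟩
      obtain ⟨c, hc⟩ := exists_totalD_totalCocontraction hX hp φ
      exact ⟨c, hc.trans (congrArg (_ - ·) (algebraMap_eq_lof_const b c).symm)⟩)

/-- The value of a cochain of degree `n` on a chain. -/
def evalChain (b : X) {n : ℕ} (z : SingChain R X (n + 1)) :
    (singularCochains R X b).carrier →ₗ[R] R :=
  LinearMap.applyₗ z ∘ₗ (dual R X n).toLinearMap ∘ₗ
    DirectSum.component R ℕ (SSetCochain (TopCat.toSSet.obj X) R) n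

theorem evalChain_lof (b : X) {n : ℕ} (z : SingChain R X (n + 1))
    (φ : SSetCochain (TopCat.toSSet.obj X) R n) :
    evalChain b z (DirectSum.lof R ℕ (SSetCochain (TopCat.toSSet.obj X) R) n φ) =
      dual R X n φ z :=
  congrArg (fun φ => dual R X n φ z) (DirectSum.component.lof_self R n φ)

/-- The functional `ρ` vanishes on boundaries, so its multiples are cocycles, and they take every
value on `z`. -/
theorem evalChain_surjective {n : ℕ} (b : X) {z : SingChain R X (n + 1)}
    {ρ : SingChain R X (n + 1) →ₗ[R] R} (hz : ρ z = 1) (hρ : ∀ y, ρ (bd (n + 1) y) = 0) :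
    Function.Surjective
      (evalChain b z ∘ₗ ((singularCochains R X b).cocycles n).subtype) := by
  intro r
  refine ⟨⟨DirectSum.lof R ℕ _ n ((dual R X n).symm (r • ρ)), ⟨_, rfl⟩, ?_⟩, ?_⟩
  · refine (totalD_lof n _).trans ?_
    have h : coboundary n ((dual R X n).symm (r • ρ)) = 0 := by
      apply (dual R X (n + 1)).injective
      rw [dual_coboundary, LinearEquiv.apply_symm_apply, map_zero]
      refine LinearMap.ext fun y => ?_
      rw [LinearMap.comp_apply, LinearMap.smul_apply, hρ, smul_zero, LinearMap.zero_apply]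
    rw [h, map_zero]
    rfl
  · refine (evalChain_lof b z _).trans ?_
    rw [LinearEquiv.apply_symm_apply, LinearMap.smul_apply, hz, smul_eq_mul, mul_one]

/-- A cocycle $\omega$ vanishes on boundaries. If also $\omega(z)=0$, the decomposition of chains
gives $\omega(x)=\omega(c\,\partial x)$, so $\omega$ is the coboundary of $\omega\circ c$. -/
theorem mem_range_d_iff {n : ℕ} (b : X) {z : SingChain R X (n + 2)}
    {ρ : SingChain R X (n + 2) →ₗ[R] R} (hz : bd (n + 1) z = 0)
    (hρ : ∀ x, ∃ y, x - contraction R X (n + 1) (bd (n + 1) x) = ρ x • z + bd (n + 2) y)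
    {ω : (singularCochains R X b).carrier} (hω : ω ∈ (singularCochains R X b).cocycles (n + 1)) :
    ω ∈ LinearMap.range (singularCochains R X b).d ↔ evalChain b z ω = 0 := by
  constructor
  · intro h
    obtain ⟨_, ⟨ψ, rfl⟩, rfl⟩ := (singularCochains R X b).exists_d_eq_of_mem hω.1 h
    refine (congrArg (evalChain b z) (totalD_lof n ψ)).trans ?_
    rw [evalChain_lof, dual_coboundary, LinearMap.comp_apply, hz, map_zero]
  · obtain ⟨⟨φ, rfl⟩, hd⟩ := hω
    intro h
    replace h : dual R X (n + 1) φ z = 0 := (evalChain_lof b z φ).symm.trans h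
    replace hd : coboundary (n + 1) φ = 0 := by
      refine DirectSum.of_injective (β := SSetCochain (TopCat.toSSet.obj X) R) (n + 2) ?_
      rw [map_zero]
      exact (totalD_lof (n + 1) φ).symm.trans hd
    refine ⟨DirectSum.lof R ℕ _ n (cocontraction R X n φ), (totalD_lof n _).trans ?_⟩
    congr 1
    apply (dual R X (n + 1)).injective
    rw [dual_coboundary, dual_cocontraction]
    refine LinearMap.ext fun x => ?_
    obtain ⟨y, hy⟩ := hρ x
    have := congrArg (dual R X (n + 1) φ) hy
    have h0 : dual R X (n + 1) φ (bd (n + 2) y) = 0 := by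
      rw [← LinearMap.comp_apply, ← dual_coboundary, hd, map_zero, LinearMap.zero_apply]
    rw [map_sub, map_add, map_smul, h, smul_zero, zero_add, h0, sub_eq_zero] at this
    exact this.symm

/-- The cohomology in the top degree of a space with the homology of a sphere. -/
theorem nonempty_cohomology_equiv {n : ℕ} (hn : n ≠ 0)
    (hX : HasSphereHomology R (Set.univ : Set X) (n + 1)) (b : X) :
    Nonempty ((singularCochains R X b).cohomology n ≃ₗ[R] R) := by
  obtain ⟨n, rfl⟩ := Nat.exists_eq_succ_of_ne_zero hn
  obtain ⟨z, hz, ρ, h1, h2, h3⟩ := exists_coefficient hX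
  let ε := evalChain b z ∘ₗ ((singularCochains R X b).cocycles (n + 1)).subtype
  exact ⟨Submodule.quotEquivOfEq _ (LinearMap.ker ε)
    (Submodule.ext fun ω => mem_range_d_iff b hz h3 ω.2) ≪≫ₗ
      ε.quotKerEquivOfSurjective (evalChain_surjective b h1 h2)⟩

end SSetCochain

end
theorem mainTheorem3 (R : Type*) [CommRing R] (n : ℕ) (hn : 2 ≤ n) (b : TopCat.sphere.{0} n) :
    let A : AugDGAlgebra R := singularCochains R (TopCat.sphere.{0} n) b
    Nonempty (A.barCohomology ((n : ℤ) - 1) ≃ₗ[R] R) ∧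
      (∃ ω : A.cocycles n, Submodule.span R {A.cls ω} = ⊤) ∧
      ∀ ω : A.cocycles n, Submodule.span R {A.cls ω} = ⊤ →
        Submodule.span R {A.barCls (A.weightOne (show n ≠ 0 by omega) ω)} = ⊤ := by
  have hX := SingChain.hasSphereHomology_sphere (R := R) n
  exact AugDGAlgebra.bar_generated_by_weightOne _ hn (by omega) ⟨SSetCochain.partialContraction hX b⟩
    (SSetCochain.nonempty_cohomology_equiv (by omega) hX b)
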